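/- **Theorem 1.2 (Laplace–Beltrami operator on the Baran simplex).** Let $n\ge 1$ and let $S^n=\{x\in\mathbb R^n: x_i>0\ \forall i,\ \sum_i x_i<1\}$ carry the Riemannian metric $g$ (the Baran metric of the simplex) with matrix $$G(x)=\operatorname{diag}(x_1^{-1},\dots,x_n^{-1})+\Big(1-\sum_i x_i\Big)^{-1}\mathbf 1\mathbf 1^{T}.$$ Let $\mu$ be the measure with density $\big((1-\sum_i x_i)\prod_i x_i\big)^{-1/2}$ on $S^n$ with respect to Lebesgue measure, and $\Delta u=\operatorname{div}(\operatorname{grad}u)=(\det G)^{-1/2}\sum_{i}\partial_i\big((\det G)^{1/2}\sum_j (G^{-1})_{ij}\,\partial_j u\big)$. For $\alpha\in\mathbb N^n$ (with $0\in\mathbb N$) put $|\alpha|=\sum_i\alpha_i$ and $$P_\alpha(x)=\prod_{j=1}^n\Big(1-\sum_{k<j}x_k\Big)^{\alpha_j}J_{\alpha_j}^{a_j,-1/2}\Big(\frac{2x_j}{1-\sum_{k<j}x_k}-1\Big),\qquad a_j=2\sum_{k=j+1}^n\alpha_k+\frac{n-j-1}2,$$ where $J_m^{a,b}$ is the Jacobi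 polynomial of degree $m$ for the weight $(1-t)^a(1+t)^b$ on $(-1,1)$; let $\psi_\alpha=P_\alpha/\|P_\alpha\|_{L^2(\mu)}$, $\hat u_\alpha=\int_{S^n}u\,\psi_\alpha\,d\mu$ and $\lambda_s=s\big(s+\frac{n-1}2\big)$ for $s\in\mathbb N$. Functions are complex valued. Then: 1. $G(x)$ is positive definite for every $x\in S^n$, $\mu$ is the Riemannian volume $\mathrm{Vol}_g$, and for every $u\in C^2(S^n)$ $$\Delta u=\mathcal D u:=\sum_i x_i(1-x_i)\,\partial_i^2u-2\sum_{i<j}x_ix_j\,\partial_i\partial_j u+\tfrac12\sum_i\big(1-(n+1)x_i\big)\partial_i u .$$ 2. Every $\psi_\alpha$ is (on $S^n$) a polynomial of total degree $|\alpha|$; the $\psi_\alpha$ are orthonormal in $L^2(\mu)$ and their linear span is dense in $L^2(S^n,g)=L^2(\mu)$. 3. Let $C^2_b(S^n)$ be the space of $C^2$ functions on $S^n$ which are bounded together with their partial derivatives of order at most two. For $u\in C^2_b(S^n)$ both $u$ and $\Delta u$ are in $L^2(S^n,g)$, and $\Delta$ with domain $C^2_b(S^n)$ is a well-defined, densely defined,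 symmetric, unbounded operator in $L^2(S^n,g)$. The set of eigenvalues of $-\Delta$ on $C^2_b(S^n)$ is $\{\lambda_s:s\in\mathbb N\}$, and the eigenspace of $\lambda_s$ is $\operatorname{span}\{\psi_\alpha:|\alpha|=s\}$. 4. $\Delta$ is closable, and its closure $\overline\Delta$ is self-adjoint. The spectrum of $-\overline\Delta$ is $\{\lambda_s:s\in\mathbb N\}$, with the same eigenspaces $\operatorname{span}\{\psi_\alpha:|\alpha|=s\}$, and $$\mathcal D(\overline\Delta)=\Big\{u\in L^2(S^n,g):\sum_{s=0}^\infty\lambda_s^2\sum_{|\alpha|=s}|\hat u_\alpha|^2<\infty\Big\}\subset H^1(S^n,g).$$ 5. $-\overline\Delta$ has exactly one nonnegative self-adjoint square root $(-\overline\Delta)^{1/2}$, and $$\mathcal D\big((-\overline\Delta)^{1/2}\big)=\Big\{u\in L^2(S^n,g):\sum_{s=0}^\infty\lambda_s\sum_{|\alpha|=s}|\hat u_\alpha|^2<\infty\Big\}=H^1(S^n,g).$$ Here $H^1(S^n,g)\subset L^2(S^n,g)$ is the completion of $\{u\in C^\infty(S^n):\|u\|_{1,2}<\infty\}$ in the norm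 $\|u\|_{1,2}=\big(\int|u|^2\,d\mathrm{Vol}_g\big)^{1/2}+\big(\int|\operatorname{grad}u|_g^2\,d\mathrm{Vol}_g\big)^{1/2}$, i.e. the set of $L^2$ limits of $\|\cdot\|_{1,2}$-Cauchy sequences of such functions. -/

import Mathlib

open MeasureTheory
open scoped ContDiff

noncomputable section

/-- Partial derivative `∂ᵢ u` of a complex-valued function on `ℝⁿ`. -/
def partialDeriv {n : ℕ} (i : Fin n) (u : (Fin n → ℝ) → ℂ) : (Fin n → ℝ) → ℂ :=
  fun x => fderiv ℝ u x (Pi.single i 1)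

/-! ### Riemannian operators in a global chart

A Riemannian metric on an open subset of `ℝⁿ` is represented by its matrix function `G`. -/

/-- Components `(grad u)ⁱ = ∑ⱼ gⁱʲ ∂ⱼ u` of the gradient. -/
def riemGrad {n : ℕ} (G : (Fin n → ℝ) → Matrix (Fin n) (Fin n) ℝ) (u : (Fin n → ℝ) → ℂ)
    (x : Fin n → ℝ) (i : Fin n) : ℂ :=
  ∑ j, (((G x)⁻¹ i j : ℝ) : ℂ) * partialDeriv j u x

/-- Divergence `(det g)^(-1/2) ∑ᵢ ∂ᵢ ((det g)^(1/2) Xⁱ)` of a vector field. -/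
def riemDiv {n : ℕ} (G : (Fin n → ℝ) → Matrix (Fin n) (Fin n) ℝ)
    (X : (Fin n → ℝ) → Fin n → ℂ) (x : Fin n → ℝ) : ℂ :=
  ((1 / Real.sqrt (G x).det : ℝ) : ℂ) *
    ∑ i, partialDeriv i (fun y => ((Real.sqrt (G y).det : ℝ) : ℂ) * X y i) x

/-- The Laplace–Beltrami operator `Δ u = div (grad u)`. -/
def laplaceBeltrami {n : ℕ} (G : (Fin n → ℝ) → Matrix (Fin n) (Fin n) ℝ)
    (u : (Fin n → ℝ) → ℂ) : (Fin n → ℝ) → ℂ :=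
  riemDiv G (riemGrad G u)

/-- `|grad u|²_g = ∑ᵢⱼ gᵢⱼ (grad u)ⁱ conj ((grad u)ʲ)`. -/
def riemGradNormSq {n : ℕ} (G : (Fin n → ℝ) → Matrix (Fin n) (Fin n) ℝ)
    (u : (Fin n → ℝ) → ℂ) (x : Fin n → ℝ) : ℝ :=
  (∑ i, ∑ j, ((G x i j : ℝ) : ℂ) * riemGrad G u x i *
    (starRingEnd ℂ) (riemGrad G u x j)).re

/-- The Riemannian volume measure `(det g)^(1/2) dx` on `M ⊆ ℝⁿ`. -/
def riemVolume {n : ℕ} (M : Set (Fin n → ℝ)) (G : (Fin n → ℝ) → Matrix (Fin n) (Fin n) ℝ) :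
    Measure (Fin n → ℝ) :=
  (volume.restrict M).withDensity fun x => ENNReal.ofReal (Real.sqrt (G x).det)

/-- The Hilbert space `L²(M, g)` of complex-valued functions. -/
abbrev RiemL2 {n : ℕ} (M : Set (Fin n → ℝ)) (G : (Fin n → ℝ) → Matrix (Fin n) (Fin n) ℝ) :
    Type :=
  Lp ℂ 2 (riemVolume M G)

/-- The norm `‖u‖₁,₂ = (∫ |u|²)^(1/2) + (∫ |grad u|²_g)^(1/2)`, with values in `[0, ∞]`. -/
def sobolevNorm {n : ℕ} (M : Set (Fin n → ℝ)) (G : (Fin n → ℝ) → Matrix (Fin n) (Fin n) ℝ)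
    (u : (Fin n → ℝ) → ℂ) : ENNReal :=
  eLpNorm u 2 (riemVolume M G) +
    (∫⁻ x, ENNReal.ofReal (riemGradNormSq G u x) ∂(riemVolume M G)) ^ (1 / 2 : ℝ)

/-- The smooth functions on the open set `M` with `‖u‖₁,₂ < ∞`. -/
def SmoothSobolev {n : ℕ} (M : Set (Fin n → ℝ)) (G : (Fin n → ℝ) → Matrix (Fin n) (Fin n) ℝ) :
    Set ((Fin n → ℝ) → ℂ) :=
  {u | ContDiffOn ℝ ∞ u M ∧ sobolevNorm M G u < ⊤}

/-- The Sobolev space `H¹(M, g)`, as a subset of `L²(M, g)`: the `L²` limits of the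
`‖·‖₁,₂`-Cauchy sequences of smooth functions with `‖·‖₁,₂ < ∞`. -/
def SobolevH1 {n : ℕ} (M : Set (Fin n → ℝ)) (G : (Fin n → ℝ) → Matrix (Fin n) (Fin n) ℝ) :
    Set (RiemL2 M G) :=
  {f | ∃ φ : ℕ → (Fin n → ℝ) → ℂ,
    (∀ k, φ k ∈ SmoothSobolev M G) ∧
    (∀ ε : ENNReal, 0 < ε → ∃ N, ∀ k ≥ N, ∀ l ≥ N, sobolevNorm M G (φ k - φ l) ≤ ε) ∧
    Filter.Tendsto (fun k => eLpNorm (φ k - (f : (Fin n → ℝ) → ℂ)) 2 (riemVolume M G))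
      Filter.atTop (nhds 0)}

/-! ### Unbounded operators -/

/-- The eigenspace `{f ∈ D(T) : T f = z f}`. -/
def opEigenspace {H : Type*} [NormedAddCommGroup H] [InnerProductSpace ℂ H]
    (T : H →ₗ.[ℂ] H) (z : ℂ) : Set H :=
  {f | ∃ hf : f ∈ T.domain, T ⟨f, hf⟩ = z • f}

/-- The set of eigenvalues of `T`. -/
def opEigenvalues {H : Type*} [NormedAddCommGroup H] [InnerProductSpace ℂ H]
    (T : H →ₗ.[ℂ] H) : Set ℂ :=
  {z | ∃ f ∈ opEigenspace T z, f ≠ 0}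

/-- The spectrum of `T`: those `z` for which `T - z : D(T) → H` has no bounded inverse
`R : H → D(T)`. -/
def opSpectrum {H : Type*} [NormedAddCommGroup H] [InnerProductSpace ℂ H]
    (T : H →ₗ.[ℂ] H) : Set ℂ :=
  {z | ¬ ∃ R : H →L[ℂ] H,
    (∀ f, ∃ hf : R f ∈ T.domain, T ⟨R f, hf⟩ - z • R f = f) ∧
    (∀ u : T.domain, R (T u - z • (u : H)) = u)}

/-- `B` is a nonnegative self-adjoint square root of `A`: `B ∘ B = A`, where `B ∘ B` has the
domain `{u ∈ D(B) : B u ∈ D(B)}`. -/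
def IsPosSqrt {H : Type*} [NormedAddCommGroup H] [InnerProductSpace ℂ H] [CompleteSpace H]
    (B A : H →ₗ.[ℂ] H) : Prop :=
  IsSelfAdjoint B ∧
  (∀ u : B.domain, 0 ≤ (inner ℂ (u : H) (B u)).re) ∧
  (∀ u v : H, (u, v) ∈ A.graph ↔ ∃ w, (u, w) ∈ B.graph ∧ (w, v) ∈ B.graph)

/-! ### The simplex -/

/-- The open simplex `{x ∈ ℝⁿ : xᵢ > 0, ∑ xᵢ < 1}`. -/
def openSimplex (n : ℕ) : Set (Fin n → ℝ) :=
  {x | (∀ i, 0 < x i) ∧ ∑ i, x i < 1}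

/-- The Baran metric of the simplex, `diag (1 / xᵢ) + (1 - ∑ xᵢ)⁻¹ 𝟙 𝟙ᵀ`. -/
def baranSimplex (n : ℕ) (x : Fin n → ℝ) : Matrix (Fin n) (Fin n) ℝ :=
  Matrix.diagonal (fun i => (x i)⁻¹) + (1 - ∑ i, x i)⁻¹ • Matrix.of fun _ _ => (1 : ℝ)

/-- The measure `((1 - ∑ xᵢ) ∏ xᵢ)^(-1/2) dx` on the open simplex. -/
def simplexMeasure (n : ℕ) : Measure (Fin n → ℝ) :=
  (volume.restrict (openSimplex n)).withDensity fun x =>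
    ENNReal.ofReal (1 / Real.sqrt ((1 - ∑ i, x i) * ∏ i, x i))

/-- `L²(Sⁿ, g)` for the open simplex with its Baran metric. -/
abbrev SimplexL2 (n : ℕ) : Type := RiemL2 (openSimplex n) (baranSimplex n)

/-- `C²_b(Sⁿ)`: the `C²` functions on the open simplex that are bounded together with their
partial derivatives of order at most two. -/
def C2b (n : ℕ) : Set ((Fin n → ℝ) → ℂ) :=
  {u | ContDiffOn ℝ 2 u (openSimplex n) ∧
    ∃ C : ℝ, ∀ x ∈ openSimplex n,
      ‖u x‖ ≤ C ∧ (∀ i, ‖partialDeriv i u x‖ ≤ C) ∧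
      (∀ i j, ‖partialDeriv i (partialDeriv j u) x‖ ≤ C)}

/-- The Dunkl–Xu operator
`∑ᵢ xᵢ (1 - xᵢ) ∂ᵢ² - 2 ∑_{i<j} xᵢ xⱼ ∂ᵢ ∂ⱼ + (1/2) ∑ᵢ (1 - (n+1) xᵢ) ∂ᵢ`. -/
def dunklXu (n : ℕ) (u : (Fin n → ℝ) → ℂ) (x : Fin n → ℝ) : ℂ :=
  ∑ i, ((x i * (1 - x i) : ℝ) : ℂ) * partialDeriv i (partialDeriv i u) x
    - 2 * ∑ i, ∑ j ∈ Finset.Ioi i,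
        ((x i * x j : ℝ) : ℂ) * partialDeriv i (partialDeriv j u) x
    + (1 / 2) * ∑ i, ((1 - (n + 1) * x i : ℝ) : ℂ) * partialDeriv i u x

/-- The Jacobi polynomial of degree `m` with parameters `a, b`, evaluated at `t`, for the weight
`(1 - t)^a (1 + t)^b`:
`(1 / m!) ∑ₖ C(m,k) (m + a + b + 1)ₖ (a + k + 1)_{m-k} ((t - 1) / 2)^k`,
with rising factorials `(c)ₖ = c (c + 1) ⋯ (c + k - 1)`. -/
def jacobiP (m : ℕ) (a b t : ℝ) : ℝ :=
  (1 / (m.factorial : ℝ)) * ∑ k ∈ Finset.range (m + 1),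
    (m.choose k : ℝ) * (ascPochhammer ℝ k).eval (m + a + b + 1) *
      (ascPochhammer ℝ (m - k)).eval (a + k + 1) * ((t - 1) / 2) ^ k

/-- `|α| = ∑ αᵢ`. -/
def multiDeg {n : ℕ} (α : Fin n → ℕ) : ℕ := ∑ i, α i

/-- The orthogonal polynomial
`∏ⱼ (1 - ∑_{k<j} xₖ)^{αⱼ} J_{αⱼ}^{aⱼ,-1/2} (2 xⱼ / (1 - ∑_{k<j} xₖ) - 1)`, where
`aⱼ = 2 ∑_{k>j} αₖ + (n - j - 1) / 2` for `j = 1, …, n`; the index `j : Fin n` of the code is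
one less than this `j`. -/
def simplexPoly {n : ℕ} (α : Fin n → ℕ) (x : Fin n → ℝ) : ℝ :=
  ∏ j : Fin n, (1 - ∑ k ∈ Finset.Iio j, x k) ^ α j *
    jacobiP (α j) (2 * (∑ k ∈ Finset.Ioi j, (α k : ℝ)) + ((n : ℝ) - ((j : ℕ) + 1) - 1) / 2)
      (-1 / 2) (2 * x j / (1 - ∑ k ∈ Finset.Iio j, x k) - 1)

/-- The normalized polynomial `ψ_α`. -/
def psi {n : ℕ} (α : Fin n → ℕ) (x : Fin n → ℝ) : ℝ :=
  simplexPoly α x / Real.sqrt (∫ y, simplexPoly α y ^ 2 ∂(simplexMeasure n))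

/-- The elements of `L²(Sⁿ, g)` represented by some `ψ_α` with `|α| = s`. -/
def psiClasses (n s : ℕ) : Set (SimplexL2 n) :=
  {f | ∃ α : Fin n → ℕ, multiDeg α = s ∧
    (f : (Fin n → ℝ) → ℂ) =ᵐ[riemVolume (openSimplex n) (baranSimplex n)]
      fun x => ((psi α x : ℝ) : ℂ)}

/-- The Fourier coefficient `û_α = ∫ u ψ_α dμ`. -/
def fourierCoeffSimplex {n : ℕ} (u : SimplexL2 n) (α : Fin n → ℕ) : ℂ :=
  ∫ x, (u : (Fin n → ℝ) → ℂ) x * ((psi α x : ℝ) : ℂ) ∂(simplexMeasure n)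

/-- `λ_s = s (s + (n - 1) / 2)`. -/
def simplexEigenvalue (n s : ℕ) : ℝ := s * (s + ((n : ℝ) - 1) / 2)

end

/-! The analysis reduces to one abstract fact: a symmetric operator whose domain contains a Hilbert
basis of eigenvectors with real eigenvalues has as closure the maximal diagonal operator in that
basis (`closure_eq_diagOp`). Domain, self-adjointness, spectrum, eigenspaces and the unique
nonnegative square root of the closure are then read off from coefficients. So two things are
needed: symmetry of `Δ` on `C²_b`, and the eigenbasis.

Symmetry. The inverse metric is `diag x - x xᵀ`, and the density is `ρ^(-1/2)`, where `ρ` is the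
product of the `n + 1` barycentric coordinates. Paired with `grad v`, the singular form `d log ρ`
becomes `∑ ∂ᵢ v - (n + 1) E v`, where `E = ∑ xᵢ ∂ᵢ`, and this is bounded when the first derivatives
of `v` are (`sum_partialDeriv_simplexCutoff_mul`). Hence the cutoffs `φ(k ρ)` cost nothing in the
limit, and Green's formula holds without boundary conditions (`integral_gradPairing_eq_neg`). Only
one of its two functions has to be in `C²_b`.

Eigenbasis. In terms of the Euler operator, the Dunkl–Xu operator is a degree-lowering operator
minus `E (E + (n - 1) / 2)`, so it acts on degree `s` as `-λ_s` modulo lower degree. The map `(t, y)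
↦ (t, (1 - t) y)` turns the simplex measure into a beta measure times the simplex measure of one
dimension less (`simplexMeasure_succ`). Along it `P_α` separates, and Jacobi orthogonality gives by
induction that the `P_α` are mutually orthogonal and orthogonal to all polynomials of lower degree.
The remainder `Δψ_α + λψ_α` has degree below `|α|` and, by symmetry, is orthogonal to every such
polynomial; so it is zero (`dunklPoly_psiPolyC`). Completeness follows from a dimension count in
each degree and Stone–Weierstrass.

`H¹`. Green's formula against finite sums of eigenfunctions gives a Bessel inequality for the
Dirichlet energy, `∑ λ |û|² ≤ ∫ |grad u|²`, which puts `H¹` inside the domain of the square root.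
Conversely, partial sums of the expansion are polynomials and are Cauchy in the Sobolev norm when `∑
λ |û|²` converges. -/

/-! ### Operators that are diagonal in a Hilbert basis -/

section Diagonal

variable {ι H : Type*} [NormedAddCommGroup H] [InnerProductSpace ℂ H]

/-- The graph of the diagonal operator `b i ↦ μ i • b i`. -/
def diagGraph (b : HilbertBasis ι ℂ H) (μ : ι → ℝ) : Submodule ℂ (H × H) where
  carrier := {p | ∀ i, b.repr p.2 i = μ i * b.repr p.1 i}
  add_mem' := by
    intro p q hp hq i
    have h1 := hp i
    have h2 := hq i
    simp only [Prod.snd_add, Prod.fst_add, map_add, lp.coeFn_add, Pi.add_apply, h1, h2]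
    ring
  zero_mem' := by intro i; simp
  smul_mem' := by
    intro c p hp i
    have h1 := hp i
    simp only [Prod.smul_snd, Prod.smul_fst, map_smul, lp.coeFn_smul, Pi.smul_apply, h1,
      smul_eq_mul]
    ring

/-- The maximal operator with `b i ↦ μ i • b i`. -/
noncomputable def diagOp (b : HilbertBasis ι ℂ H) (μ : ι → ℝ) : H →ₗ.[ℂ] H :=
  (diagGraph b μ).toLinearPMap

variable (b : HilbertBasis ι ℂ H) (μ : ι → ℝ)

theorem HilbertBasis.eq_zero_of_repr {u : H} (h : ∀ i, b.repr u i = 0) : u = 0 := by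
  have : b.repr u = 0 := by
    ext i
    simpa using h i
  simpa using this

/-- `Submodule.toLinearPMap` has the intended graph only for a single-valued relation; here a pair
`(0, v)` forces all coefficients of `v` to vanish. -/
theorem mem_diagOp_graph {u v : H} :
    (u, v) ∈ (diagOp b μ).graph ↔ ∀ i, b.repr v i = μ i * b.repr u i := by
  unfold diagOp
  rw [Submodule.toLinearPMap_graph_eq]
  · rfl
  · rintro ⟨x, y⟩ hx h0
    simp only at h0
    refine b.eq_zero_of_repr fun i => ?_
    have h1 := hx i
    simpa [h0] using h1

theorem repr_basis_eq_ite [DecidableEq ι] (i j : ι) :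
    b.repr (b i) j = if j = i then 1 else 0 := by
  rw [b.repr_self, lp.single_apply]
  split_ifs with h
  · subst h; simp
  · simp [h]

theorem basis_mem_diagOp_graph (i : ι) : (b i, (μ i : ℂ) • b i) ∈ (diagOp b μ).graph := by
  classical
  rw [mem_diagOp_graph]
  intro j
  simp only [map_smul, lp.coeFn_smul, Pi.smul_apply, smul_eq_mul, repr_basis_eq_ite]
  split_ifs with h
  · rw [h]
  · simp

theorem summable_norm_sq_repr (u : H) : Summable fun i => ‖b.repr u i‖ ^ 2 := by
  have := lp.memℓp (b.repr u)
  rw [memℓp_gen_iff (by norm_num)] at this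
  simpa using this

theorem exists_repr_eq {c : ι → ℂ} (hc : Summable fun i => ‖c i‖ ^ 2) :
    ∃ v : H, ∀ i, b.repr v i = c i := by
  have hm : Memℓp c 2 := by
    rw [memℓp_gen_iff (by norm_num)]
    simpa using hc
  exact ⟨b.repr.symm ⟨c, hm⟩, fun i => by simp⟩

/-- By Riesz–Fischer, the prescribed coefficients of the image belong to a vector exactly when they
are square summable. -/
theorem mem_diagOp_domain {u : H} :
    u ∈ (diagOp b μ).domain ↔ Summable fun i => μ i ^ 2 * ‖b.repr u i‖ ^ 2 := by
  have key (i : ι) : μ i ^ 2 * ‖b.repr u i‖ ^ 2 = ‖(μ i : ℂ) * b.repr u i‖ ^ 2 := by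
    rw [norm_mul, mul_pow]; simp
  simp_rw [LinearPMap.mem_domain_iff, mem_diagOp_graph, key]
  constructor
  · rintro ⟨v, hv⟩
    simp_rw [← hv]
    exact summable_norm_sq_repr b v
  · intro h
    exact exists_repr_eq b h

/-- Each coefficient condition equates two continuous functions of the pair, so the graph is an
intersection of closed sets. -/
theorem isClosed_diagGraph : _root_.IsClosed (diagGraph b μ : Set (H × H)) := by
  have h : (diagGraph b μ : Set (H × H)) =
      ⋂ i, {p : H × H | inner ℂ (b i) p.2 = μ i * inner ℂ (b i) p.1} := by
    ext p
    simp only [Set.mem_iInter, Set.mem_ofPred_eq, ← b.repr_apply_apply]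
    rfl
  rw [h]
  refine isClosed_iInter fun i => isClosed_eq ?_ ?_ <;> fun_prop

theorem diagOp_graph : (diagOp b μ).graph = diagGraph b μ := by
  ext ⟨u, v⟩
  rw [mem_diagOp_graph]
  rfl

theorem diagOp_isClosed : (diagOp b μ).IsClosed := by
  unfold LinearPMap.IsClosed
  rw [diagOp_graph]
  exact isClosed_diagGraph b μ

/-- The diagonal operator is the closure of its restriction to the span of the basis. -/
theorem diagOp_graph_le_of_basis_mem (g : Submodule ℂ (H × H))
    (hg : ∀ i, (b i, (μ i : ℂ) • b i) ∈ g) : (diagOp b μ).graph ≤ g.topologicalClosure := by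
  rintro ⟨u, v⟩ huv
  rw [mem_diagOp_graph] at huv
  -- The expansions of `u` and `v` converge jointly, and each partial sum is a finite combination of
  -- the pairs `(b i, μ i • b i)`.
  have hs : HasSum (fun i => b.repr u i • (b i, (μ i : ℂ) • b i)) (u, v) := by
    refine HasSum.prodMk (b.hasSum_repr u) ?_
    have := b.hasSum_repr v
    have he : (fun i => b.repr v i • b i) = fun i => b.repr u i • (μ i : ℂ) • b i := by
      funext i
      rw [huv, smul_smul, mul_comm]
    rwa [he] at this
  refine mem_closure_of_tendsto hs (Filter.Eventually.of_forall fun s => ?_)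
  exact g.sum_mem fun i _ => g.smul_mem _ (hg i)

variable {b μ}

/-- Since `μ i` is real, `⟪b i, T u⟫ = ⟪T (b i), u⟫ = μ i ⟪b i, u⟫`. Thus the diagonal operator
bounds every symmetric operator with these eigenpairs from above. -/
theorem graph_le_diagOp_of_symmetric {T : H →ₗ.[ℂ] H} (hT : T.IsFormalAdjoint T)
    (hb : ∀ i, (b i, (μ i : ℂ) • b i) ∈ T.graph) : T.graph ≤ (diagOp b μ).graph := by
  rintro ⟨u, v⟩ huv
  rw [mem_diagOp_graph]
  intro i
  obtain ⟨x, hx, hx'⟩ := T.mem_graph_iff.1 huv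
  obtain ⟨y, hy, hy'⟩ := T.mem_graph_iff.1 (hb i)
  simp only at hx hx' hy hy'
  have h := hT y x
  rw [hx', hy', hx, hy, inner_smul_left] at h
  rw [b.repr_apply_apply, b.repr_apply_apply, ← h]
  simp

theorem isClosable_of_symmetric_of_basis {T : H →ₗ.[ℂ] H} (hT : T.IsFormalAdjoint T)
    (hb : ∀ i, (b i, (μ i : ℂ) • b i) ∈ T.graph) : T.IsClosable :=
  (diagOp_isClosed b μ).isClosable.leIsClosable
    (LinearPMap.le_of_le_graph (graph_le_diagOp_of_symmetric hT hb))

/-- A symmetric operator with a Hilbert basis of eigenvectors is essentially self-adjoint. -/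
theorem closure_eq_diagOp {T : H →ₗ.[ℂ] H} (hT : T.IsFormalAdjoint T)
    (hb : ∀ i, (b i, (μ i : ℂ) • b i) ∈ T.graph) : T.closure = diagOp b μ := by
  apply LinearPMap.eq_of_eq_graph
  rw [← (isClosable_of_symmetric_of_basis hT hb).graph_closure_eq_closure_graph]
  apply le_antisymm
  · refine Submodule.topologicalClosure_minimal _ (graph_le_diagOp_of_symmetric hT hb) ?_
    rw [diagOp_graph]
    exact isClosed_diagGraph b μ
  · exact diagOp_graph_le_of_basis_mem b μ _ hb

variable (b μ)

theorem LinearPMap.mem_neg_graph {T : H →ₗ.[ℂ] H} {u v : H} :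
    (u, v) ∈ (-T).graph ↔ (u, -v) ∈ T.graph := by
  simp only [LinearPMap.mem_graph_iff]
  constructor
  · rintro ⟨y, hy, hy'⟩
    refine ⟨y, hy, ?_⟩
    rw [LinearPMap.neg_apply] at hy'
    rw [← hy', neg_neg]
  · rintro ⟨y, hy, hy'⟩
    refine ⟨y, hy, ?_⟩
    rw [LinearPMap.neg_apply, hy', neg_neg]

theorem neg_diagOp : -diagOp b μ = diagOp b (fun i => -μ i) := by
  apply LinearPMap.eq_of_eq_graph
  ext ⟨u, v⟩
  rw [LinearPMap.mem_neg_graph, mem_diagOp_graph, mem_diagOp_graph]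
  refine forall_congr' fun i => ?_
  simp only [map_neg, lp.coeFn_neg, Pi.neg_apply, Complex.ofReal_neg]
  rw [neg_mul, neg_eq_iff_eq_neg]

theorem basis_mem_diagOp_domain (i : ι) : b i ∈ (diagOp b μ).domain :=
  LinearPMap.mem_domain_of_mem_graph (basis_mem_diagOp_graph b μ i)

theorem dense_of_basis_mem (p : Submodule ℂ H) (hp : ∀ i, b i ∈ p) : Dense (p : Set H) := by
  have h := b.dense_span
  rw [← Submodule.dense_iff_topologicalClosure_eq_top] at h
  refine h.mono ?_
  refine SetLike.coe_subset_coe.2 (Submodule.span_le.2 ?_)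
  rintro _ ⟨i, rfl⟩
  exact hp i

theorem dense_diagOp_domain : Dense ((diagOp b μ).domain : Set H) :=
  dense_of_basis_mem b _ (basis_mem_diagOp_domain b μ)

theorem inner_eq_of_mem_diagOp_graph {u v u' v' : H} (h : (u, v) ∈ (diagOp b μ).graph)
    (h' : (u', v') ∈ (diagOp b μ).graph) : inner ℂ v u' = inner ℂ u v' := by
  rw [mem_diagOp_graph] at h h'
  rw [← b.repr.inner_map_map, ← b.repr.inner_map_map, lp.inner_eq_tsum, lp.inner_eq_tsum]
  refine tsum_congr fun i => ?_
  simp only [h, h', RCLike.inner_apply, map_mul, Complex.conj_ofReal]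
  ring

theorem diagOp_isFormalAdjoint : (diagOp b μ).IsFormalAdjoint (diagOp b μ) := fun x y =>
  inner_eq_of_mem_diagOp_graph b μ ((diagOp b μ).mem_graph x) ((diagOp b μ).mem_graph y)

/-- Symmetry gives one inclusion. For the other, testing the adjoint against the basis vectors
already determines the coefficients of its values. -/
theorem diagOp_isSelfAdjoint [CompleteSpace H] : IsSelfAdjoint (diagOp b μ) := by
  rw [LinearPMap.isSelfAdjoint_def]
  have hd := dense_diagOp_domain b μ
  refine le_antisymm ?_ (LinearPMap.IsFormalAdjoint.le_adjoint hd (diagOp_isFormalAdjoint b μ))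
  apply LinearPMap.le_of_le_graph
  rintro ⟨u, v⟩ huv
  rw [mem_diagOp_graph]
  intro i
  obtain ⟨x, hx, hx'⟩ := (LinearPMap.mem_graph_iff _).1 huv
  obtain ⟨y, hy, hy'⟩ := (LinearPMap.mem_graph_iff _).1 (basis_mem_diagOp_graph b μ i)
  simp only at hx hx' hy hy'
  have h := (LinearPMap.adjoint_isFormalAdjoint hd).symm y x
  rw [hx', hy', hx, hy, inner_smul_left] at h
  rw [b.repr_apply_apply, b.repr_apply_apply, ← h]
  simp

theorem opEigenspace_eq {T : H →ₗ.[ℂ] H} {z : ℂ} {f : H} :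
    f ∈ opEigenspace T z ↔ (f, z • f) ∈ T.graph := by
  rw [LinearPMap.mem_graph_iff]
  constructor
  · rintro ⟨hf, h⟩
    exact ⟨⟨f, hf⟩, rfl, h⟩
  · rintro ⟨⟨y, hy⟩, h1, h2⟩
    simp only at h1 h2
    subst h1
    exact ⟨hy, h2⟩

theorem repr_eq_zero_of_mem_diagOp_graph {z : ℂ} {f : H} (h : (f, z • f) ∈ (diagOp b μ).graph)
    {i : ι} (hi : z ≠ μ i) : b.repr f i = 0 := by
  rw [mem_diagOp_graph] at h
  have := h i
  simp only [map_smul, lp.coeFn_smul, Pi.smul_apply, smul_eq_mul] at this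
  rw [← sub_eq_zero, ← sub_mul] at this
  exact (mul_eq_zero.1 this).resolve_left (sub_ne_zero.2 hi)

/-- An operator between the span of the basis and the diagonal operator has the diagonal entries
as eigenvalues. -/
theorem opEigenvalues_eq_range {T : H →ₗ.[ℂ] H} (hT : T.graph ≤ (diagOp b μ).graph)
    (hb : ∀ i, (b i, (μ i : ℂ) • b i) ∈ T.graph) :
    opEigenvalues T = Set.range fun i => (μ i : ℂ) := by
  ext z
  constructor
  · rintro ⟨f, hf, hf0⟩
    rw [opEigenspace_eq] at hf
    by_contra hz
    refine hf0 (b.eq_zero_of_repr fun i => repr_eq_zero_of_mem_diagOp_graph b μ (hT hf) ?_)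
    rintro rfl
    exact hz ⟨i, rfl⟩
  · rintro ⟨i, rfl⟩
    exact ⟨b i, opEigenspace_eq.2 (hb i), b.orthonormal.ne_zero i⟩

/-- An eigenvector has only coefficients with `μ i = c`; as these are finitely many, its expansion
is a finite sum and the algebraic span needs no closure. The reverse inclusion uses only that the
graph of `T` is a subspace. -/
theorem opEigenspace_eq_span {T : H →ₗ.[ℂ] H} (hT : T.graph ≤ (diagOp b μ).graph)
    (hb : ∀ i, (b i, (μ i : ℂ) • b i) ∈ T.graph) (c : ℝ) (hc : {i | μ i = c}.Finite) :
    opEigenspace T c = (Submodule.span ℂ (b '' {i | μ i = c}) : Set H) := by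
  ext f
  rw [opEigenspace_eq]
  constructor
  · intro hf
    have h0 (i : ι) (hi : i ∉ {i | μ i = c}) : b.repr f i = 0 := by
      refine repr_eq_zero_of_mem_diagOp_graph b μ (hT hf) fun h => hi ?_
      exact_mod_cast h.symm
    have hs := b.hasSum_repr f
    have hs' : HasSum (fun i => b.repr f i • b i) (∑ i ∈ hc.toFinset, b.repr f i • b i) :=
      hasSum_sum_of_ne_finset_zero fun i hi => by
        rw [h0 i (by simpa using hi), zero_smul]
    rw [hs.unique hs']
    refine Submodule.sum_mem _ fun i hi => Submodule.smul_mem _ _ (Submodule.subset_span ?_)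
    exact ⟨i, by simpa using hi, rfl⟩
  · intro hf
    refine Submodule.span_induction (p := fun f _ => (f, (c : ℂ) • f) ∈ T.graph) ?_ ?_ ?_ ?_ hf
    · rintro _ ⟨i, hi, rfl⟩
      have := hb i
      rw [show μ i = c from hi] at this
      exact this
    · simp
    · intro x y _ _ hx hy
      have := T.graph.add_mem hx hy
      simpa using this
    · intro a x _ hx
      have := T.graph.smul_mem a hx
      rw [Prod.smul_mk, smul_comm] at this
      exact this

/-- The hypothesis says that the set of the `μ i` is closed. Off it the resolvent is diagonal with
entries `(μ i - z)⁻¹`, bounded by `δ⁻¹`; at `z = μ i` injectivity fails on `b i`. -/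
theorem opSpectrum_diagOp (hsep : ∀ z : ℂ, (∀ i, z ≠ μ i) → ∃ δ > 0, ∀ i, δ ≤ ‖(μ i : ℂ) - z‖) :
    opSpectrum (diagOp b μ) = Set.range fun i => (μ i : ℂ) := by
  ext z
  constructor
  · intro hz
    by_contra hr
    apply hz
    obtain ⟨δ, hδ, hd⟩ := hsep z fun i h => hr ⟨i, h.symm⟩
    have hle (u : H) (i : ι) :
        ‖((μ i : ℂ) - z)⁻¹ * b.repr u i‖ ^ 2 ≤ (δ⁻¹) ^ 2 * ‖b.repr u i‖ ^ 2 := by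
      rw [norm_mul, mul_pow, norm_inv]
      gcongr
      exact hd i
    have hsum (u : H) : Summable fun i => ‖((μ i : ℂ) - z)⁻¹ * b.repr u i‖ ^ 2 :=
      Summable.of_nonneg_of_le (fun _ => by positivity) (hle u)
        ((summable_norm_sq_repr b u).mul_left _)
    choose R hR using fun u => exists_repr_eq b (hsum u)
    have hinj {u v : H} (h : ∀ i, b.repr u i = b.repr v i) : u = v := by
      apply b.repr.injective
      ext i
      exact h i
    have hne (i : ι) : (μ i : ℂ) - z ≠ 0 := sub_ne_zero.2 fun h => hr ⟨i, h⟩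
    let L : H →ₗ[ℂ] H :=
      { toFun := R
        map_add' := fun u v => hinj fun i => by
          simp only [hR, map_add, lp.coeFn_add, Pi.add_apply, mul_add]
        map_smul' := fun a u => hinj fun i => by
          simp only [hR, map_smul, lp.coeFn_smul, Pi.smul_apply, smul_eq_mul, RingHom.id_apply]
          ring }
    have hnorm (u : H) : ‖u‖ ^ 2 = ∑' i, ‖b.repr u i‖ ^ 2 := by
      rw [← b.repr.norm_map u]
      have := lp.norm_rpow_eq_tsum (p := 2) (by norm_num) (b.repr u)
      simpa using this
    have hbound (u : H) : ‖L u‖ ≤ δ⁻¹ * ‖u‖ := by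
      apply le_of_sq_le_sq _ (by positivity)
      rw [mul_pow, hnorm, hnorm, ← tsum_mul_left]
      refine Summable.tsum_le_tsum (fun i => ?_) (summable_norm_sq_repr b _)
        ((summable_norm_sq_repr b u).mul_left _)
      change ‖b.repr (R u) i‖ ^ 2 ≤ _
      rw [hR]
      exact hle u i
    refine ⟨L.mkContinuous δ⁻¹ hbound, fun f => ?_, fun u => ?_⟩
    · have hg : (R f, f + z • R f) ∈ (diagOp b μ).graph := by
        rw [mem_diagOp_graph]
        intro i
        simp only [map_add, lp.coeFn_add, Pi.add_apply, map_smul, lp.coeFn_smul, Pi.smul_apply,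
          hR, smul_eq_mul]
        have := hne i
        field_simp
        ring
      obtain ⟨⟨y, hy⟩, h1, h2⟩ := (LinearPMap.mem_graph_iff _).1 hg
      simp only at h1 h2
      subst h1
      refine ⟨hy, ?_⟩
      change diagOp b μ ⟨R f, hy⟩ - z • R f = f
      rw [h2]
      simp
    · change R _ = _
      refine hinj fun i => ?_
      have := (mem_diagOp_graph b μ).1 ((diagOp b μ).mem_graph u) i
      simp only [hR, map_sub, lp.coeFn_sub, Pi.sub_apply, map_smul, lp.coeFn_smul, Pi.smul_apply,
        smul_eq_mul, this]
      have := hne i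
      field_simp
  · rintro ⟨i, rfl⟩ ⟨R, -, hR⟩
    obtain ⟨y, hy, hy'⟩ := (LinearPMap.mem_graph_iff _).1 (basis_mem_diagOp_graph b μ i)
    simp only at hy hy'
    have := hR y
    rw [hy', hy, sub_self, map_zero] at this
    exact b.orthonormal.ne_zero i this.symm

theorem isPosSqrt_diagOp [CompleteSpace H] (hμ : ∀ i, 0 ≤ μ i) :
    IsPosSqrt (diagOp b fun i => √(μ i)) (diagOp b μ) := by
  refine ⟨diagOp_isSelfAdjoint b _, fun u => ?_, fun u v => ?_⟩
  · have h := (mem_diagOp_graph b _).1 ((diagOp b fun i => √(μ i)).mem_graph u)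
    rw [← b.repr.inner_map_map]
    have hs := lp.hasSum_inner (𝕜 := ℂ) (b.repr (u : H)) (b.repr (diagOp b (fun i => √(μ i)) u))
    refine (Complex.hasSum_re hs).nonneg fun i => ?_
    rw [h]
    simp only [RCLike.inner_apply, mul_assoc, Complex.mul_conj, Complex.re_ofReal_mul]
    have := Complex.normSq_nonneg (b.repr (u : H) i)
    simp only [Complex.ofReal_re]
    positivity
  · simp only [mem_diagOp_graph]
    have hsq (i : ι) : (√(μ i) : ℂ) * √(μ i) = μ i := by
      exact_mod_cast Real.mul_self_sqrt (hμ i)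
    constructor
    · intro h
      -- The intermediate vector `B u` exists because `μ ≤ 1 + μ ^ 2`, so its coefficients are
      -- dominated by those of `u` and `v` together.
      obtain ⟨w, hw⟩ := exists_repr_eq b (c := fun i => √(μ i) * b.repr u i) (by
        refine Summable.of_nonneg_of_le (fun _ => by positivity) (fun i => ?_)
          ((summable_norm_sq_repr b u).add (summable_norm_sq_repr b v))
        rw [h, norm_mul, norm_mul, mul_pow, mul_pow]
        simp only [Complex.norm_real, Real.norm_eq_abs, sq_abs, Real.sq_sqrt (hμ i)]
        nlinarith [sq_nonneg (μ i - 1), sq_nonneg ‖b.repr u i‖, sq_nonneg (μ i),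
          mul_nonneg (sq_nonneg (μ i - 1)) (sq_nonneg ‖b.repr u i‖),
          mul_nonneg (hμ i) (sq_nonneg ‖b.repr u i‖)])
      refine ⟨w, hw, fun i => ?_⟩
      rw [h, hw, ← mul_assoc, hsq]
    · rintro ⟨w, h1, h2⟩ i
      rw [h2, h1, ← mul_assoc, hsq]

theorem isFormalAdjoint_of_isSelfAdjoint [CompleteSpace H] {B : H →ₗ.[ℂ] H}
    (hB : IsSelfAdjoint B) : B.IsFormalAdjoint B := by
  have h := LinearPMap.adjoint_isFormalAdjoint hB.dense_domain
  rwa [LinearPMap.isSelfAdjoint_def.1 hB] at h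

/-- Uniqueness of the nonnegative square root of a diagonal operator. -/
theorem IsPosSqrt.eq_diagOp [CompleteSpace H] (hμ : ∀ i, 0 ≤ μ i) {B : H →ₗ.[ℂ] H}
    (hB : IsPosSqrt B (diagOp b μ)) : B = diagOp b fun i => √(μ i) := by
  obtain ⟨hsa, hpos, hsq⟩ := hB
  have hsym := isFormalAdjoint_of_isSelfAdjoint hsa
  have hb (i : ι) : (b i, (√(μ i) : ℂ) • b i) ∈ B.graph := by
    obtain ⟨w, h1, h2⟩ := (hsq _ _).1 (basis_mem_diagOp_graph b μ i)
    suffices w = (√(μ i) : ℂ) • b i by rwa [← this]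
    have hss : (√(μ i) : ℂ) * √(μ i) = μ i := by exact_mod_cast Real.mul_self_sqrt (hμ i)
    -- Here `w = B (b i)` and `B w = μ i • b i`. If `μ i = 0`, symmetry gives `⟪w, w⟫ = ⟪B w, b i⟫ =
    -- 0`.
    by_cases h0 : μ i = 0
    · rw [h0] at h2 ⊢
      simp only [Complex.ofReal_zero, zero_smul, Real.sqrt_zero] at h2 ⊢
      obtain ⟨x, hx, hx'⟩ := (LinearPMap.mem_graph_iff _).1 h1
      obtain ⟨y, hy, hy'⟩ := (LinearPMap.mem_graph_iff _).1 h2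
      simp only at hx hx' hy hy'
      have := hsym y x
      rw [hy', hx', hy, inner_zero_left] at this
      exact inner_self_eq_zero.1 this.symm
    · have hp : 0 < √(μ i) := Real.sqrt_pos.2 (lt_of_le_of_ne (hμ i) (Ne.symm h0))
      -- The defect `w - √μ • b i` satisfies the eigenvector equation of `B` for the negative number
      -- `-√μ`, so nonnegativity of `B` forces it to be zero.
      have hz : (w - (√(μ i) : ℂ) • b i, -(√(μ i) : ℂ) • (w - (√(μ i) : ℂ) • b i)) ∈ B.graph := by
        have := B.graph.sub_mem h2 (B.graph.smul_mem (√(μ i) : ℂ) h1)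
        convert this using 1
        simp only [Prod.smul_mk, Prod.mk_sub_mk, smul_sub, smul_smul, neg_mul, neg_smul, hss]
        congr 1
        abel
      obtain ⟨x, hx, hx'⟩ := (LinearPMap.mem_graph_iff _).1 hz
      simp only at hx hx'
      have := hpos x
      rw [hx', hx, inner_smul_right, inner_self_eq_norm_sq_to_K] at this
      rw [← sub_eq_zero]
      by_contra hne
      have hn : 0 < ‖w - (√(μ i) : ℂ) • b i‖ := norm_pos_iff.2 hne
      have h3 : (-(√(μ i) : ℂ) * ((‖w - (√(μ i) : ℂ) • b i‖ : ℝ) : ℂ) ^ 2).re =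
          -(√(μ i) * ‖w - (√(μ i) : ℂ) • b i‖ ^ 2) := by
        rw [← Complex.ofReal_pow, ← Complex.ofReal_neg, ← Complex.ofReal_mul, Complex.ofReal_re]
        ring
      have h4 : 0 < √(μ i) * ‖w - (√(μ i) : ℂ) • b i‖ ^ 2 := by positivity
      have h5 : 0 ≤ -(√(μ i) * ‖w - (√(μ i) : ℂ) • b i‖ ^ 2) := by
        rw [← h3]; exact this
      linarith
  -- `B` is symmetric and has the basis as eigenvectors, so its closure is diagonal; being
  -- self-adjoint, `B` is already closed.
  rw [← closure_eq_diagOp hsym hb]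
  apply LinearPMap.eq_of_eq_graph
  rw [← hsa.isClosed.isClosable.graph_closure_eq_closure_graph]
  exact (IsClosed.submodule_topologicalClosure_eq hsa.isClosed).symm

end Diagonal

/-! ### The Baran metric of the simplex -/

section Metric

variable {n : ℕ}

theorem isOpen_openSimplex (n : ℕ) : IsOpen (openSimplex n) := by
  have : openSimplex n = (⋂ i, {x | 0 < x i}) ∩ {x | ∑ i, x i < 1} := by
    ext x; simp [openSimplex]
  rw [this]
  refine (isOpen_iInter_of_finite fun i => ?_).inter ?_
  · exact isOpen_lt continuous_const (continuous_apply i)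
  · exact isOpen_lt (by fun_prop) continuous_const

theorem openSimplex_mem_nhds {x : Fin n → ℝ} (hx : x ∈ openSimplex n) :
    openSimplex n ∈ nhds x := (isOpen_openSimplex n).mem_nhds hx

theorem measurableSet_openSimplex (n : ℕ) : MeasurableSet (openSimplex n) :=
  (isOpen_openSimplex n).measurableSet

theorem lt_one_of_mem_openSimplex {x : Fin n → ℝ} (hx : x ∈ openSimplex n) (i : Fin n) :
    x i < 1 :=
  (Finset.single_le_sum (fun j _ => (hx.1 j).le) (Finset.mem_univ i)).trans_lt hx.2

/-- The product `(1 - ∑ xᵢ) ∏ xᵢ` of the barycentric coordinates. -/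
noncomputable def barycentricProd (x : Fin n → ℝ) : ℝ := (1 - ∑ i, x i) * ∏ i, x i

theorem barycentricProd_pos {x : Fin n → ℝ} (hx : x ∈ openSimplex n) : 0 < barycentricProd x :=
  mul_pos (sub_pos.2 hx.2) (Finset.prod_pos fun i _ => hx.1 i)

/-- The Sherman–Morrison inverse of a diagonal matrix plus a rank-one matrix. Unlike the metric, it
is polynomial in `x`. -/
theorem baranSimplex_mul {x : Fin n → ℝ} (hx : x ∈ openSimplex n) :
    baranSimplex n x * (Matrix.diagonal x - Matrix.vecMulVec x x) = 1 := by
  have h0 : 1 - ∑ i, x i ≠ 0 := (sub_pos.2 hx.2).ne'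
  ext i j
  have hi : x i ≠ 0 := (hx.1 i).ne'
  rw [baranSimplex, add_mul, Matrix.add_apply, Matrix.diagonal_mul, Matrix.smul_mul,
    Matrix.smul_apply, Matrix.mul_apply]
  simp only [Matrix.sub_apply, Matrix.vecMulVec_apply, Matrix.of_apply, one_mul,
    Finset.sum_sub_distrib, smul_eq_mul, ← Finset.sum_mul, Matrix.diagonal_apply,
    Finset.sum_ite_eq', Finset.mem_univ, if_true, Matrix.one_apply]
  split_ifs with h
  · subst h
    field_simp
    ring
  · field_simp
    ring

theorem baranSimplex_inv {x : Fin n → ℝ} (hx : x ∈ openSimplex n) :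
    (baranSimplex n x)⁻¹ = Matrix.diagonal x - Matrix.vecMulVec x x :=
  Matrix.inv_eq_right_inv (baranSimplex_mul hx)

/-- The matrix determinant lemma: the rank-one term multiplies `∏ xᵢ⁻¹` by `1 + (∑ xᵢ) / (1 - ∑ xᵢ)
= 1 / (1 - ∑ xᵢ)`. -/
theorem det_baranSimplex {x : Fin n → ℝ} (hx : x ∈ openSimplex n) :
    (baranSimplex n x).det = (barycentricProd x)⁻¹ := by
  have h0 : 1 - ∑ i, x i ≠ 0 := (sub_pos.2 hx.2).ne'
  have hA : IsUnit (Matrix.diagonal fun i => (x i)⁻¹).det := by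
    rw [Matrix.det_diagonal]
    exact (Finset.prod_ne_zero_iff.2 fun i _ => inv_ne_zero (hx.1 i).ne').isUnit
  have hG : baranSimplex n x = (Matrix.diagonal fun i => (x i)⁻¹) +
      Matrix.replicateCol Unit (fun _ => (1 - ∑ i, x i)⁻¹) *
        Matrix.replicateRow Unit (fun _ => (1 : ℝ)) := by
    ext i j
    simp [baranSimplex, Matrix.mul_apply]
  have hinv : (Matrix.diagonal fun i => (x i)⁻¹)⁻¹ = Matrix.diagonal x := by
    refine Matrix.inv_eq_right_inv ?_
    rw [Matrix.diagonal_mul_diagonal, ← Matrix.diagonal_one]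
    congr 1
    ext i
    exact inv_mul_cancel₀ (hx.1 i).ne'
  rw [hG, Matrix.det_add_replicateCol_mul_replicateRow hA, Matrix.det_diagonal, hinv,
    Matrix.det_unique]
  simp only [Matrix.add_apply, Matrix.mul_apply, Matrix.replicateRow_apply, one_mul,
    Matrix.replicateCol_apply, Matrix.one_apply, if_true, Matrix.diagonal_apply,
    Finset.sum_ite_eq', Finset.mem_univ, ← Finset.sum_mul, barycentricProd, mul_inv,
    Finset.prod_inv_distrib]
  have : 1 + (∑ i, x i) * (1 - ∑ i, x i)⁻¹ = (1 - ∑ i, x i)⁻¹ := by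
    field_simp
    ring
  rw [this, mul_comm]

theorem baranSimplex_posDef {x : Fin n → ℝ} (hx : x ∈ openSimplex n) :
    (baranSimplex n x).PosDef := by
  refine Matrix.PosDef.add_posSemidef ?_ ?_
  · exact Matrix.PosDef.diagonal fun i => inv_pos.2 (hx.1 i)
  · have h : (Matrix.of fun _ _ => (1 : ℝ) : Matrix (Fin n) (Fin n) ℝ) =
        Matrix.vecMulVec (fun _ => 1) (star fun _ => 1) := by
      ext i j; simp [Matrix.vecMulVec_apply]
    rw [h]
    exact (Matrix.posSemidef_vecMulVec_self_star _).smul (inv_nonneg.2 (sub_nonneg.2 hx.2.le))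

theorem simplexMeasure_eq_riemVolume (n : ℕ) :
    simplexMeasure n = riemVolume (openSimplex n) (baranSimplex n) := by
  refine withDensity_congr_ae ?_
  filter_upwards [ae_restrict_mem (measurableSet_openSimplex n)] with x hx
  rw [det_baranSimplex hx, Real.sqrt_inv, one_div]
  rfl

/-! ### The gradient and the Laplacian -/

section PartialDeriv

variable {u v : (Fin n → ℝ) → ℂ} {x : Fin n → ℝ} (i : Fin n)

theorem partialDeriv_congr (h : u =ᶠ[nhds x] v) : partialDeriv i u x = partialDeriv i v x := by
  unfold partialDeriv
  rw [h.fderiv_eq]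

theorem partialDeriv_add (hu : DifferentiableAt ℝ u x) (hv : DifferentiableAt ℝ v x) :
    partialDeriv i (fun y => u y + v y) x = partialDeriv i u x + partialDeriv i v x := by
  unfold partialDeriv
  rw [fderiv_fun_add hu hv]; rfl

theorem partialDeriv_sub (hu : DifferentiableAt ℝ u x) (hv : DifferentiableAt ℝ v x) :
    partialDeriv i (fun y => u y - v y) x = partialDeriv i u x - partialDeriv i v x := by
  unfold partialDeriv
  rw [fderiv_fun_sub hu hv]; rfl

theorem partialDeriv_mul (hu : DifferentiableAt ℝ u x) (hv : DifferentiableAt ℝ v x) :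
    partialDeriv i (fun y => u y * v y) x =
      u x * partialDeriv i v x + partialDeriv i u x * v x := by
  unfold partialDeriv
  rw [fderiv_fun_mul hu hv]
  simp [mul_comm]

theorem partialDeriv_sum {ι : Type*} {s : Finset ι} {f : ι → (Fin n → ℝ) → ℂ}
    (hf : ∀ j ∈ s, DifferentiableAt ℝ (f j) x) :
    partialDeriv i (fun y => ∑ j ∈ s, f j y) x = ∑ j ∈ s, partialDeriv i (f j) x := by
  unfold partialDeriv
  rw [fderiv_fun_sum hf]
  simp

theorem partialDeriv_const (c : ℂ) : partialDeriv i (fun _ => c) x = 0 := by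
  simp [partialDeriv]

theorem differentiableAt_ofReal_coord (j : Fin n) :
    DifferentiableAt ℝ (fun y : Fin n → ℝ => ((y j : ℝ) : ℂ)) x :=
  Complex.ofRealCLM.differentiableAt.comp x (differentiableAt_apply j x)

theorem partialDeriv_coord (j : Fin n) :
    partialDeriv i (fun y : Fin n → ℝ => ((y j : ℝ) : ℂ)) x = if j = i then 1 else 0 := by
  have h : HasFDerivAt (fun y : Fin n → ℝ => ((y j : ℝ) : ℂ))
      (Complex.ofRealCLM.comp (ContinuousLinearMap.proj j)) x :=
    Complex.ofRealCLM.hasFDerivAt.comp x (hasFDerivAt_apply j x)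
  unfold partialDeriv
  rw [h.fderiv]
  simp only [ContinuousLinearMap.coe_comp, Function.comp_apply, ContinuousLinearMap.proj_apply,
    Pi.single_apply]
  split_ifs <;> simp

theorem partialDeriv_ofReal_comp {f : (Fin n → ℝ) → ℝ} {f' : (Fin n → ℝ) →L[ℝ] ℝ}
    (h : HasFDerivAt f f' x) :
    partialDeriv i (fun y => ((f y : ℝ) : ℂ)) x = ((f' (Pi.single i 1) : ℝ) : ℂ) := by
  have h : HasFDerivAt (fun y => ((f y : ℝ) : ℂ)) (Complex.ofRealCLM.comp f') x :=
    Complex.ofRealCLM.hasFDerivAt.comp x h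
  unfold partialDeriv
  rw [h.fderiv]
  rfl

theorem ContDiffAt.partialDeriv {m : WithTop ℕ∞} {k : WithTop ℕ∞} (hu : ContDiffAt ℝ k u x)
    (hm : m + 1 ≤ k) : ContDiffAt ℝ m (partialDeriv i u) x :=
  (hu.fderiv_right hm).clm_apply contDiffAt_const

theorem partialDeriv_comm (hu : ContDiffAt ℝ 2 u x) (j : Fin n) :
    partialDeriv i (partialDeriv j u) x = partialDeriv j (partialDeriv i u) x := by
  have h := hu.isSymmSndFDerivAt (by simp)
  have hd : DifferentiableAt ℝ (fderiv ℝ u) x :=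
    (hu.fderiv_right (m := 1) (by norm_num)).differentiableAt (by norm_num)
  have key (i j : Fin n) : partialDeriv i (partialDeriv j u) x =
      fderiv ℝ (fderiv ℝ u) x (Pi.single i 1) (Pi.single j 1) := by
    change fderiv ℝ (fun y => fderiv ℝ u y (Pi.single j 1)) x _ = _
    rw [fderiv_clm_apply hd (differentiableAt_const _)]
    simp
  rw [key, key]
  exact h _ _

end PartialDeriv

/-- The radial derivative `∑ xⱼ ∂ⱼ u`. -/
noncomputable def eulerDeriv (u : (Fin n → ℝ) → ℂ) (x : Fin n → ℝ) : ℂ :=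
  ∑ j, ((x j : ℝ) : ℂ) * partialDeriv j u x

/-- The factor `xᵢ` is what later absorbs the poles `1 / xᵢ` in the logarithmic derivatives of the
density and of the cutoffs. -/
theorem riemGrad_baranSimplex (u : (Fin n → ℝ) → ℂ) {x : Fin n → ℝ} (hx : x ∈ openSimplex n)
    (i : Fin n) : riemGrad (baranSimplex n) u x i =
      ((x i : ℝ) : ℂ) * (partialDeriv i u x - eulerDeriv u x) := by
  unfold riemGrad eulerDeriv
  rw [baranSimplex_inv hx]
  simp only [Matrix.sub_apply, Matrix.vecMulVec_apply, Complex.ofReal_sub, sub_mul,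
    Finset.sum_sub_distrib, Matrix.diagonal_apply, Complex.ofReal_mul, mul_assoc,
    ← Finset.mul_sum, mul_sub]
  congr 1
  rw [Finset.sum_eq_single i] <;> simp +contextual [eq_comm]

/-- The logarithm of the product of the barycentric coordinates. -/
noncomputable def logBarycentric (x : Fin n → ℝ) : ℝ :=
  Real.log (1 - ∑ i, x i) + ∑ i, Real.log (x i)

theorem exp_logBarycentric {x : Fin n → ℝ} (hx : x ∈ openSimplex n) :
    Real.exp (logBarycentric x) = barycentricProd x := by
  rw [logBarycentric, Real.exp_add, Real.exp_sum, Real.exp_log (sub_pos.2 hx.2), barycentricProd]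
  congr 1
  exact Finset.prod_congr rfl fun i _ => Real.exp_log (hx.1 i)

/-- Writing the density as an exponential makes its derivatives a multiple of itself, so it factors
out of the divergence. -/
theorem sqrt_det_baranSimplex {x : Fin n → ℝ} (hx : x ∈ openSimplex n) :
    √(baranSimplex n x).det = Real.exp (-(1 / 2) * logBarycentric x) := by
  rw [det_baranSimplex hx, ← exp_logBarycentric hx, ← Real.exp_neg, Real.sqrt_eq_rpow,
    ← Real.exp_mul]
  ring_nf

theorem exists_hasFDerivAt_logBarycentric {x : Fin n → ℝ} (hx : x ∈ openSimplex n) :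
    ∃ L : (Fin n → ℝ) →L[ℝ] ℝ, HasFDerivAt logBarycentric L x ∧
      ∀ i, L (Pi.single i 1) = (x i)⁻¹ - (1 - ∑ j, x j)⁻¹ := by
  have h0 : 1 - ∑ i, x i ≠ 0 := (sub_pos.2 hx.2).ne'
  have h1 : HasFDerivAt (fun y : Fin n → ℝ => 1 - ∑ i, y i)
      (-∑ i, ContinuousLinearMap.proj (R := ℝ) (φ := fun _ : Fin n => ℝ) i) x :=
    (HasFDerivAt.fun_sum fun i _ => hasFDerivAt_apply i x).const_sub 1
  have h2 := (h1.log h0).add (HasFDerivAt.fun_sum (u := Finset.univ) fun i _ =>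
    (hasFDerivAt_apply (𝕜 := ℝ) i x).log (hx.1 i).ne')
  refine ⟨_, h2, fun i => ?_⟩
  simp only [add_apply, smul_apply,
    neg_apply, sum_apply, smul_eq_mul,
    ContinuousLinearMap.proj_apply, Pi.single_apply, Finset.sum_ite_eq', Finset.mem_univ,
    if_true, mul_ite, mul_one, mul_zero]
  simp
  ring

theorem differentiableAt_sqrt_det {x : Fin n → ℝ} (hx : x ∈ openSimplex n) :
    DifferentiableAt ℝ (fun y => ((√(baranSimplex n y).det : ℝ) : ℂ)) x := by
  obtain ⟨L, hL, -⟩ := exists_hasFDerivAt_logBarycentric hx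
  have h : HasFDerivAt (fun y : Fin n → ℝ => Real.exp (-(1 / 2) * logBarycentric y)) _ x :=
    (hL.const_mul (-(1 / 2) : ℝ)).exp
  refine (Complex.ofRealCLM.differentiableAt.comp x h.differentiableAt).congr_of_eventuallyEq ?_
  filter_upwards [openSimplex_mem_nhds hx] with y hy
  simp [sqrt_det_baranSimplex hy]

theorem partialDeriv_sqrt_det {x : Fin n → ℝ} (hx : x ∈ openSimplex n) (i : Fin n) :
    partialDeriv i (fun y => ((√(baranSimplex n y).det : ℝ) : ℂ)) x =
      (√(baranSimplex n x).det : ℝ) * (-(1 / 2) * ((x i : ℂ)⁻¹ - (1 - ∑ j, (x j : ℂ))⁻¹)) := by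
  obtain ⟨L, hL, hL'⟩ := exists_hasFDerivAt_logBarycentric hx
  have h : HasFDerivAt (fun y : Fin n → ℝ => Real.exp (-(1 / 2) * logBarycentric y)) _ x :=
    (hL.const_mul (-(1 / 2) : ℝ)).exp
  have he : (fun y => ((√(baranSimplex n y).det : ℝ) : ℂ)) =ᶠ[nhds x]
      fun y => ((Real.exp (-(1 / 2) * logBarycentric y) : ℝ) : ℂ) := by
    filter_upwards [openSimplex_mem_nhds hx] with y hy
    rw [sqrt_det_baranSimplex hy]
  rw [partialDeriv_congr i he, partialDeriv_ofReal_comp i h, sqrt_det_baranSimplex hx]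
  simp only [smul_apply, hL', smul_eq_mul]
  push_cast
  ring

variable {u : (Fin n → ℝ) → ℂ} {x : Fin n → ℝ}

theorem differentiableAt_eulerDeriv (hu : ContDiffAt ℝ 2 u x) :
    DifferentiableAt ℝ (eulerDeriv u) x := by
  refine DifferentiableAt.fun_sum fun j _ => ?_
  exact (differentiableAt_ofReal_coord j).mul
    ((hu.partialDeriv j (m := 1) (by norm_num)).differentiableAt (by norm_num))

theorem partialDeriv_eulerDeriv (hu : ContDiffAt ℝ 2 u x) (i : Fin n) :
    partialDeriv i (eulerDeriv u) x =
      partialDeriv i u x + ∑ j, ((x j : ℝ) : ℂ) * partialDeriv i (partialDeriv j u) x := by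
  have hd (j : Fin n) : DifferentiableAt ℝ (partialDeriv j u) x :=
    (hu.partialDeriv j (m := 1) (by norm_num)).differentiableAt (by norm_num)
  change partialDeriv i (fun y => ∑ j, ((y j : ℝ) : ℂ) * partialDeriv j u y) x = _
  rw [partialDeriv_sum i fun j _ => (differentiableAt_ofReal_coord j).fun_mul (hd j)]
  simp only [partialDeriv_mul i (differentiableAt_ofReal_coord _) (hd _), partialDeriv_coord,
    Finset.sum_add_distrib, ite_mul, one_mul, zero_mul, Finset.sum_ite_eq', Finset.mem_univ,
    if_true]
  ring

theorem differentiableAt_coord_mul_sub_eulerDeriv (hu : ContDiffAt ℝ 2 u x) (i : Fin n) :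
    DifferentiableAt ℝ (fun y => ((y i : ℝ) : ℂ) * (partialDeriv i u y - eulerDeriv u y)) x :=
  (differentiableAt_ofReal_coord i).mul
    (((hu.partialDeriv i (m := 1) (by norm_num)).differentiableAt (by norm_num)).sub
      (differentiableAt_eulerDeriv hu))

theorem riemGrad_eventuallyEq (u : (Fin n → ℝ) → ℂ) (hx : x ∈ openSimplex n) (i : Fin n) :
    (fun y => riemGrad (baranSimplex n) u y i) =ᶠ[nhds x]
      fun y => ((y i : ℝ) : ℂ) * (partialDeriv i u y - eulerDeriv u y) := by
  filter_upwards [openSimplex_mem_nhds hx] with y hy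
  exact riemGrad_baranSimplex u hy i

theorem differentiableAt_riemGrad (hx : x ∈ openSimplex n) (hu : ContDiffAt ℝ 2 u x)
    (i : Fin n) : DifferentiableAt ℝ (fun y => riemGrad (baranSimplex n) u y i) x :=
  (differentiableAt_coord_mul_sub_eulerDeriv hu i).congr_of_eventuallyEq
    (riemGrad_eventuallyEq u hx i)

theorem partialDeriv_riemGrad (hx : x ∈ openSimplex n) (hu : ContDiffAt ℝ 2 u x) (i : Fin n) :
    partialDeriv i (fun y => riemGrad (baranSimplex n) u y i) x =
      (partialDeriv i u x - eulerDeriv u x) +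
        x i * (partialDeriv i (partialDeriv i u) x - partialDeriv i u x
          - ∑ j, ((x j : ℝ) : ℂ) * partialDeriv i (partialDeriv j u) x) := by
  have hd : DifferentiableAt ℝ (partialDeriv i u) x :=
    (hu.partialDeriv i (m := 1) (by norm_num)).differentiableAt (by norm_num)
  have he := differentiableAt_eulerDeriv hu
  rw [partialDeriv_congr i (riemGrad_eventuallyEq u hx i),
    partialDeriv_mul i (differentiableAt_ofReal_coord i) (hd.fun_sub he), partialDeriv_coord,
    partialDeriv_sub i hd he, partialDeriv_eulerDeriv hu]
  simp only [if_true]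
  ring

theorem sqrt_det_baranSimplex_pos (hx : x ∈ openSimplex n) : 0 < √(baranSimplex n x).det := by
  rw [sqrt_det_baranSimplex hx]
  exact Real.exp_pos _

theorem sum_sum_eq_diag_add_two_mul_Ioi {f : Fin n → Fin n → ℂ} (hf : ∀ i j, f i j = f j i) :
    ∑ i, ∑ j, f i j = ∑ i, f i i + 2 * ∑ i, ∑ j ∈ Finset.Ioi i, f i j := by
  have h1 (i : Fin n) : ∑ j, f i j =
      f i i + ∑ j ∈ Finset.Ioi i, f i j + ∑ j ∈ Finset.Iio i, f i j := by
    rw [← Finset.sum_filter_add_sum_filter_not Finset.univ (fun j => i < j) (f i),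
      ← Finset.sum_filter_add_sum_filter_not (Finset.univ.filter fun j => ¬ i < j)
        (fun j => j < i) (f i)]
    have e1 : Finset.univ.filter (fun j => i < j) = Finset.Ioi i := by ext; simp
    have e2 : (Finset.univ.filter fun j => ¬ i < j).filter (fun j => j < i) = Finset.Iio i := by
      ext j
      simp only [Finset.mem_filter, Finset.mem_univ, true_and, Finset.mem_Iio]
      omega
    have e3 : (Finset.univ.filter fun j => ¬ i < j).filter (fun j => ¬ j < i) = {i} := by
      ext j
      simp only [Finset.mem_filter, Finset.mem_univ, true_and, Finset.mem_singleton]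
      omega
    rw [e1, e2, e3, Finset.sum_singleton]
    ring
  have h2 : ∑ i, ∑ j ∈ Finset.Iio i, f i j = ∑ i, ∑ j ∈ Finset.Ioi i, f i j := by
    rw [Finset.sum_comm' (t' := Finset.univ) (s' := fun j => Finset.Ioi j) (by simp)]
    exact Finset.sum_congr rfl fun i _ => Finset.sum_congr rfl fun j _ => hf _ _
  simp only [h1, Finset.sum_add_distrib, h2]
  ring

theorem laplaceBeltrami_eq_dunklXu (hu : ContDiffOn ℝ 2 u (openSimplex n))
    (hx : x ∈ openSimplex n) : laplaceBeltrami (baranSimplex n) u x = dunklXu n u x := by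
  have hux : ContDiffAt ℝ 2 u x := hu.contDiffAt (openSimplex_mem_nhds hx)
  have hw : ((√(baranSimplex n x).det : ℝ) : ℂ) ≠ 0 := by
    exact_mod_cast (sqrt_det_baranSimplex_pos hx).ne'
  have h0 : 1 - ∑ i, (x i : ℂ) ≠ 0 := by
    exact_mod_cast (sub_pos.2 hx.2).ne'
  have hi (i : Fin n) : (x i : ℂ) ≠ 0 := by exact_mod_cast (hx.1 i).ne'
  unfold laplaceBeltrami riemDiv
  simp only [partialDeriv_mul _ (differentiableAt_sqrt_det hx)
    (differentiableAt_riemGrad hx hux _), partialDeriv_sqrt_det hx, partialDeriv_riemGrad hx hux,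
    riemGrad_baranSimplex u hx]
  -- The terms with `(1 - ∑ xⱼ)⁻¹` are kept apart: after summation over `i` they are `(1 - ∑ xⱼ)⁻¹
  -- (1 - ∑ xⱼ) E u / 2`, and the pole cancels.
  have key (i : Fin n) : ((√(baranSimplex n x).det : ℝ) : ℂ) *
        ((partialDeriv i u x - eulerDeriv u x) +
        x i * (partialDeriv i (partialDeriv i u) x - partialDeriv i u x
          - ∑ j, ((x j : ℝ) : ℂ) * partialDeriv i (partialDeriv j u) x)) +
      (√(baranSimplex n x).det : ℝ) * (-(1 / 2) * ((x i : ℂ)⁻¹ - (1 - ∑ j, (x j : ℂ))⁻¹)) *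
        (x i * (partialDeriv i u x - eulerDeriv u x)) =
      (√(baranSimplex n x).det : ℝ) * (
        x i * partialDeriv i (partialDeriv i u) x
        - ∑ j, ((x i * x j : ℝ) : ℂ) * partialDeriv i (partialDeriv j u) x
        + (1 / 2 * partialDeriv i u x - 1 / 2 * eulerDeriv u x - x i * partialDeriv i u x
          + 1 / 2 * (1 - ∑ j, (x j : ℂ))⁻¹ * (x i * partialDeriv i u x)
          - 1 / 2 * (1 - ∑ j, (x j : ℂ))⁻¹ * (x i * eulerDeriv u x))) := by
    have : ∑ j, ((x i * x j : ℝ) : ℂ) * partialDeriv i (partialDeriv j u) x =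
        x i * ∑ j, ((x j : ℝ) : ℂ) * partialDeriv i (partialDeriv j u) x := by
      rw [Finset.mul_sum]
      refine Finset.sum_congr rfl fun j _ => ?_
      push_cast
      ring
    rw [this]
    have := hi i
    generalize (1 - ∑ j, (x j : ℂ))⁻¹ = r
    field_simp
    ring
  simp only [key]
  rw [← Finset.mul_sum, one_div, Complex.ofReal_inv, inv_mul_cancel_left₀ hw]
  simp only [Finset.sum_add_distrib, Finset.sum_sub_distrib, ← Finset.mul_sum, ← Finset.sum_mul]
  have he : ∑ i, (x i : ℂ) * partialDeriv i u x = eulerDeriv u x := rfl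
  have hs : ∑ i, ∑ j, ((x i * x j : ℝ) : ℂ) * partialDeriv i (partialDeriv j u) x =
      ∑ i, ((x i * x i : ℝ) : ℂ) * partialDeriv i (partialDeriv i u) x +
      2 * ∑ i, ∑ j ∈ Finset.Ioi i, ((x i * x j : ℝ) : ℂ) * partialDeriv i (partialDeriv j u) x :=
    sum_sum_eq_diag_add_two_mul_Ioi fun i j => by
      rw [partialDeriv_comm i hux j, mul_comm (x i)]
  rw [hs, he]
  have h3 : ∑ i, ((x i * (1 - x i) : ℝ) : ℂ) * partialDeriv i (partialDeriv i u) x =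
      ∑ i, (x i : ℂ) * partialDeriv i (partialDeriv i u) x -
      ∑ i, ((x i * x i : ℝ) : ℂ) * partialDeriv i (partialDeriv i u) x := by
    rw [← Finset.sum_sub_distrib]
    refine Finset.sum_congr rfl fun i _ => ?_
    push_cast
    ring
  have h4 : ∑ i, ((1 - (n + 1) * x i : ℝ) : ℂ) * partialDeriv i u x =
      ∑ i, partialDeriv i u x - (n + 1) * eulerDeriv u x := by
    rw [← he, Finset.mul_sum, ← Finset.sum_sub_distrib]
    refine Finset.sum_congr rfl fun i _ => ?_
    push_cast
    ring
  unfold dunklXu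
  rw [h3, h4]
  simp only [Finset.sum_const, Finset.card_univ, Fintype.card_fin, nsmul_eq_mul]
  field_simp
  ring

end Metric

/-! ### Green's formula on the simplex -/

section Green

variable {n : ℕ}

theorem integral_simplexMeasure {E : Type*} [NormedAddCommGroup E] [NormedSpace ℝ E]
    (f : (Fin n → ℝ) → E) :
    ∫ x, f x ∂(simplexMeasure n) =
      ∫ x in openSimplex n, √(baranSimplex n x).det • f x := by
  unfold simplexMeasure
  rw [integral_withDensity_eq_integral_toReal_smul (by fun_prop)
    (Filter.Eventually.of_forall fun x => ENNReal.ofReal_lt_top)]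
  refine setIntegral_congr_fun (measurableSet_openSimplex n) fun x hx => ?_
  rw [ENNReal.toReal_ofReal (by positivity), det_baranSimplex hx, Real.sqrt_inv, one_div]
  rfl

theorem ae_mem_openSimplex (n : ℕ) : ∀ᵐ x ∂(simplexMeasure n), x ∈ openSimplex n :=
  (withDensity_absolutelyContinuous _ _).ae_le (ae_restrict_mem (measurableSet_openSimplex n))

theorem aestronglyMeasurable_of_continuousOn_openSimplex {E : Type*} [NormedAddCommGroup E]
    {f : (Fin n → ℝ) → E} (hf : ContinuousOn f (openSimplex n)) :
    AEStronglyMeasurable f (simplexMeasure n) :=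
  (hf.aestronglyMeasurable (measurableSet_openSimplex n)).mono_ac
    (withDensity_absolutelyContinuous _ _)

theorem integral_partialDeriv_eq_zero {F : (Fin n → ℝ) → ℂ} (hF : ContDiff ℝ 1 F)
    (hc : HasCompactSupport F) (i : Fin n) : ∫ x, partialDeriv i F x = 0 := by
  have hcont : Continuous (partialDeriv i F) :=
    (hF.continuous_fderiv (by norm_num)).clm_apply continuous_const
  have hsupp : HasCompactSupport (partialDeriv i F) :=
    hc.fderiv_apply (𝕜 := ℝ) (v := Pi.single i 1)
  have h := integral_mul_fderiv_eq_neg_fderiv_mul_of_integrable (μ := volume) (f := F)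
    (g := fun _ => (1 : ℂ)) (v := Pi.single i (1 : ℝ))
    (by simp only [mul_one]; exact hcont.integrable_of_hasCompactSupport hsupp) (by simp)
    (by simp only [mul_one]; exact hF.continuous.integrable_of_hasCompactSupport hc)
    (fun x _ => hF.differentiable (by norm_num) x) (fun x _ => differentiableAt_const _)
  simp only [fderiv_fun_const, Pi.zero_apply, zero_apply, mul_zero, integral_zero, mul_one] at h
  exact neg_eq_zero.1 h.symm

/-- The cutoff profile: zero on `t ≤ 1` and one on `t ≥ 2`. -/
noncomputable def cutoffProfile (t : ℝ) : ℝ := Real.smoothTransition (t - 1)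

theorem contDiff_cutoffProfile : ContDiff ℝ ∞ cutoffProfile :=
  Real.smoothTransition.contDiff.comp (contDiff_id.sub contDiff_const)

theorem cutoffProfile_eq_zero {t : ℝ} (h : t ≤ 1) : cutoffProfile t = 0 :=
  Real.smoothTransition.zero_of_nonpos (by linarith)

theorem cutoffProfile_eq_one {t : ℝ} (h : 2 ≤ t) : cutoffProfile t = 1 :=
  Real.smoothTransition.one_of_one_le (by linarith)

theorem abs_cutoffProfile_le (t : ℝ) : |cutoffProfile t| ≤ 1 := by
  unfold cutoffProfile
  rw [abs_of_nonneg (Real.smoothTransition.nonneg _)]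
  exact Real.smoothTransition.le_one _

theorem deriv_cutoffProfile_eq_zero {t : ℝ} (h : 2 < t) : deriv cutoffProfile t = 0 := by
  have : cutoffProfile =ᶠ[nhds t] fun _ => 1 := by
    filter_upwards [lt_mem_nhds h] with s hs
    exact cutoffProfile_eq_one hs.le
  rw [this.deriv_eq, deriv_const]

theorem continuous_deriv_cutoffProfile : Continuous (deriv cutoffProfile) :=
  contDiff_cutoffProfile.continuous_deriv (by simp)

/-- The derivative vanishes beyond `t = 2`, so only a compact interval matters. Applied at `t = k
ρ`, this bounds the cutoff error uniformly in `k`. -/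
theorem exists_mul_deriv_cutoffProfile_le :
    ∃ M, ∀ t, 0 ≤ t → |t * deriv cutoffProfile t| ≤ M := by
  obtain ⟨M, hM⟩ := (isCompact_Icc (a := (0 : ℝ)) (b := 2)).exists_bound_of_continuousOn
    (f := fun t => t * deriv cutoffProfile t)
    (continuous_id.mul continuous_deriv_cutoffProfile).continuousOn
  refine ⟨max M 0, fun t ht => ?_⟩
  by_cases h : t ≤ 2
  · exact (hM t ⟨ht, h⟩).trans (le_max_left _ _)
  · rw [deriv_cutoffProfile_eq_zero (not_le.1 h)]
    simp

theorem contDiffAt_logBarycentric {x : Fin n → ℝ} (hx : x ∈ openSimplex n) {m : WithTop ℕ∞} :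
    ContDiffAt ℝ m logBarycentric x := by
  refine ContDiffAt.add (ContDiffAt.log ?_ (sub_pos.2 hx.2).ne')
    (ContDiffAt.sum fun i _ => ContDiffAt.log ?_ (hx.1 i).ne')
  · exact contDiffAt_const.sub (ContDiffAt.sum fun i _ => contDiffAt_apply _ _ i x)
  · exact contDiffAt_apply _ _ i x

theorem contDiffAt_ofReal_comp {f : (Fin n → ℝ) → ℝ} {x : Fin n → ℝ} {m : WithTop ℕ∞}
    (hf : ContDiffAt ℝ m f x) : ContDiffAt ℝ m (fun y => ((f y : ℝ) : ℂ)) x :=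
  Complex.ofRealCLM.contDiff.contDiffAt.comp x hf

theorem contDiffAt_sqrt_det {x : Fin n → ℝ} (hx : x ∈ openSimplex n) {m : WithTop ℕ∞} :
    ContDiffAt ℝ m (fun y => ((√(baranSimplex n y).det : ℝ) : ℂ)) x := by
  have h : ContDiffAt ℝ m (fun y : Fin n → ℝ => Real.exp (-(1 / 2) * logBarycentric y)) x :=
    (contDiffAt_const.mul (contDiffAt_logBarycentric hx)).exp
  refine (contDiffAt_ofReal_comp h).congr_of_eventuallyEq ?_
  filter_upwards [openSimplex_mem_nhds hx] with y hy
  rw [sqrt_det_baranSimplex hy]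

theorem contDiffAt_ofReal_coord (i : Fin n) {x : Fin n → ℝ} {m : WithTop ℕ∞} :
    ContDiffAt ℝ m (fun y : Fin n → ℝ => ((y i : ℝ) : ℂ)) x :=
  contDiffAt_ofReal_comp (contDiffAt_apply _ _ i x)

theorem contDiffAt_eulerDeriv {v : (Fin n → ℝ) → ℂ} {x : Fin n → ℝ} {m k : WithTop ℕ∞}
    (hv : ContDiffAt ℝ k v x) (hm : m + 1 ≤ k) : ContDiffAt ℝ m (eulerDeriv v) x :=
  ContDiffAt.sum fun j _ => (contDiffAt_ofReal_coord j).mul (hv.partialDeriv j hm)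

theorem contDiffAt_riemGrad {v : (Fin n → ℝ) → ℂ} {x : Fin n → ℝ} {m k : WithTop ℕ∞}
    (hx : x ∈ openSimplex n) (hv : ContDiffAt ℝ k v x) (hm : m + 1 ≤ k) (i : Fin n) :
    ContDiffAt ℝ m (fun y => riemGrad (baranSimplex n) v y i) x :=
  ((contDiffAt_ofReal_coord i).mul
    ((hv.partialDeriv i hm).sub (contDiffAt_eulerDeriv hv hm))).congr_of_eventuallyEq
    (riemGrad_eventuallyEq v hx i)

/-- On the closed simplex the bound `ρ ≥ c > 0` excludes every face, so the set is a closed subset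
of the unit cube. The cutoffs vanish off such sets. -/
theorem isCompact_barycentricProd_ge (n : ℕ) {c : ℝ} (hc : 0 < c) :
    IsCompact {x : Fin n → ℝ | x ∈ openSimplex n ∧ c ≤ barycentricProd x} := by
  have h : {x : Fin n → ℝ | x ∈ openSimplex n ∧ c ≤ barycentricProd x} =
      Set.Icc 0 1 ∩ {x | ∑ i, x i ≤ 1} ∩ {x | c ≤ barycentricProd x} := by
    ext x
    constructor
    · rintro ⟨hx, hc⟩
      exact ⟨⟨⟨fun i => (hx.1 i).le, fun i => (lt_one_of_mem_openSimplex hx i).le⟩, hx.2.le⟩, hc⟩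
    · rintro ⟨⟨⟨h0, -⟩, h1⟩, h2⟩
      have hne : barycentricProd x ≠ 0 := (hc.trans_le h2).ne'
      have hp := mul_ne_zero_iff.1 hne
      refine ⟨⟨fun i => lt_of_le_of_ne (h0 i) fun h => ?_, lt_of_le_of_ne h1 fun h => ?_⟩, h2⟩
      · exact Finset.prod_ne_zero_iff.1 hp.2 i (Finset.mem_univ i) h.symm
      · exact hp.1 (by rw [h, sub_self])
  rw [h]
  refine (isCompact_Icc.inter_right (isClosed_le (by fun_prop) continuous_const)).inter_right
    (isClosed_le continuous_const ?_)
  unfold barycentricProd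
  fun_prop

/-- The cutoff function `φ(k ρ)` on the simplex, extended by zero, where `ρ` is the product of the
barycentric coordinates. -/
noncomputable def simplexCutoff (k : ℕ) (x : Fin n → ℝ) : ℝ :=
  (openSimplex n).indicator (fun y => cutoffProfile (k * Real.exp (logBarycentric y))) x

theorem contDiffAt_simplexCutoff (k : ℕ) {x : Fin n → ℝ} (hx : x ∈ openSimplex n) :
    ContDiffAt ℝ 1 (simplexCutoff k) x := by
  have h : ContDiffAt ℝ 1 (fun y : Fin n → ℝ => cutoffProfile (k * Real.exp (logBarycentric y)))
      x := by
    have h1 : ContDiff ℝ 1 cutoffProfile :=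
      contDiff_cutoffProfile.of_le (by exact_mod_cast le_top)
    have h2 : ContDiffAt ℝ 1 (fun y : Fin n → ℝ => k * Real.exp (logBarycentric y)) x :=
      contDiffAt_const.mul (contDiffAt_logBarycentric hx).exp
    exact h1.contDiffAt.comp (f := fun y : Fin n → ℝ => k * Real.exp (logBarycentric y)) x h2
  refine h.congr_of_eventuallyEq ?_
  filter_upwards [openSimplex_mem_nhds hx] with y hy
  exact Set.indicator_of_mem hy _

/-- The grouping as `(k ρ) φ'(k ρ)` times `∂ᵢ log ρ` isolates a factor that is bounded independently
of `k`. -/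
theorem partialDeriv_simplexCutoff (k : ℕ) {x : Fin n → ℝ} (hx : x ∈ openSimplex n)
    (i : Fin n) : partialDeriv i (fun y => ((simplexCutoff k y : ℝ) : ℂ)) x =
      (((k * barycentricProd x) * deriv cutoffProfile (k * barycentricProd x) : ℝ) : ℂ) *
        ((x i : ℂ)⁻¹ - (1 - ∑ j, (x j : ℂ))⁻¹) := by
  obtain ⟨L, hL, hL'⟩ := exists_hasFDerivAt_logBarycentric hx
  have h1 : HasFDerivAt (fun y : Fin n → ℝ => k * Real.exp (logBarycentric y)) _ x :=
    hL.exp.const_mul (k : ℝ)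
  have hd : HasDerivAt cutoffProfile (deriv cutoffProfile (k * Real.exp (logBarycentric x)))
      (k * Real.exp (logBarycentric x)) :=
    (contDiff_cutoffProfile.differentiable (by simp) _).hasDerivAt
  have h2 := hd.comp_hasFDerivAt x h1
  have he : (fun y => ((simplexCutoff k y : ℝ) : ℂ)) =ᶠ[nhds x]
      fun y => (((cutoffProfile ∘ fun y => k * Real.exp (logBarycentric y)) y : ℝ) : ℂ) := by
    filter_upwards [openSimplex_mem_nhds hx] with y hy
    rw [simplexCutoff, Set.indicator_of_mem hy]
    rfl
  rw [partialDeriv_congr i he, partialDeriv_ofReal_comp i h2, exp_logBarycentric hx]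
  simp only [smul_apply, hL', smul_eq_mul]
  push_cast
  ring

/-- The bilinear form `∑ᵢ ∂ᵢ u (grad v)ⁱ`. -/
noncomputable def gradPairing (u v : (Fin n → ℝ) → ℂ) (x : Fin n → ℝ) : ℂ :=
  ∑ i, partialDeriv i u x * riemGrad (baranSimplex n) v x i

/-- The poles of `d log ρ` cancel against the degeneracy of the inverse metric, since `∑ᵢ (grad v)ⁱ
= (1 - ∑ xⱼ) E v`. The right side has no denominators; this is why no boundary term appears. -/
theorem sum_partialDeriv_simplexCutoff_mul (k : ℕ) (v : (Fin n → ℝ) → ℂ) {x : Fin n → ℝ}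
    (hx : x ∈ openSimplex n) :
    ∑ i, partialDeriv i (fun y => ((simplexCutoff k y : ℝ) : ℂ)) x *
        riemGrad (baranSimplex n) v x i =
      (((k * barycentricProd x) * deriv cutoffProfile (k * barycentricProd x) : ℝ) : ℂ) *
        (∑ i, partialDeriv i v x - (n + 1) * eulerDeriv v x) := by
  have h0 : 1 - ∑ i, (x i : ℂ) ≠ 0 := by exact_mod_cast (sub_pos.2 hx.2).ne'
  have hi (i : Fin n) : (x i : ℂ) ≠ 0 := by exact_mod_cast (hx.1 i).ne'
  simp only [partialDeriv_simplexCutoff k hx, riemGrad_baranSimplex v hx]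
  have key (i : Fin n) (c : ℂ) : c * ((x i : ℂ)⁻¹ - (1 - ∑ j, (x j : ℂ))⁻¹) *
      (x i * (partialDeriv i v x - eulerDeriv v x)) =
      c * (partialDeriv i v x - eulerDeriv v x
        - (1 - ∑ j, (x j : ℂ))⁻¹ * (x i * partialDeriv i v x)
        + (1 - ∑ j, (x j : ℂ))⁻¹ * (x i * eulerDeriv v x)) := by
    have := hi i
    generalize (1 - ∑ j, (x j : ℂ))⁻¹ = r
    field_simp
    ring
  simp only [key, ← Finset.mul_sum, Finset.sum_add_distrib, Finset.sum_sub_distrib,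
    ← Finset.sum_mul]
  have he : ∑ i, (x i : ℂ) * partialDeriv i v x = eulerDeriv v x := rfl
  rw [he]
  congr 1
  simp only [Finset.sum_const, Finset.card_univ, Fintype.card_fin, nsmul_eq_mul]
  field_simp
  ring

/-- The divergence theorem for the compactly supported `C¹` field `χ u √(det G) grad v`, with `χ`
the cutoff; the product rule gives the three terms. -/
theorem integral_cutoff_green {u v : (Fin n → ℝ) → ℂ} (hu : ContDiffOn ℝ 1 u (openSimplex n))
    (hv : ContDiffOn ℝ 2 v (openSimplex n)) (k : ℕ) :
    ∫ x, (((simplexCutoff k x : ℝ) : ℂ) *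
        (u x * laplaceBeltrami (baranSimplex n) v x + gradPairing u v x) +
      (((k * barycentricProd x) * deriv cutoffProfile (k * barycentricProd x) : ℝ) : ℂ) *
        (u x * (∑ i, partialDeriv i v x - (n + 1) * eulerDeriv v x))) ∂(simplexMeasure n) = 0 := by
  set F : Fin n → (Fin n → ℝ) → ℂ := fun i x =>
    ((simplexCutoff k x : ℝ) : ℂ) * u x *
      (((√(baranSimplex n x).det : ℝ) : ℂ) * riemGrad (baranSimplex n) v x i) with hF
  -- The threshold `(k + 1)⁻¹`, rather than `k⁻¹`, is positive also for `k = 0`, and `k ρ ≤ 1` still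
  -- holds on the simplex outside `K`.
  set K := {x : Fin n → ℝ | x ∈ openSimplex n ∧ ((k : ℝ) + 1)⁻¹ ≤ barycentricProd x} with hK
  have hKc : IsCompact K := isCompact_barycentricProd_ge n (by positivity)
  have hux {x} (hx : x ∈ openSimplex n) : ContDiffAt ℝ 1 u x :=
    hu.contDiffAt (openSimplex_mem_nhds hx)
  have hvx {x} (hx : x ∈ openSimplex n) : ContDiffAt ℝ 2 v x :=
    hv.contDiffAt (openSimplex_mem_nhds hx)
  have hcut {x : Fin n → ℝ} (hx : x ∉ K) : simplexCutoff k x = 0 := by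
    by_cases hS : x ∈ openSimplex n
    · rw [simplexCutoff, Set.indicator_of_mem hS, exp_logBarycentric hS]
      apply cutoffProfile_eq_zero
      have hlt : barycentricProd x < ((k : ℝ) + 1)⁻¹ := not_le.1 fun h => hx ⟨hS, h⟩
      calc k * barycentricProd x ≤ k * ((k : ℝ) + 1)⁻¹ := by gcongr
        _ ≤ 1 := by
          rw [← div_eq_mul_inv, div_le_one (by positivity)]
          linarith
    · exact Set.indicator_of_notMem hS _
  have hF0 (i : Fin n) {x} (hx : x ∉ K) : F i x = 0 := by simp [hF, hcut hx]
  have hFc (i : Fin n) : HasCompactSupport (F i) := HasCompactSupport.intro hKc fun x hx => hF0 i hx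
  have hFd (i : Fin n) : ContDiff ℝ 1 (F i) := by
    rw [contDiff_iff_contDiffAt]
    intro x
    by_cases hx : x ∈ openSimplex n
    · exact ((contDiffAt_ofReal_comp (contDiffAt_simplexCutoff k hx)).mul (hux hx)).mul
        ((contDiffAt_sqrt_det hx).mul (contDiffAt_riemGrad hx (hvx hx) (by norm_num) i))
    · have : F i =ᶠ[nhds x] fun _ => 0 := by
        filter_upwards [hKc.isClosed.isOpen_compl.mem_nhds fun h => hx h.1] with y hy
        exact hF0 i hy
      exact contDiffAt_const.congr_of_eventuallyEq this
  have hsum : ∫ x, ∑ i, partialDeriv i (F i) x = 0 := by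
    rw [integral_finsetSum]
    · exact Finset.sum_eq_zero fun i _ => integral_partialDeriv_eq_zero (hFd i) (hFc i) i
    · intro i _
      exact (((hFd i).continuous_fderiv (by norm_num)).clm_apply
        continuous_const).integrable_of_hasCompactSupport
        ((hFc i).fderiv_apply (𝕜 := ℝ) (v := Pi.single i 1))
  have hout : ∀ x, x ∉ openSimplex n → ∑ i, partialDeriv i (F i) x = 0 := by
    intro x hx
    refine Finset.sum_eq_zero fun i _ => ?_
    have : F i =ᶠ[nhds x] fun _ => 0 := by
      filter_upwards [hKc.isClosed.isOpen_compl.mem_nhds fun h => hx h.1] with y hy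
      exact hF0 i hy
    rw [partialDeriv_congr i this, partialDeriv_const]
  rw [integral_simplexMeasure, ← hsum, ← setIntegral_eq_integral_of_forall_compl_eq_zero hout]
  refine setIntegral_congr_fun (measurableSet_openSimplex n) fun x hx => ?_
  have hw : ((√(baranSimplex n x).det : ℝ) : ℂ) ≠ 0 := by
    exact_mod_cast (sqrt_det_baranSimplex_pos hx).ne'
  have hχ : DifferentiableAt ℝ (fun y => ((simplexCutoff k y : ℝ) : ℂ)) x :=
    (contDiffAt_ofReal_comp (contDiffAt_simplexCutoff k hx)).differentiableAt (by norm_num)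
  have hud : DifferentiableAt ℝ u x := (hux hx).differentiableAt (by norm_num)
  have hg (i : Fin n) : DifferentiableAt ℝ (fun y => ((√(baranSimplex n y).det : ℝ) : ℂ) *
      riemGrad (baranSimplex n) v y i) x :=
    (differentiableAt_sqrt_det hx).mul (differentiableAt_riemGrad hx (hvx hx) i)
  have hexp (i : Fin n) : partialDeriv i (F i) x =
      ((simplexCutoff k x : ℝ) : ℂ) * u x * partialDeriv i (fun y =>
        ((√(baranSimplex n y).det : ℝ) : ℂ) * riemGrad (baranSimplex n) v y i) x +
      ((√(baranSimplex n x).det : ℝ) : ℂ) * (((simplexCutoff k x : ℝ) : ℂ) *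
        (partialDeriv i u x * riemGrad (baranSimplex n) v x i) +
        u x * (partialDeriv i (fun y => ((simplexCutoff k y : ℝ) : ℂ)) x *
          riemGrad (baranSimplex n) v x i)) := by
    rw [hF]
    simp only
    rw [partialDeriv_mul i (hχ.fun_mul hud) (hg i), partialDeriv_mul i hχ hud]
    ring
  have hlap : ∑ i, partialDeriv i (fun y =>
      ((√(baranSimplex n y).det : ℝ) : ℂ) * riemGrad (baranSimplex n) v y i) x =
      ((√(baranSimplex n x).det : ℝ) : ℂ) * laplaceBeltrami (baranSimplex n) v x := by
    unfold laplaceBeltrami riemDiv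
    rw [one_div, Complex.ofReal_inv, mul_inv_cancel_left₀ hw]
  simp only [hexp]
  rw [Finset.sum_add_distrib, ← Finset.mul_sum, ← Finset.mul_sum, Finset.sum_add_distrib,
    ← Finset.mul_sum, ← Finset.mul_sum, hlap, sum_partialDeriv_simplexCutoff_mul k v hx,
    Complex.real_smul]
  unfold gradPairing
  ring

/-- **Green's formula** for a test function with bounded first derivatives; the degeneracy of the
metric makes boundary conditions unnecessary. -/
theorem integral_gradPairing_eq_neg {u v : (Fin n → ℝ) → ℂ}
    (hu : ContDiffOn ℝ 1 u (openSimplex n)) (hv : ContDiffOn ℝ 2 v (openSimplex n))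
    {C : ℝ} (hC : ∀ x ∈ openSimplex n, ∀ i, ‖partialDeriv i v x‖ ≤ C)
    (hui : Integrable u (simplexMeasure n))
    (hlap : Integrable (fun x => u x * laplaceBeltrami (baranSimplex n) v x) (simplexMeasure n))
    (hgrad : Integrable (gradPairing u v) (simplexMeasure n)) :
    ∫ x, gradPairing u v x ∂(simplexMeasure n) =
      -∫ x, u x * laplaceBeltrami (baranSimplex n) v x ∂(simplexMeasure n) := by
  obtain ⟨M, hM⟩ := exists_mul_deriv_cutoffProfile_le
  have hM0 : 0 ≤ M := (abs_nonneg _).trans (hM 0 le_rfl)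
  set h : (Fin n → ℝ) → ℂ := fun x => ∑ i, partialDeriv i v x - (n + 1) * eulerDeriv v x with hh
  have hvx {x} (hx : x ∈ openSimplex n) : ContDiffAt ℝ 2 v x :=
    hv.contDiffAt (openSimplex_mem_nhds hx)
  have hhc : ContinuousOn h (openSimplex n) := fun x hx => by
    refine ContinuousAt.continuousWithinAt (ContinuousAt.sub ?_ (continuousAt_const.mul ?_))
    · exact tendsto_finsetSum _ fun i _ =>
        ((hvx hx).partialDeriv i (m := 1) (by norm_num)).continuousAt
    · exact (contDiffAt_eulerDeriv (hvx hx) (m := 1) (by norm_num)).continuousAt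
  set B : ℝ := n * C + (n + 1) * (n * C)
  have hhB : ∀ x ∈ openSimplex n, ‖h x‖ ≤ B := by
    intro x hx
    have h1 : ‖∑ i, partialDeriv i v x‖ ≤ n * C :=
      (norm_sum_le_of_le _ fun i _ => hC x hx i).trans (by simp)
    have h2 : ‖eulerDeriv v x‖ ≤ n * C := by
      refine (norm_sum_le_of_le (f := fun j => ((x j : ℝ) : ℂ) * partialDeriv j v x)
        (n := fun _ => C) _ fun i _ => ?_).trans (by simp)
      rw [norm_mul, Complex.norm_real, Real.norm_eq_abs, abs_of_pos (hx.1 i)]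
      exact (mul_le_of_le_one_left (norm_nonneg _) (lt_one_of_mem_openSimplex hx i).le).trans
        (hC x hx i)
    have h3 : ‖((n : ℂ) + 1)‖ = n + 1 := by
      rw [← Nat.cast_succ, Complex.norm_natCast]
      simp
    calc ‖h x‖ ≤ ‖∑ i, partialDeriv i v x‖ + ‖((n : ℂ) + 1) * eulerDeriv v x‖ := norm_sub_le _ _
      _ ≤ B := by
        rw [norm_mul, h3]
        exact add_le_add h1 (mul_le_mul_of_nonneg_left h2 (by positivity))
  -- At a fixed point `k ρ > 2` for all large `k`, where the cutoff is one and its derivative zero.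
  -- All the integrals are zero, hence so is the limit.
  have hlim := tendsto_integral_of_dominated_convergence (μ := simplexMeasure n)
    (F := fun (k : ℕ) x => (((simplexCutoff k x : ℝ) : ℂ) *
        (u x * laplaceBeltrami (baranSimplex n) v x + gradPairing u v x) +
      (((k * barycentricProd x) * deriv cutoffProfile (k * barycentricProd x) : ℝ) : ℂ) *
        (u x * h x)))
    (f := fun x => u x * laplaceBeltrami (baranSimplex n) v x + gradPairing u v x)
    (bound := fun x => ‖u x * laplaceBeltrami (baranSimplex n) v x‖ + ‖gradPairing u v x‖ +
      M * B * ‖u x‖) ?_ ?_ ?_ ?_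
  · simp only [hh, integral_cutoff_green hu hv] at hlim
    have := tendsto_nhds_unique tendsto_const_nhds hlim
    rw [integral_add hlap hgrad] at this
    exact eq_neg_of_add_eq_zero_right this.symm
  · intro k
    refine AEStronglyMeasurable.add (AEStronglyMeasurable.mul ?_ (hlap.add hgrad).1)
      (AEStronglyMeasurable.mul ?_ (hui.1.mul (aestronglyMeasurable_of_continuousOn_openSimplex hhc)))
    · refine aestronglyMeasurable_of_continuousOn_openSimplex fun x hx => ?_
      exact (contDiffAt_ofReal_comp
        (contDiffAt_simplexCutoff k hx)).continuousAt.continuousWithinAt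
    · refine (Continuous.aestronglyMeasurable ?_)
      have h1 : Continuous fun x : Fin n → ℝ => k * barycentricProd x := by
        unfold barycentricProd; fun_prop
      exact Complex.continuous_ofReal.comp (h1.mul (continuous_deriv_cutoffProfile.comp h1))
  · exact (hlap.norm.add hgrad.norm).add (hui.norm.const_mul _)
  · intro k
    filter_upwards [ae_mem_openSimplex n] with x hx
    have h1 : ‖((simplexCutoff k x : ℝ) : ℂ)‖ ≤ 1 := by
      rw [Complex.norm_real, simplexCutoff, Set.indicator_of_mem hx]
      exact abs_cutoffProfile_le _
    have h2 : ‖(((k * barycentricProd x) * deriv cutoffProfile (k * barycentricProd x) : ℝ) : ℂ)‖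
        ≤ M := by
      rw [Complex.norm_real]
      exact hM _ (mul_nonneg (Nat.cast_nonneg _) (barycentricProd_pos hx).le)
    refine (norm_add_le _ _).trans (add_le_add ?_ ?_)
    · rw [norm_mul]
      exact (mul_le_of_le_one_left (norm_nonneg _) h1).trans (norm_add_le _ _)
    · rw [norm_mul, norm_mul, mul_assoc M, mul_comm B]
      have := hhB x hx
      gcongr
  · filter_upwards [ae_mem_openSimplex n] with x hx
    have hp := barycentricProd_pos hx
    refine tendsto_const_nhds.congr' ?_
    obtain ⟨N, hN⟩ := exists_nat_gt (2 / barycentricProd x)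
    filter_upwards [Filter.eventually_ge_atTop N] with k hk
    have hlt : 2 < k * barycentricProd x := by
      rw [div_lt_iff₀ hp] at hN
      refine hN.trans_le ?_
      gcongr
    rw [deriv_cutoffProfile_eq_zero hlt, simplexCutoff, Set.indicator_of_mem hx,
      exp_logBarycentric hx, cutoffProfile_eq_one hlt.le]
    simp

end Green

/-! ### The simplex measure as an iterated beta measure -/

section Fibration

variable {n : ℕ}

/-- The map `(t, y) ↦ (t, (1 - t) y)`, which sends `(0, 1) × Sⁿ` onto `Sⁿ⁺¹`. -/
noncomputable def simplexCone (n : ℕ) (p : ℝ × (Fin n → ℝ)) : Fin (n + 1) → ℝ :=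
  Fin.cons p.1 ((1 - p.1) • p.2)

theorem measurable_simplexCone (n : ℕ) : Measurable (simplexCone n) := by
  rw [measurable_pi_iff]
  intro i
  refine Fin.cases ?_ (fun j => ?_) i
  · simpa [simplexCone] using measurable_fst
  · simp only [simplexCone, Fin.cons_succ, Pi.smul_apply, smul_eq_mul]
    fun_prop

theorem cons_mem_openSimplex_iff {t : ℝ} {y : Fin n → ℝ} (ht : t < 1) :
    (Fin.cons t ((1 - t) • y) : Fin (n + 1) → ℝ) ∈ openSimplex (n + 1) ↔
      0 < t ∧ y ∈ openSimplex n := by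
  have hr : 0 < 1 - t := sub_pos.2 ht
  simp only [openSimplex, Set.mem_ofPred_eq, Fin.forall_fin_succ, Fin.cons_zero, Fin.cons_succ,
    Pi.smul_apply, smul_eq_mul, Fin.sum_univ_succ, ← Finset.mul_sum, and_assoc]
  refine and_congr_right fun _ => and_congr ?_ ?_
  · exact forall_congr' fun i => by rw [mul_pos_iff_of_pos_left hr]
  · rw [← lt_sub_iff_add_lt', mul_lt_iff_lt_one_right hr]

theorem cons_notMem_openSimplex {t : ℝ} {z : Fin n → ℝ} (ht : ¬ (0 < t ∧ t < 1)) :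
    (Fin.cons t z : Fin (n + 1) → ℝ) ∉ openSimplex (n + 1) := by
  intro h
  refine ht ⟨by simpa using h.1 0, by simpa using lt_one_of_mem_openSimplex h 0⟩

theorem lintegral_pi_succ {g : (Fin (n + 1) → ℝ) → ENNReal} (hg : Measurable g) :
    ∫⁻ x, g x = ∫⁻ t : ℝ, ∫⁻ z : Fin n → ℝ, g (Fin.cons t z) := by
  have hmp := (volume_preserving_piFinSuccAbove (fun _ : Fin (n + 1) => ℝ) 0).symm
  have hm : Measurable fun p : ℝ × (Fin n → ℝ) =>
      g ((MeasurableEquiv.piFinSuccAbove (fun _ => ℝ) 0).symm p) :=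
    hg.comp (MeasurableEquiv.measurable _)
  rw [← hmp.lintegral_comp hg]
  refine (lintegral_prod _ hm.aemeasurable).trans ?_
  simp [MeasurableEquiv.piFinSuccAbove, Fin.insertNthEquiv, Fin.insertNth_zero']

theorem lintegral_smul_eq {r : ℝ} (hr : 0 < r) {G : (Fin n → ℝ) → ENNReal} (hG : Measurable G) :
    ∫⁻ z, G z = ENNReal.ofReal (r ^ n) * ∫⁻ y, G (r • y) := by
  have h := Measure.map_addHaar_smul (volume : Measure (Fin n → ℝ)) hr.ne'
  have h2 := lintegral_map (μ := volume) hG (measurable_const_smul r (α := Fin n → ℝ))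
  rw [h, lintegral_smul_measure, Module.finrank_fin_fun, abs_of_pos (by positivity)] at h2
  rw [← h2, smul_eq_mul, ← mul_assoc, ← ENNReal.ofReal_mul (by positivity),
    mul_inv_cancel₀ (by positivity), ENNReal.ofReal_one, one_mul]

/-- The image of the simplex measure under the first coordinate, up to the mass of the fibres. -/
noncomputable def simplexFiber (n : ℕ) : Measure ℝ :=
  ENNReal.ofReal (ProbabilityTheory.beta (1 / 2) (((n : ℝ) + 1) / 2)) •
    ProbabilityTheory.betaMeasure (1 / 2) (((n : ℝ) + 1) / 2)

instance (n : ℕ) : IsProbabilityMeasure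
    (ProbabilityTheory.betaMeasure (1 / 2) (((n : ℝ) + 1) / 2)) :=
  ProbabilityTheory.isProbabilityMeasureBeta (by norm_num) (by positivity)

instance (n : ℕ) : IsFiniteMeasure (simplexFiber n) := by
  unfold simplexFiber
  exact Measure.smul_finite _ ENNReal.ofReal_ne_top

theorem lintegral_simplexFiber {f : ℝ → ENNReal} (hf : Measurable f) :
    ∫⁻ t, f t ∂(simplexFiber n) = ∫⁻ t, (if 0 < t ∧ t < 1 then
      ENNReal.ofReal (t ^ (-(1 / 2) : ℝ) * (1 - t) ^ (((n : ℝ) - 1) / 2)) else 0) * f t := by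
  have hb : 0 < ProbabilityTheory.beta (1 / 2) (((n : ℝ) + 1) / 2) :=
    ProbabilityTheory.beta_pos (by norm_num) (by positivity)
  have hmeas : Measurable (ProbabilityTheory.betaPDF (1 / 2) (((n : ℝ) + 1) / 2)) :=
    (ProbabilityTheory.measurable_betaPDFReal _ _).ennreal_ofReal
  unfold simplexFiber ProbabilityTheory.betaMeasure
  rw [lintegral_smul_measure, lintegral_withDensity_eq_lintegral_mul _ hmeas hf, smul_eq_mul,
    ← lintegral_const_mul _ (hmeas.mul hf)]
  refine lintegral_congr fun t => ?_
  simp only [Pi.mul_apply, ← mul_assoc]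
  congr 1
  rw [ProbabilityTheory.betaPDF_eq, ← ENNReal.ofReal_mul hb.le]
  split_ifs with h
  · congr 1
    rw [mul_assoc, ← mul_assoc, mul_one_div_cancel hb.ne', one_mul]
    congr 2 <;> ring
  · simp

theorem measurable_simplexDensity (n : ℕ) : Measurable fun x : Fin n → ℝ =>
    ENNReal.ofReal (1 / √((1 - ∑ i, x i) * ∏ i, x i)) := by fun_prop

theorem lintegral_simplexMeasure {f : (Fin n → ℝ) → ENNReal} (hf : Measurable f) :
    ∫⁻ x, f x ∂(simplexMeasure n) = ∫⁻ x, (openSimplex n).indicator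
      (fun x => ENNReal.ofReal (1 / √((1 - ∑ i, x i) * ∏ i, x i)) * f x) x := by
  unfold simplexMeasure
  rw [lintegral_withDensity_eq_lintegral_mul _ (measurable_simplexDensity n) hf,
    lintegral_indicator (measurableSet_openSimplex n)]
  rfl

/-- Since `ρ (t, (1 - t) y) = t (1 - t)^(n + 1) ρ y`, the Jacobian `(1 - t)^n` leaves the exponent
`n - (n + 1) / 2 = (n - 1) / 2`. -/
theorem rpow_mul_density {t : ℝ} (ht : 0 < t) (ht1 : t < 1) {y : Fin n → ℝ}
    (hy : y ∈ openSimplex n) :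
    (1 - t) ^ n * (1 / √(barycentricProd (Fin.cons t ((1 - t) • y) : Fin (n + 1) → ℝ))) =
      t ^ (-(1 / 2) : ℝ) * (1 - t) ^ (((n : ℝ) - 1) / 2) * (1 / √(barycentricProd y)) := by
  have hr : 0 < 1 - t := sub_pos.2 ht1
  have hp := barycentricProd_pos hy
  have he : barycentricProd (Fin.cons t ((1 - t) • y) : Fin (n + 1) → ℝ) =
      t * ((1 - t) ^ (n + 1) * barycentricProd y) := by
    simp only [barycentricProd, Fin.sum_univ_succ, Fin.prod_univ_succ, Fin.cons_zero,
      Fin.cons_succ, Pi.smul_apply, smul_eq_mul, Finset.prod_mul_distrib, Finset.prod_const,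
      Finset.card_univ, Fintype.card_fin, ← Finset.mul_sum]
    ring
  have hpow : (1 - t) ^ n = (1 - t) ^ (((n : ℝ) - 1) / 2) * √((1 - t) ^ (n + 1)) := by
    rw [Real.sqrt_eq_rpow, ← Real.rpow_natCast, ← Real.rpow_natCast, ← Real.rpow_mul hr.le,
      ← Real.rpow_add hr]
    congr 1
    push_cast
    ring
  have ht' : t ^ (-(1 / 2) : ℝ) = 1 / √t := by
    rw [Real.rpow_neg ht.le, Real.sqrt_eq_rpow, one_div (t ^ _)]
  rw [he, Real.sqrt_mul ht.le, Real.sqrt_mul (by positivity), hpow, ht']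
  have h1 : 0 < √((1 - t) ^ (n + 1)) := Real.sqrt_pos.2 (by positivity)
  have h2 : 0 < √t := Real.sqrt_pos.2 ht
  have h3 : 0 < √(barycentricProd y) := Real.sqrt_pos.2 hp
  field_simp

instance (n : ℕ) : SFinite (simplexMeasure n) := by
  unfold simplexMeasure; infer_instance

/-- Fubini in the first coordinate, then rescaling of each slice by `1 - t`. This product structure
drives every induction on the dimension. -/
theorem simplexMeasure_succ (n : ℕ) : simplexMeasure (n + 1) =
    Measure.map (simplexCone n) ((simplexFiber n).prod (simplexMeasure n)) := by
  refine Measure.ext_of_lintegral _ fun f hf => ?_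
  have hf' : Measurable fun p => f (simplexCone n p) := hf.comp (measurable_simplexCone n)
  have hfy (t : ℝ) : Measurable fun y => f (simplexCone n (t, y)) :=
    hf'.comp measurable_prodMk_left
  have hg : Measurable ((openSimplex (n + 1)).indicator fun x =>
      ENNReal.ofReal (1 / √((1 - ∑ i, x i) * ∏ i, x i)) * f x) :=
    ((measurable_simplexDensity _).mul hf).indicator (measurableSet_openSimplex _)
  rw [lintegral_map hf (measurable_simplexCone n), lintegral_prod _ hf'.aemeasurable,
    lintegral_simplexFiber (Measurable.lintegral_prod_right' hf'), lintegral_simplexMeasure hf,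
    lintegral_pi_succ hg]
  refine lintegral_congr fun t => ?_
  by_cases ht : 0 < t ∧ t < 1
  · have hr : 0 < 1 - t := sub_pos.2 ht.2
    have hcons : Measurable fun z : Fin n → ℝ => (Fin.cons t z : Fin (n + 1) → ℝ) := by
      rw [measurable_pi_iff]
      intro i
      refine Fin.cases ?_ (fun j => ?_) i
      · simp
      · simpa using measurable_pi_apply j
    have hgc : Measurable fun z : Fin n → ℝ => (openSimplex (n + 1)).indicator (fun x =>
        ENNReal.ofReal (1 / √((1 - ∑ i, x i) * ∏ i, x i)) * f x) (Fin.cons t z) := hg.comp hcons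
    rw [if_pos ht, lintegral_simplexMeasure (hfy t), lintegral_smul_eq hr hgc,
      ← lintegral_const_mul', ← lintegral_const_mul']
    · refine lintegral_congr fun y => ?_
      have hiff := cons_mem_openSimplex_iff (y := y) ht.2
      by_cases hy : y ∈ openSimplex n
      · rw [Set.indicator_of_mem (hiff.2 ⟨ht.1, hy⟩), Set.indicator_of_mem hy, ← mul_assoc,
          ← mul_assoc, ← ENNReal.ofReal_mul (pow_nonneg hr.le _), ← ENNReal.ofReal_mul
            (mul_nonneg (Real.rpow_nonneg ht.1.le _) (Real.rpow_nonneg hr.le _))]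
        congr 2
        exact rpow_mul_density ht.1 ht.2 hy
      · rw [Set.indicator_of_notMem hy, Set.indicator_of_notMem fun h => hy (hiff.1 h).2]
        simp
    · exact ENNReal.ofReal_ne_top
    · exact ENNReal.ofReal_ne_top
  · rw [if_neg ht, zero_mul]
    simp [Set.indicator_of_notMem (cons_notMem_openSimplex ht)]

/-- Induction along the fibration, starting from a one-point space: a product of finite measures is
finite, and so is its image. -/
theorem isFiniteMeasure_simplexMeasure : ∀ n : ℕ, IsFiniteMeasure (simplexMeasure n)
  | 0 => by
    unfold simplexMeasure
    refine isFiniteMeasure_withDensity_ofReal ?_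
    simp only [Finset.univ_eq_empty, Finset.sum_empty, Finset.prod_empty]
    exact (hasFiniteIntegral_const (μ := volume.restrict (openSimplex 0)) (1 / √((1 - 0) * 1)))
  | n + 1 => by
    have := isFiniteMeasure_simplexMeasure n
    rw [simplexMeasure_succ]
    infer_instance

instance (n : ℕ) : IsFiniteMeasure (simplexMeasure n) := isFiniteMeasure_simplexMeasure n

theorem ae_simplexFiber (n : ℕ) : ∀ᵐ t ∂(simplexFiber n), 0 < t ∧ t < 1 := by
  have hms : MeasurableSet {t : ℝ | ¬ (0 < t ∧ t < 1)} := by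
    refine MeasurableSet.compl ?_
    exact measurableSet_Ioo
  rw [ae_iff, ← lintegral_indicator_one hms,
    lintegral_simplexFiber (measurable_one.indicator hms)]
  refine (lintegral_congr fun t => ?_).trans lintegral_zero
  by_cases h : 0 < t ∧ t < 1
  · rw [Set.indicator_of_notMem (by simpa using h), mul_zero]
  · rw [if_neg h, zero_mul]

/-- Integration of a function which separates in the coordinates `(t, (1 - t) y)`. -/
theorem integral_simplexMeasure_succ {F : (Fin (n + 1) → ℝ) → ℝ} {a : ℝ → ℝ}
    {c : (Fin n → ℝ) → ℝ} (hF : AEStronglyMeasurable F (simplexMeasure (n + 1)))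
    (h : ∀ t, 0 < t → t < 1 → ∀ y, F (Fin.cons t ((1 - t) • y)) = a t * c y) :
    ∫ x, F x ∂(simplexMeasure (n + 1)) =
      (∫ t, a t ∂(simplexFiber n)) * ∫ y, c y ∂(simplexMeasure n) := by
  rw [simplexMeasure_succ] at hF ⊢
  rw [integral_map (measurable_simplexCone n).aemeasurable hF, ← integral_prod_mul]
  refine integral_congr_ae ?_
  have h2 : ∀ᵐ p ∂((simplexFiber n).prod (simplexMeasure n)), 0 < p.1 ∧ p.1 < 1 :=
    Measure.quasiMeasurePreserving_fst.ae (ae_simplexFiber n)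
  filter_upwards [h2] with p hp
  exact h p.1 hp.1 hp.2 p.2

end Fibration

/-! ### Orthogonality of the Jacobi polynomials and of the simplex polynomials -/

section Jacobi

open Polynomial

/-- The moments `∫ (1 - t)^N` of the fibre measure. -/
noncomputable def fiberMoment (n N : ℕ) : ℝ := ∫ t, (1 - t) ^ N ∂(simplexFiber n)

theorem fiberMoment_eq (n N : ℕ) :
    fiberMoment n N = ProbabilityTheory.beta (1 / 2) (((n : ℝ) + 1) / 2 + N) := by
  have hpos : 0 < ProbabilityTheory.beta (1 / 2) (((n : ℝ) + 1) / 2 + N) :=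
    ProbabilityTheory.beta_pos (by norm_num) (by positivity)
  have hmeas : Measurable (ProbabilityTheory.betaPDF (1 / 2) (((n : ℝ) + 1) / 2 + N)) :=
    (ProbabilityTheory.measurable_betaPDFReal _ _).ennreal_ofReal
  unfold fiberMoment
  rw [integral_eq_lintegral_of_nonneg_ae, lintegral_simplexFiber (by fun_prop)]
  · have h : ∀ t : ℝ, (if 0 < t ∧ t < 1 then
        ENNReal.ofReal (t ^ (-(1 / 2) : ℝ) * (1 - t) ^ (((n : ℝ) - 1) / 2)) else 0) *
        ENNReal.ofReal ((1 - t) ^ N) =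
        ENNReal.ofReal (ProbabilityTheory.beta (1 / 2) (((n : ℝ) + 1) / 2 + N)) *
          ProbabilityTheory.betaPDF (1 / 2) (((n : ℝ) + 1) / 2 + N) t := by
      intro t
      rw [ProbabilityTheory.betaPDF_eq, ← ENNReal.ofReal_mul hpos.le]
      split_ifs with h
      · have hr : 0 < 1 - t := sub_pos.2 h.2
        rw [← ENNReal.ofReal_mul (mul_nonneg (Real.rpow_nonneg h.1.le _)
          (Real.rpow_nonneg hr.le _))]
        congr 1
        rw [← mul_assoc, ← mul_assoc, mul_one_div_cancel hpos.ne', one_mul, mul_assoc,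
          ← Real.rpow_natCast (1 - t) N, ← Real.rpow_add hr]
        congr 2 <;> ring
      · simp
    simp only [h]
    rw [lintegral_const_mul _ hmeas, ProbabilityTheory.lintegral_betaPDF_eq_one (by norm_num)
      (by positivity), mul_one, ENNReal.toReal_ofReal hpos.le]
  · filter_upwards [ae_simplexFiber n] with t ht
    exact pow_nonneg (sub_nonneg.2 ht.2.le) _
  · fun_prop

/-- The functional equation of `Γ`. This recursion is the only property of the moments that the
orthogonality proof uses. -/
theorem fiberMoment_succ (n N : ℕ) :
    fiberMoment n (N + 1) * ((n : ℝ) / 2 + N + 1) = (((n : ℝ) + 1) / 2 + N) * fiberMoment n N := by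
  have h1 : (0 : ℝ) < ((n : ℝ) + 1) / 2 + N := by positivity
  have h2 : (0 : ℝ) < 1 / 2 + (((n : ℝ) + 1) / 2 + N) := by positivity
  rw [fiberMoment_eq, fiberMoment_eq, ProbabilityTheory.beta, ProbabilityTheory.beta]
  have e1 : ((n : ℝ) + 1) / 2 + ((N + 1 : ℕ) : ℝ) = (((n : ℝ) + 1) / 2 + N) + 1 := by
    push_cast; ring
  rw [e1, ← add_assoc, Real.Gamma_add_one h1.ne', Real.Gamma_add_one h2.ne']
  have h3 := Real.Gamma_pos_of_pos h2
  have e2 : (n : ℝ) / 2 + N + 1 = 1 / 2 + (((n : ℝ) + 1) / 2 + N) := by ring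
  rw [e2]
  field_simp

/-- The coefficients of `J_m^{a,-1/2}(2 t - 1)` as a polynomial in `1 - t`. -/
noncomputable def jacobiCoeff (m : ℕ) (a : ℝ) (k : ℕ) : ℝ :=
  (1 / (m.factorial : ℝ)) * ((m.choose k : ℝ) * (ascPochhammer ℝ k).eval (m + a + 1 / 2) *
    (ascPochhammer ℝ (m - k)).eval (a + k + 1)) * (-1) ^ k

/-- This is the hypergeometric form of Jacobi's differential equation in the variable `1 - t`, read
coefficientwise. At `k = m` both sides vanish, the left one because `m.choose (m + 1) = 0`. -/
theorem jacobiCoeff_succ (m : ℕ) (a : ℝ) (k : ℕ) (hk : k ≤ m) :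
    jacobiCoeff m a (k + 1) * ((k + 1) * (k + 1 + a)) =
      jacobiCoeff m a k * (k * (k + a + 1 / 2) - m * (m + a + 1 / 2)) := by
  unfold jacobiCoeff
  rcases hk.eq_or_lt with rfl | hlt
  · simp
  · obtain ⟨j, rfl⟩ := Nat.exists_eq_add_of_lt hlt
    have e1 : k + j + 1 - k = j + 1 := by omega
    have e2 : k + j + 1 - (k + 1) = j := by omega
    have hc : ((k + j + 1).choose (k + 1) : ℝ) * (k + 1) = (k + j + 1).choose k * (j + 1) := by
      have := Nat.choose_succ_right_eq (k + j + 1) k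
      rw [e1] at this
      exact_mod_cast this
    have hp : (ascPochhammer ℝ (j + 1)).eval (a + k + 1) =
        (a + k + 1) * (ascPochhammer ℝ j).eval (a + ((k + 1 : ℕ) : ℝ) + 1) := by
      rw [ascPochhammer_succ_left, eval_mul, eval_X, eval_comp]
      congr 2
      simp only [eval_add, eval_X, eval_one]
      push_cast
      ring
    rw [e1, e2, hp, ascPochhammer_succ_eval, pow_succ]
    generalize eval (a + ((k + 1 : ℕ) : ℝ) + 1) (ascPochhammer ℝ j) = A
    generalize eval (((k + j + 1 : ℕ) : ℝ) + a + 1 / 2) (ascPochhammer ℝ k) = B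
    generalize ((k + j + 1).choose (k + 1) : ℝ) = c1 at hc ⊢
    generalize ((k + j + 1).choose k : ℝ) = c0 at hc ⊢
    push_cast
    linear_combination (-(1 : ℝ) ^ 1 * (1 / ((k + j + 1).factorial : ℝ)) * B *
      (k + j + 1 + a + 1 / 2 + k) * A * (-1) ^ k * (k + 1 + a)) * hc

/-- The rising factorial in the leading coefficient starts at `m + a + 1 / 2`, which is positive for
`m ≥ 1` but may be zero for `m = 0`; there the product is empty. -/
theorem jacobiCoeff_self_ne_zero (m : ℕ) {a : ℝ} (ha : -1 / 2 ≤ a) : jacobiCoeff m a m ≠ 0 := by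
  unfold jacobiCoeff
  have h : 0 < (ascPochhammer ℝ m).eval ((m : ℝ) + a + 1 / 2) ∨ m = 0 := by
    rcases Nat.eq_zero_or_pos m with h | h
    · exact Or.inr h
    · refine Or.inl (ascPochhammer_pos _ _ ?_)
      have : (1 : ℝ) ≤ m := by exact_mod_cast h
      linarith
  rcases h with h | rfl
  · have hf : (m.factorial : ℝ) ≠ 0 := by exact_mod_cast (Nat.factorial_pos m).ne'
    rw [Nat.choose_self, Nat.sub_self, ascPochhammer_zero, eval_one, mul_one, Nat.cast_one,
      one_mul]
    exact mul_ne_zero (mul_ne_zero (one_div_ne_zero hf) h.ne') (pow_ne_zero _ (by norm_num))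
  · simp

/-- Symmetry of the Jacobi operator on monomials, expressed through the moments. -/
theorem moment_symm {M : ℕ → ℝ} {a : ℝ}
    (hM : ∀ N, M (N + 1) * (a + N + 3 / 2) = (a + N + 1) * M N) (k l : ℕ) :
    k * (k + a) * M (k + l - 1) - k * (k + a + 1 / 2) * M (k + l) =
      l * (l + a) * M (k + l - 1) - l * (l + a + 1 / 2) * M (k + l) := by
  rcases Nat.eq_zero_or_pos (k + l) with h | h
  · have hk : k = 0 := by omega
    have hl : l = 0 := by omega
    simp [hk, hl]
  · obtain ⟨N, hN⟩ := Nat.exists_eq_add_of_le' h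
    have hc : (k : ℝ) + l = N + 1 := by exact_mod_cast hN
    have hl : (l : ℝ) = N + 1 - k := by linarith
    rw [hN, Nat.add_sub_cancel, hl]
    -- With `k + l = N + 1`, the difference of the two sides is `k - l = 2 k - N - 1` times the
    -- moment recursion.
    linear_combination (-(2 * k - N - 1 : ℝ)) * hM N

/-- The Jacobi operator is symmetric for the moment functional, so pairing the polynomial with the
`l`th power gives `(λ_m - λ_l) ⟨J, s^l⟩ = -l (l + a) ⟨J, s^(l-1)⟩`, where here `λ_k = k (k + a + 1 /
2)`. Induction on `l` ends at `l = 0`, where the right side is zero; this also makes the truncated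
index `k + l - 1` harmless. The factor on the left is nonzero for `l < m`. -/
theorem sum_jacobiCoeff_mul_moment {M : ℕ → ℝ} {a : ℝ} (ha : -1 / 2 ≤ a)
    (hM : ∀ N, M (N + 1) * (a + N + 3 / 2) = (a + N + 1) * M N) (m : ℕ) :
    ∀ l, l < m → ∑ k ∈ Finset.range (m + 1), jacobiCoeff m a k * M (k + l) = 0 := by
  have key (l : ℕ) : (m * (m + a + 1 / 2) - l * (l + a + 1 / 2)) *
      ∑ k ∈ Finset.range (m + 1), jacobiCoeff m a k * M (k + l) =
      -(l * (l + a)) * ∑ k ∈ Finset.range (m + 1), jacobiCoeff m a k * M (k + l - 1) := by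
    have h1 : ∑ k ∈ Finset.range (m + 1), jacobiCoeff m a k * (k * (k + a)) * M (k + l - 1) =
        ∑ k ∈ Finset.range (m + 1), jacobiCoeff m a k *
          (k * (k + a + 1 / 2) - m * (m + a + 1 / 2)) * M (k + l) := by
      rw [Finset.sum_range_succ', Finset.sum_range_succ]
      have : (m : ℝ) * (m + a + 1 / 2) - m * (m + a + 1 / 2) = 0 := sub_self _
      simp only [this, Nat.cast_zero, zero_mul, mul_zero, add_zero]
      refine Finset.sum_congr rfl fun k hk => ?_
      rw [show k + 1 + l - 1 = k + l by omega, ← jacobiCoeff_succ m a k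
        (Finset.mem_range.1 hk).le]
      push_cast
      ring
    have h2 : ∑ k ∈ Finset.range (m + 1), jacobiCoeff m a k *
        (k * (k + a) * M (k + l - 1) - k * (k + a + 1 / 2) * M (k + l)) =
        ∑ k ∈ Finset.range (m + 1), jacobiCoeff m a k *
        (l * (l + a) * M (k + l - 1) - l * (l + a + 1 / 2) * M (k + l)) :=
      Finset.sum_congr rfl fun k _ => by rw [moment_symm hM]
    have h3 : ∑ k ∈ Finset.range (m + 1), jacobiCoeff m a k *
        (k * (k + a + 1 / 2) - m * (m + a + 1 / 2)) * M (k + l) =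
        ∑ k ∈ Finset.range (m + 1), jacobiCoeff m a k * (k * (k + a + 1 / 2)) * M (k + l) -
        m * (m + a + 1 / 2) * ∑ k ∈ Finset.range (m + 1), jacobiCoeff m a k * M (k + l) := by
      rw [Finset.mul_sum, ← Finset.sum_sub_distrib]
      exact Finset.sum_congr rfl fun k _ => by ring
    have h4 : ∑ k ∈ Finset.range (m + 1), jacobiCoeff m a k *
        (k * (k + a) * M (k + l - 1) - k * (k + a + 1 / 2) * M (k + l)) =
        ∑ k ∈ Finset.range (m + 1), jacobiCoeff m a k * (k * (k + a)) * M (k + l - 1) -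
        ∑ k ∈ Finset.range (m + 1), jacobiCoeff m a k * (k * (k + a + 1 / 2)) * M (k + l) := by
      rw [← Finset.sum_sub_distrib]
      exact Finset.sum_congr rfl fun k _ => by ring
    have h5 : ∑ k ∈ Finset.range (m + 1), jacobiCoeff m a k *
        (l * (l + a) * M (k + l - 1) - l * (l + a + 1 / 2) * M (k + l)) =
        l * (l + a) * ∑ k ∈ Finset.range (m + 1), jacobiCoeff m a k * M (k + l - 1) -
        l * (l + a + 1 / 2) * ∑ k ∈ Finset.range (m + 1), jacobiCoeff m a k * M (k + l) := by
      rw [Finset.mul_sum, Finset.mul_sum, ← Finset.sum_sub_distrib]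
      exact Finset.sum_congr rfl fun k _ => by ring
    linarith
  intro l
  induction l with
  | zero =>
    intro hm
    have h := key 0
    simp only [Nat.cast_zero, zero_mul, neg_zero, sub_zero] at h
    refine (mul_eq_zero.1 h).resolve_left ?_
    have : (1 : ℝ) ≤ m := by exact_mod_cast hm
    have : (0 : ℝ) < m + a + 1 / 2 := by linarith
    positivity
  | succ l ih =>
    intro hm
    have h := key (l + 1)
    have h0 := ih (by omega)
    simp only [← add_assoc, Nat.add_sub_cancel] at h
    rw [h0, mul_zero] at h
    refine (mul_eq_zero.1 h).resolve_left ?_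
    have h1 : ((l + 1 : ℕ) : ℝ) < m := by exact_mod_cast hm
    have h2 : (1 : ℝ) ≤ ((l + 1 : ℕ) : ℝ) := by exact_mod_cast Nat.succ_pos l
    generalize ((l + 1 : ℕ) : ℝ) = L at h1 h2
    have h3 : (m : ℝ) * (m + a + 1 / 2) - L * (L + a + 1 / 2) = (m - L) * (m + L + a + 1 / 2) := by
      ring
    rw [h3]
    exact mul_ne_zero (sub_pos.2 h1).ne' (by linarith)

/-- The polynomial `J_m^{a,-1/2}(2 t - 1)` in the variable `1 - t`. -/
noncomputable def jacobiShift (m : ℕ) (a : ℝ) : ℝ[X] :=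
  ∑ k ∈ Finset.range (m + 1), C (jacobiCoeff m a k) * X ^ k

theorem jacobiP_eq_eval (m : ℕ) (a t : ℝ) :
    jacobiP m a (-1 / 2) (2 * t - 1) = (jacobiShift m a).eval (1 - t) := by
  unfold jacobiP jacobiShift
  rw [eval_finsetSum, Finset.mul_sum]
  refine Finset.sum_congr rfl fun k _ => ?_
  have h1 : (2 * t - 1 - 1) / 2 = -1 * (1 - t) := by ring
  have h2 : (m : ℝ) + a + -1 / 2 + 1 = m + a + 1 / 2 := by ring
  rw [eval_mul, eval_C, eval_pow, eval_X, jacobiCoeff, h1, h2, mul_pow]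
  ring

theorem degree_jacobiShift_lt (m : ℕ) (a : ℝ) {l : ℕ} (h : m < l) :
    (jacobiShift m a).degree < l := by
  refine (degree_sum_le _ _).trans_lt ?_
  rw [Finset.sup_lt_iff (WithBot.bot_lt_coe _)]
  intro k hk
  refine (degree_C_mul_X_pow_le _ _).trans_lt ?_
  have := Finset.mem_range.1 hk
  exact_mod_cast (by omega : k < l)

theorem integrable_eval_simplexFiber (n : ℕ) (p : ℝ[X]) :
    Integrable (fun t => p.eval (1 - t)) (simplexFiber n) := by
  have hc : Continuous fun t : ℝ => p.eval (1 - t) := p.continuous.comp (by fun_prop)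
  obtain ⟨C, hC⟩ := (isCompact_Icc (a := (0 : ℝ)) (b := 1)).exists_bound_of_continuousOn
    hc.continuousOn
  refine Integrable.of_bound hc.aestronglyMeasurable C ?_
  filter_upwards [ae_simplexFiber n] with t ht
  exact hC t ⟨ht.1.le, ht.2.le⟩

/-- Integration of polynomials in `1 - t` against the fibre measure. -/
noncomputable def fiberIntegral (n : ℕ) : ℝ[X] →ₗ[ℝ] ℝ where
  toFun p := ∫ t, p.eval (1 - t) ∂(simplexFiber n)
  map_add' p q := by
    simp only [eval_add]
    exact integral_add (integrable_eval_simplexFiber n p) (integrable_eval_simplexFiber n q)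
  map_smul' c p := by
    simp only [eval_smul, smul_eq_mul, RingHom.id_apply]
    exact integral_const_mul _ _

theorem fiberIntegral_apply (n : ℕ) (p : ℝ[X]) :
    fiberIntegral n p = ∫ t, p.eval (1 - t) ∂(simplexFiber n) := rfl

/-- The extra weight `(1 - t)^d` raises the Jacobi parameter from `(n - 1) / 2` to `d + (n - 1) /
2`, and the shifted moments satisfy the recursion for that parameter. -/
theorem fiberIntegral_jacobiShift_mul (n d m : ℕ) {p : ℝ[X]} (hp : p.degree < m) :
    fiberIntegral n (X ^ d * jacobiShift m (d + ((n : ℝ) - 1) / 2) * p) = 0 := by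
  have ha : -1 / 2 ≤ (d : ℝ) + ((n : ℝ) - 1) / 2 := by
    have h1 : (0 : ℝ) ≤ d := Nat.cast_nonneg d
    have h2 : (0 : ℝ) ≤ n := Nat.cast_nonneg n
    linarith
  have hmom (N : ℕ) : fiberIntegral n (X ^ N) = fiberMoment n N := by
    simp [fiberIntegral_apply, fiberMoment]
  rcases eq_or_ne p 0 with rfl | h0
  · simp
  rw [p.as_sum_range' m ((natDegree_lt_iff_degree_lt h0).2 hp), Finset.mul_sum, map_sum]
  refine Finset.sum_eq_zero fun l hl => ?_
  have h := sum_jacobiCoeff_mul_moment ha (M := fun N => fiberMoment n (d + N)) (fun N => by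
    have := fiberMoment_succ n (d + N)
    simp only [← add_assoc]
    push_cast at this
    linear_combination this) m l (Finset.mem_range.1 hl)
  have e : X ^ d * jacobiShift m (d + ((n : ℝ) - 1) / 2) * monomial l (p.coeff l) =
      ∑ k ∈ Finset.range (m + 1),
        (p.coeff l * jacobiCoeff m (d + ((n : ℝ) - 1) / 2) k) • (X : ℝ[X]) ^ (d + (k + l)) := by
    unfold jacobiShift
    rw [Finset.mul_sum, Finset.sum_mul]
    refine Finset.sum_congr rfl fun k _ => ?_
    rw [← C_mul_X_pow_eq_monomial, smul_eq_C_mul, C_mul]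
    ring
  rw [e, map_sum]
  simp only [map_smul, hmom, smul_eq_mul, mul_assoc]
  rw [← Finset.mul_sum, h, mul_zero]

end Jacobi

/-! ### Separation of variables for the simplex polynomials. -/

section SimplexPoly

open Polynomial

variable {n : ℕ}

theorem sum_Iio_succ {M : Type*} [AddCommMonoid M] (f : Fin (n + 1) → M) (j : Fin n) :
    ∑ k ∈ Finset.Iio j.succ, f k = f 0 + ∑ k ∈ Finset.Iio j, f k.succ := by
  have h {m : ℕ} (g : Fin m → M) (i : Fin m) :
      ∑ k ∈ Finset.Iio i, g k = ∑ k, if k < i then g k else 0 := by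
    rw [← Finset.sum_filter]
    congr 1
    ext k
    simp
  rw [h, h, Fin.sum_univ_succ]
  simp [Fin.succ_pos]

/-- For `j ≥ 1` the cone coordinates multiply both `xⱼ` and `1 - ∑_{k<j} xₖ` by `1 - t`, so the
Jacobi arguments do not change and the powers of `1 - t` collect. The parameter of the first factor
is exactly the one for the weight `(1 - t)^(2 |tail α|)` that this collection produces. -/
theorem simplexPoly_cons (α : Fin (n + 1) → ℕ) {t : ℝ} (ht : t < 1) (y : Fin n → ℝ) :
    simplexPoly α (Fin.cons t ((1 - t) • y)) =
      (jacobiShift (α 0) (2 * (multiDeg (Fin.tail α) : ℝ) + ((n : ℝ) - 1) / 2)).eval (1 - t) *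
        ((1 - t) ^ multiDeg (Fin.tail α) * simplexPoly (Fin.tail α) y) := by
  have hr : 1 - t ≠ 0 := (sub_pos.2 ht).ne'
  unfold simplexPoly
  rw [Fin.prod_univ_succ]
  congr 1
  · have h0 : Finset.Iio (0 : Fin (n + 1)) = ∅ := by ext; simp
    rw [h0, Fin.sum_Ioi_zero, ← jacobiP_eq_eval]
    simp only [Finset.sum_empty, sub_zero, one_pow, one_mul, Fin.cons_zero, div_one, multiDeg,
      Fin.tail, Nat.cast_sum]
    congr 2
    push_cast
    simp
  · rw [multiDeg, ← Finset.prod_pow_eq_pow_sum, ← Finset.prod_mul_distrib]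
    refine Finset.prod_congr rfl fun j _ => ?_
    rw [sum_Iio_succ, Fin.sum_Ioi_succ]
    simp only [Fin.cons_zero, Fin.cons_succ, Pi.smul_apply, smul_eq_mul, ← Finset.mul_sum]
    have e1 : 1 - (t + (1 - t) * ∑ k ∈ Finset.Iio j, y k) =
        (1 - t) * (1 - ∑ k ∈ Finset.Iio j, y k) := by ring
    rw [e1, mul_pow, mul_assoc, mul_left_comm 2, mul_div_mul_left _ _ hr]
    congr 3
    simp only [Fin.tail, Fin.val_succ]
    push_cast
    ring

theorem measurable_simplexPoly (α : Fin n → ℕ) : Measurable (simplexPoly α) := by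
  unfold simplexPoly jacobiP
  fun_prop

/-- If the tails differ, the integral over `y` vanishes by induction. If they agree, the first
indices differ, and Jacobi orthogonality for the common parameter kills the integral over `t`; by
symmetry the larger first index may be that of `α`. -/
theorem integral_simplexPoly_mul_of_ne : ∀ {n : ℕ} {α β : Fin n → ℕ}, α ≠ β →
    ∫ x, simplexPoly α x * simplexPoly β x ∂(simplexMeasure n) = 0 := by
  intro n
  induction n with
  | zero => intro α β h; exact absurd (Subsingleton.elim α β) h
  | succ n ih =>
    have main : ∀ α β : Fin (n + 1) → ℕ, α ≠ β → β 0 ≤ α 0 →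
        ∫ x, simplexPoly α x * simplexPoly β x ∂(simplexMeasure (n + 1)) = 0 := by
      intro α β hne hle
      rw [integral_simplexMeasure_succ (F := fun x => simplexPoly α x * simplexPoly β x)
        (a := fun t => (X ^ (multiDeg (Fin.tail α) + multiDeg (Fin.tail β)) *
          jacobiShift (α 0) (2 * (multiDeg (Fin.tail α) : ℝ) + ((n : ℝ) - 1) / 2) *
          jacobiShift (β 0) (2 * (multiDeg (Fin.tail β) : ℝ) + ((n : ℝ) - 1) / 2)).eval (1 - t))
        (c := fun y => simplexPoly (Fin.tail α) y * simplexPoly (Fin.tail β) y)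
        ((measurable_simplexPoly α).mul (measurable_simplexPoly β)).aestronglyMeasurable
        (fun t _ ht y => by
          rw [simplexPoly_cons α ht, simplexPoly_cons β ht]
          simp only [eval_mul, eval_pow, eval_X, pow_add]
          ring)]
      by_cases ht : Fin.tail α = Fin.tail β
      · have h0 : β 0 < α 0 := by
          refine lt_of_le_of_ne hle fun h => hne ?_
          rw [← Fin.cons_self_tail α, ← Fin.cons_self_tail β, ht, h]
        rw [← ht]
        have := fiberIntegral_jacobiShift_mul n (multiDeg (Fin.tail α) + multiDeg (Fin.tail α))
          (α 0) (degree_jacobiShift_lt (β 0)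
            (2 * (multiDeg (Fin.tail α) : ℝ) + ((n : ℝ) - 1) / 2) h0)
        rw [fiberIntegral_apply] at this
        push_cast at this
        rw [← two_mul ((multiDeg (Fin.tail α) : ℕ) : ℝ)] at this
        rw [this, zero_mul]
      · rw [ih ht, mul_zero]
    intro α β hne
    rcases le_total (β 0) (α 0) with h | h
    · exact main α β hne h
    · simp_rw [mul_comm (simplexPoly α _)]
      exact main β α hne.symm h

/-- If `|tail γ| < |tail α|`, the integral over `y` vanishes by induction. Otherwise the surplus `(1
- t)^j`, with `j = |tail γ| - |tail α|`, joins `t^(γ 0)` to a polynomial of degree at most `j + γ 0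
< α 0`, to which the Jacobi factor is orthogonal. -/
theorem integral_simplexPoly_mul_monomial : ∀ {n : ℕ} (α γ : Fin n → ℕ),
    multiDeg γ < multiDeg α →
    ∫ x, simplexPoly α x * ∏ i, x i ^ γ i ∂(simplexMeasure n) = 0 := by
  intro n
  induction n with
  | zero => intro α γ h; simp [multiDeg] at h
  | succ n ih =>
    intro α γ hlt
    rw [integral_simplexMeasure_succ (F := fun x => simplexPoly α x * ∏ i, x i ^ γ i)
      (a := fun t => (X ^ (multiDeg (Fin.tail α) + multiDeg (Fin.tail γ)) *
        jacobiShift (α 0) (2 * (multiDeg (Fin.tail α) : ℝ) + ((n : ℝ) - 1) / 2) *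
        (1 - X) ^ γ 0).eval (1 - t))
      (c := fun y => simplexPoly (Fin.tail α) y * ∏ i, y i ^ Fin.tail γ i)
      ((measurable_simplexPoly α).mul (by fun_prop)).aestronglyMeasurable
      (fun t _ ht y => by
        rw [simplexPoly_cons α ht, Fin.prod_univ_succ]
        simp only [eval_mul, eval_pow, eval_X, pow_add, Fin.cons_zero, Fin.cons_succ, eval_sub,
          eval_one, Pi.smul_apply, smul_eq_mul, mul_pow, Finset.prod_mul_distrib,
          Finset.prod_pow_eq_pow_sum, multiDeg, Fin.tail]
        ring)]
    have hα : multiDeg α = α 0 + multiDeg (Fin.tail α) := Fin.sum_univ_succ _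
    have hγ : multiDeg γ = γ 0 + multiDeg (Fin.tail γ) := Fin.sum_univ_succ _
    by_cases h : multiDeg (Fin.tail γ) < multiDeg (Fin.tail α)
    · rw [ih _ _ h, mul_zero]
    · obtain ⟨j, hj⟩ := Nat.exists_eq_add_of_le (not_lt.1 h)
      have hdeg : (X ^ j * (1 - X) ^ γ 0 : ℝ[X]).degree < (α 0 : ℕ) := by
        have h1 : (1 - X : ℝ[X]).degree ≤ 1 := by
          refine (degree_sub_le _ _).trans ?_
          simp
        have h2 : ((1 - X : ℝ[X]) ^ γ 0).degree ≤ (γ 0 : ℕ) := by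
          refine (degree_pow_le_of_le _ h1).trans ?_
          simp
        refine (degree_mul_le _ _).trans_lt ?_
        rw [degree_X_pow]
        refine (add_le_add_right h2 _).trans_lt ?_
        exact_mod_cast (by omega : j + γ 0 < α 0)
      have := fiberIntegral_jacobiShift_mul n (multiDeg (Fin.tail α) + multiDeg (Fin.tail α))
        (α 0) hdeg
      rw [fiberIntegral_apply] at this
      push_cast at this
      rw [← two_mul ((multiDeg (Fin.tail α) : ℕ) : ℝ)] at this
      have he (A : ℝ[X]) : X ^ (multiDeg (Fin.tail α) + multiDeg (Fin.tail γ)) * A *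
          (1 - X) ^ γ 0 = X ^ (multiDeg (Fin.tail α) + multiDeg (Fin.tail α)) * A *
          (X ^ j * (1 - X) ^ γ 0) := by
        rw [hj]; ring
      rw [he, this, zero_mul]

end SimplexPoly

/-! ### Polynomial functions on the simplex -/

section PolyFun

open MvPolynomial

variable {n : ℕ}

/-- The function on `ℝⁿ` defined by a complex polynomial. -/
noncomputable def polyFun (p : MvPolynomial (Fin n) ℂ) (x : Fin n → ℝ) : ℂ :=
  eval (fun i => ((x i : ℝ) : ℂ)) p

theorem polyFun_add (p q : MvPolynomial (Fin n) ℂ) (x : Fin n → ℝ) :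
    polyFun (p + q) x = polyFun p x + polyFun q x := by simp [polyFun]

theorem polyFun_mul (p q : MvPolynomial (Fin n) ℂ) (x : Fin n → ℝ) :
    polyFun (p * q) x = polyFun p x * polyFun q x := by simp [polyFun]

theorem polyFun_smul (c : ℂ) (p : MvPolynomial (Fin n) ℂ) (x : Fin n → ℝ) :
    polyFun (c • p) x = c * polyFun p x := by simp [polyFun]

theorem polyFun_sub (p q : MvPolynomial (Fin n) ℂ) (x : Fin n → ℝ) :
    polyFun (p - q) x = polyFun p x - polyFun q x := by simp [polyFun]

theorem polyFun_sum {ι : Type*} (s : Finset ι) (f : ι → MvPolynomial (Fin n) ℂ)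
    (x : Fin n → ℝ) : polyFun (∑ i ∈ s, f i) x = ∑ i ∈ s, polyFun (f i) x := by simp [polyFun]

theorem polyFun_X (i : Fin n) (x : Fin n → ℝ) : polyFun (X i) x = x i := by simp [polyFun]

theorem polyFun_C (c : ℂ) (x : Fin n → ℝ) : polyFun (C c) x = c := by simp [polyFun]

theorem contDiff_polyFun (p : MvPolynomial (Fin n) ℂ) {m : WithTop ℕ∞} :
    ContDiff ℝ m (polyFun p) := by
  induction p using MvPolynomial.induction_on with
  | C c =>
    have : polyFun (C c : MvPolynomial (Fin n) ℂ) = fun _ => c := funext fun x => polyFun_C c x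
    rw [this]
    exact contDiff_const
  | add p q hp hq =>
    have : polyFun (p + q) = fun x => polyFun p x + polyFun q x :=
      funext fun x => polyFun_add p q x
    rw [this]
    exact hp.add hq
  | mul_X p i hp =>
    have : polyFun (p * X i) = fun x => polyFun p x * ((x i : ℝ) : ℂ) :=
      funext fun x => by rw [polyFun_mul, polyFun_X]
    rw [this]
    exact hp.mul (Complex.ofRealCLM.contDiff.comp (contDiff_apply ℝ ℝ i))

theorem differentiableAt_polyFun (p : MvPolynomial (Fin n) ℂ) (x : Fin n → ℝ) :
    DifferentiableAt ℝ (polyFun p) x := (contDiff_polyFun p (m := 1)).differentiable (by simp) x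

theorem partialDeriv_polyFun (i : Fin n) (p : MvPolynomial (Fin n) ℂ) :
    partialDeriv i (polyFun p) = polyFun (pderiv i p) := by
  funext x
  induction p using MvPolynomial.induction_on with
  | C c =>
    have : polyFun (C c : MvPolynomial (Fin n) ℂ) = fun _ => c := funext fun x => polyFun_C c x
    rw [this, partialDeriv_const, pderiv_C]
    simp [polyFun]
  | add p q hp hq =>
    have : polyFun (p + q) = fun x => polyFun p x + polyFun q x :=
      funext fun x => polyFun_add p q x
    rw [this, partialDeriv_add i (differentiableAt_polyFun p x) (differentiableAt_polyFun q x),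
      map_add, polyFun_add, hp, hq]
  | mul_X p j hp =>
    have : polyFun (p * X j) = fun x => polyFun p x * ((x j : ℝ) : ℂ) :=
      funext fun x => by rw [polyFun_mul, polyFun_X]
    rw [this, partialDeriv_mul i (differentiableAt_polyFun p x) (differentiableAt_ofReal_coord j),
      partialDeriv_coord, hp, pderiv_mul, pderiv_X, polyFun_add, polyFun_mul, polyFun_mul,
      polyFun_X, Pi.single_apply]
    by_cases h : i = j
    · subst h
      simp [polyFun]
      ring
    · rw [if_neg (Ne.symm h), if_neg (Ne.symm h)]
      simp [polyFun]

theorem isCompact_closure_openSimplex (n : ℕ) : IsCompact (closure (openSimplex n)) := by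
  refine (isCompact_Icc (a := (0 : Fin n → ℝ)) (b := 1)).of_isClosed_subset isClosed_closure ?_
  exact closure_minimal (fun x hx => ⟨fun i => (hx.1 i).le,
    fun i => (lt_one_of_mem_openSimplex hx i).le⟩) isClosed_Icc

theorem exists_norm_polyFun_le (p : MvPolynomial (Fin n) ℂ) :
    ∃ C, ∀ x ∈ openSimplex n, ‖polyFun p x‖ ≤ C := by
  obtain ⟨C, hC⟩ := (isCompact_closure_openSimplex n).exists_bound_of_continuousOn
    (contDiff_polyFun p (m := 0)).continuous.continuousOn
  exact ⟨C, fun x hx => hC x (subset_closure hx)⟩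

theorem polyFun_mem_C2b (p : MvPolynomial (Fin n) ℂ) : polyFun p ∈ C2b n := by
  refine ⟨(contDiff_polyFun p).contDiffOn, ?_⟩
  obtain ⟨C0, h0⟩ := exists_norm_polyFun_le p
  choose C1 h1 using fun i => exists_norm_polyFun_le (pderiv i p)
  choose C2 h2 using fun i j => exists_norm_polyFun_le (pderiv i (pderiv j p))
  refine ⟨|C0| + ∑ i, |C1 i| + ∑ i, ∑ j, |C2 i j|, fun x hx => ⟨?_, fun i => ?_, fun i j => ?_⟩⟩
  · have a1 : 0 ≤ ∑ i, |C1 i| := by positivity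
    have a2 : 0 ≤ ∑ i, ∑ j, |C2 i j| := by positivity
    linarith [h0 x hx, le_abs_self C0]
  · have a1 : |C1 i| ≤ ∑ i, |C1 i| :=
      Finset.single_le_sum (f := fun i => |C1 i|) (fun _ _ => abs_nonneg _) (Finset.mem_univ i)
    have a2 : 0 ≤ ∑ i, ∑ j, |C2 i j| := by positivity
    rw [partialDeriv_polyFun]
    linarith [h1 i x hx, le_abs_self (C1 i), abs_nonneg C0]
  · have a1 : 0 ≤ ∑ i, |C1 i| := by positivity
    have a2 : |C2 i j| ≤ ∑ j, |C2 i j| :=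
      Finset.single_le_sum (f := fun j => |C2 i j|) (fun _ _ => abs_nonneg _) (Finset.mem_univ j)
    have a3 : ∑ j, |C2 i j| ≤ ∑ i, ∑ j, |C2 i j| :=
      Finset.single_le_sum (f := fun i => ∑ j, |C2 i j|)
        (fun _ _ => by positivity) (Finset.mem_univ i)
    rw [partialDeriv_polyFun, partialDeriv_polyFun]
    linarith [h2 i j x hx, le_abs_self (C2 i j), abs_nonneg C0]

theorem eq_of_polyFun_eqOn {p q : MvPolynomial (Fin n) ℂ}
    (h : Set.EqOn (polyFun p) (polyFun q) (openSimplex n)) : p = q := by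
  -- The simplex contains the box `(0, 1 / (n + 1))ⁿ`, a product of infinite sets, and these
  -- determine a polynomial.
  refine MvPolynomial.funext_set (fun _ => Complex.ofReal '' Set.Ioo 0 (1 / ((n : ℝ) + 1)))
    (fun _ => ?_) fun x hx => ?_
  · exact (Set.Ioo_infinite (by positivity)).image Complex.ofReal_injective.injOn
  · choose y hy hyx using fun i => hx i (Set.mem_univ i)
    have hx' : x = fun i => ((y i : ℝ) : ℂ) := funext fun i => (hyx i).symm
    rw [hx']
    refine h ⟨fun i => (hy i).1, ?_⟩
    calc ∑ i, y i ≤ ∑ _i : Fin n, 1 / ((n : ℝ) + 1) := Finset.sum_le_sum fun i _ => (hy i).2.le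
      _ < 1 := by
        rw [Finset.sum_const, Finset.card_univ, Fintype.card_fin, nsmul_eq_mul, mul_one_div,
          div_lt_one (by positivity)]
        linarith

/-! ### The Dunkl–Xu operator on polynomials -/

/-- The Euler operator `∑ Xᵢ ∂ᵢ`. -/
noncomputable def eulerPoly (n : ℕ) : MvPolynomial (Fin n) ℂ →ₗ[ℂ] MvPolynomial (Fin n) ℂ :=
  ∑ i, LinearMap.mulLeft ℂ (X i) ∘ₗ (pderiv i).toLinearMap

/-- The degree-lowering part `∑ (Xᵢ ∂ᵢ² + (1/2) ∂ᵢ)` of the Dunkl–Xu operator. -/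
noncomputable def lowerPoly (n : ℕ) : MvPolynomial (Fin n) ℂ →ₗ[ℂ] MvPolynomial (Fin n) ℂ :=
  ∑ i, (LinearMap.mulLeft ℂ (X i) ∘ₗ (pderiv i).toLinearMap ∘ₗ (pderiv i).toLinearMap +
    (1 / 2 : ℂ) • (pderiv i).toLinearMap)

/-- The Dunkl–Xu operator on polynomials. -/
noncomputable def dunklPoly (n : ℕ) : MvPolynomial (Fin n) ℂ →ₗ[ℂ] MvPolynomial (Fin n) ℂ :=
  lowerPoly n - (eulerPoly n ∘ₗ eulerPoly n + (((n : ℂ) - 1) / 2) • eulerPoly n)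

theorem eulerPoly_apply (p : MvPolynomial (Fin n) ℂ) :
    eulerPoly n p = ∑ i, X i * pderiv i p := by simp [eulerPoly]

theorem lowerPoly_apply (p : MvPolynomial (Fin n) ℂ) :
    lowerPoly n p = ∑ i, (X i * pderiv i (pderiv i p) + (1 / 2 : ℂ) • pderiv i p) := by
  simp [lowerPoly]

theorem eulerDeriv_polyFun (p : MvPolynomial (Fin n) ℂ) :
    eulerDeriv (polyFun p) = polyFun (eulerPoly n p) := by
  funext x
  simp only [eulerDeriv, eulerPoly_apply, polyFun_sum, polyFun_mul, polyFun_X,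
    partialDeriv_polyFun]

/-- The identity `E² = E + ∑ᵢⱼ xᵢ xⱼ ∂ᵢ ∂ⱼ` absorbs all quadratic second-order terms, and the
first-order coefficient `(n + 1) / 2` becomes `(n - 1) / 2`. -/
theorem dunklXu_eq_euler {u : (Fin n → ℝ) → ℂ} {x : Fin n → ℝ} (hu : ContDiffAt ℝ 2 u x) :
    dunklXu n u x = ∑ i, ((x i : ℂ) * partialDeriv i (partialDeriv i u) x +
        1 / 2 * partialDeriv i u x) -
      (eulerDeriv (eulerDeriv u) x + ((n : ℂ) - 1) / 2 * eulerDeriv u x) := by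
  have hs : ∑ i, ∑ j, ((x i * x j : ℝ) : ℂ) * partialDeriv i (partialDeriv j u) x =
      ∑ i, ((x i * x i : ℝ) : ℂ) * partialDeriv i (partialDeriv i u) x +
      2 * ∑ i, ∑ j ∈ Finset.Ioi i, ((x i * x j : ℝ) : ℂ) * partialDeriv i (partialDeriv j u) x :=
    sum_sum_eq_diag_add_two_mul_Ioi fun i j => by
      rw [partialDeriv_comm i hu j, mul_comm (x i)]
  have hE : eulerDeriv (eulerDeriv u) x = eulerDeriv u x +
      ∑ i, ∑ j, ((x i * x j : ℝ) : ℂ) * partialDeriv i (partialDeriv j u) x := by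
    change ∑ i, ((x i : ℝ) : ℂ) * partialDeriv i (eulerDeriv u) x = _
    simp only [partialDeriv_eulerDeriv hu, mul_add, Finset.sum_add_distrib, Finset.mul_sum]
    congr 1
    refine Finset.sum_congr rfl fun i _ => Finset.sum_congr rfl fun j _ => ?_
    push_cast
    ring
  have h3 : ∑ i, ((x i * (1 - x i) : ℝ) : ℂ) * partialDeriv i (partialDeriv i u) x =
      ∑ i, (x i : ℂ) * partialDeriv i (partialDeriv i u) x -
      ∑ i, ((x i * x i : ℝ) : ℂ) * partialDeriv i (partialDeriv i u) x := by
    rw [← Finset.sum_sub_distrib]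
    refine Finset.sum_congr rfl fun i _ => ?_
    push_cast
    ring
  have h4 : ∑ i, ((1 - (n + 1) * x i : ℝ) : ℂ) * partialDeriv i u x =
      ∑ i, partialDeriv i u x - (n + 1) * eulerDeriv u x := by
    rw [eulerDeriv, Finset.mul_sum, ← Finset.sum_sub_distrib]
    refine Finset.sum_congr rfl fun i _ => ?_
    push_cast
    ring
  rw [hE, hs, dunklXu, h3, h4, Finset.sum_add_distrib, ← Finset.mul_sum]
  ring

theorem dunklXu_polyFun (p : MvPolynomial (Fin n) ℂ) (x : Fin n → ℝ) :
    dunklXu n (polyFun p) x = polyFun (dunklPoly n p) x := by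
  rw [dunklXu_eq_euler (contDiff_polyFun p).contDiffAt]
  simp only [partialDeriv_polyFun, eulerDeriv_polyFun, dunklPoly, LinearMap.sub_apply,
    LinearMap.add_apply, LinearMap.smul_apply, LinearMap.comp_apply, polyFun_sub, polyFun_add,
    polyFun_smul, lowerPoly_apply, polyFun_sum, polyFun_mul, polyFun_X]

/-- The polynomials of degree less than `s`. -/
noncomputable def polyLT (n s : ℕ) : Submodule ℂ (MvPolynomial (Fin n) ℂ) :=
  restrictSupport ℂ {γ | γ.degree < s}

theorem polyLT_mono {s t : ℕ} (h : s ≤ t) : polyLT n s ≤ polyLT n t :=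
  restrictSupport_mono ℂ fun _ hγ => lt_of_lt_of_le hγ h

theorem monomial_mem_polyLT {γ : Fin n →₀ ℕ} {s : ℕ} (h : γ.degree < s) (c : ℂ) :
    monomial γ c ∈ polyLT n s := (monomial_mem_restrictSupport ℂ).2 (Or.inl h)

theorem polyLT_le_of_monomial {s : ℕ} {V : Submodule ℂ (MvPolynomial (Fin n) ℂ)}
    (h : ∀ γ : Fin n →₀ ℕ, γ.degree < s → monomial γ (1 : ℂ) ∈ V) : polyLT n s ≤ V := by
  unfold polyLT
  rw [restrictSupport_eq_span, Submodule.span_le]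
  rintro _ ⟨γ, hγ, rfl⟩
  exact h γ hγ

theorem eulerPoly_monomial (γ : Fin n →₀ ℕ) (c : ℂ) :
    eulerPoly n (monomial γ c) = (γ.degree : ℂ) • monomial γ c := by
  rw [eulerPoly_apply]
  simp only [X_mul_pderiv_monomial]
  rw [← Finset.sum_smul, Finsupp.degree_eq_sum, Nat.cast_smul_eq_nsmul]

theorem pderiv_monomial_mem_polyLT (i : Fin n) (γ : Fin n →₀ ℕ) (c : ℂ) :
    pderiv i (monomial γ c) ∈ polyLT n γ.degree := by
  rw [pderiv_monomial]
  by_cases h : γ i = 0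
  · simp [h]
  · refine monomial_mem_polyLT ?_ _
    have h1 : (γ - Finsupp.single i 1) + Finsupp.single i 1 = γ :=
      tsub_add_cancel_of_le (by
        rw [Finsupp.single_le_iff]; omega)
    have h2 := congrArg Finsupp.degree h1
    rw [map_add, Finsupp.degree_single] at h2
    omega

theorem lowerPoly_monomial_mem (γ : Fin n →₀ ℕ) (c : ℂ) :
    lowerPoly n (monomial γ c) ∈ polyLT n γ.degree := by
  rw [lowerPoly_apply]
  refine Submodule.sum_mem _ fun i _ => Submodule.add_mem _ ?_
    (Submodule.smul_mem _ _ (pderiv_monomial_mem_polyLT i γ c))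
  have h := pderiv_monomial_mem_polyLT i γ c
  -- Since `∂ᵢ` of a monomial is again a monomial, `Xᵢ ∂ᵢ` only rescales it, so `Xᵢ ∂ᵢ²` lowers the
  -- degree as `∂ᵢ` does.
  rw [pderiv_monomial] at h ⊢
  rw [X_mul_pderiv_monomial]
  exact Submodule.smul_of_tower_mem _ _ h

/-- Monomials are eigenvectors of the Euler operator, so the Dunkl–Xu operator is triangular for the
degree, with diagonal entries `-λ_s`. -/
theorem dunklPoly_monomial (γ : Fin n →₀ ℕ) (c : ℂ) :
    dunklPoly n (monomial γ c) =
      lowerPoly n (monomial γ c) - (simplexEigenvalue n γ.degree : ℂ) • monomial γ c := by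
  simp only [dunklPoly, LinearMap.sub_apply, LinearMap.add_apply, LinearMap.smul_apply,
    LinearMap.comp_apply, eulerPoly_monomial, map_smul, smul_smul, ← add_smul]
  congr 2
  simp only [simplexEigenvalue]
  push_cast
  ring

theorem dunklPoly_mem_polyLT {s : ℕ} {p : MvPolynomial (Fin n) ℂ} (hp : p ∈ polyLT n s) :
    dunklPoly n p ∈ polyLT n s := by
  refine (polyLT_le_of_monomial (V := (polyLT n s).comap (dunklPoly n)) fun γ hγ => ?_) hp
  rw [Submodule.mem_comap, dunklPoly_monomial]
  exact Submodule.sub_mem _ (polyLT_mono hγ.le (lowerPoly_monomial_mem γ 1))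
    (Submodule.smul_mem _ _ (monomial_mem_polyLT hγ 1))

/-- Adding `λ_s` cancels the diagonal entry in the top degree `s`; everything else already has lower
degree. -/
theorem dunklPoly_add_smul_mem_polyLT {s : ℕ} {p : MvPolynomial (Fin n) ℂ}
    (hp : p ∈ polyLT n (s + 1)) :
    dunklPoly n p + (simplexEigenvalue n s : ℂ) • p ∈ polyLT n s := by
  suffices h : polyLT n (s + 1) ≤ (polyLT n s).comap
      (dunklPoly n + (simplexEigenvalue n s : ℂ) • LinearMap.id) by
    have := h hp
    rwa [Submodule.mem_comap, LinearMap.add_apply, LinearMap.smul_apply,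
      LinearMap.id_apply] at this
  refine polyLT_le_of_monomial fun γ hγ => ?_
  rw [Submodule.mem_comap, LinearMap.add_apply, LinearMap.smul_apply, LinearMap.id_apply,
    dunklPoly_monomial]
  have hle : γ.degree ≤ s := Nat.lt_succ_iff.1 hγ
  have h1 := polyLT_mono hle (lowerPoly_monomial_mem γ 1)
  rcases hle.eq_or_lt with h | h
  · rw [h, sub_add_cancel]
    exact h1
  · exact Submodule.add_mem _ (Submodule.sub_mem _ h1
      (Submodule.smul_mem _ _ (monomial_mem_polyLT h 1)))
      (Submodule.smul_mem _ _ (monomial_mem_polyLT h 1))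

end PolyFun

/-! ### The simplex polynomials as multivariate polynomials, and their degree. -/

section SimplexMvPoly

open MvPolynomial

variable {n : ℕ}

/-- The factor `r^m J_m^{a,-1/2}(2 xⱼ / r - 1)`, with `r = 1 - ∑_{k<j} xₖ`, as a polynomial. -/
noncomputable def jacobiFactor (j : Fin n) (m : ℕ) (a : ℝ) : MvPolynomial (Fin n) ℝ :=
  ∑ k ∈ Finset.range (m + 1), C (jacobiCoeff m a k) *
    ((1 - ∑ i ∈ Finset.Iio j, X i - X j) ^ k * (1 - ∑ i ∈ Finset.Iio j, X i) ^ (m - k))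

theorem eval_jacobiFactor (j : Fin n) (m : ℕ) (a : ℝ) {x : Fin n → ℝ}
    (hx : 1 - ∑ k ∈ Finset.Iio j, x k ≠ 0) :
    eval x (jacobiFactor j m a) = (1 - ∑ k ∈ Finset.Iio j, x k) ^ m *
      jacobiP m a (-1 / 2) (2 * x j / (1 - ∑ k ∈ Finset.Iio j, x k) - 1) := by
  rw [mul_div_assoc, jacobiP_eq_eval, jacobiFactor, jacobiShift, Polynomial.eval_finsetSum,
    map_sum, Finset.mul_sum]
  refine Finset.sum_congr rfl fun k hk => ?_
  have hk : k ≤ m := Nat.lt_succ_iff.1 (Finset.mem_range.1 hk)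
  simp only [map_mul, map_pow, map_sub, map_one, map_sum, eval_X, eval_C, Polynomial.eval_mul,
    Polynomial.eval_C, Polynomial.eval_pow, Polynomial.eval_X]
  generalize 1 - ∑ k ∈ Finset.Iio j, x k = r at hx
  have h1 : r ^ m = r ^ k * r ^ (m - k) := by rw [← pow_add, Nat.add_sub_cancel' hk]
  have h2 : r - x j = r * (1 - x j / r) := by field_simp
  rw [h1, h2, mul_pow]
  ring

theorem totalDegree_one_sub_sum_le (s : Finset (Fin n)) :
    (1 - ∑ i ∈ s, X i : MvPolynomial (Fin n) ℝ).totalDegree ≤ 1 := by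
  refine (totalDegree_sub _ _).trans (max_le (by simp) ?_)
  refine totalDegree_finsetSum_le fun i _ => ?_
  rw [totalDegree_X]

/-- The upper bound holds term by term. For the lower bound, substituting `1 - X` for `X j` and zero
for the other variables gives the one-variable polynomial `jacobiShift m a`, with nonzero
coefficient in degree `m`; a substitution of degree one cannot raise the degree. -/
theorem totalDegree_jacobiFactor (j : Fin n) (m : ℕ) {a : ℝ} (ha : -1 / 2 ≤ a) :
    (jacobiFactor j m a).totalDegree = m := by
  have hle : (jacobiFactor j m a).totalDegree ≤ m := by
    refine totalDegree_finsetSum_le fun k hk => ?_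
    have hk : k ≤ m := Nat.lt_succ_iff.1 (Finset.mem_range.1 hk)
    refine (totalDegree_mul _ _).trans ?_
    rw [totalDegree_C, zero_add]
    refine (totalDegree_mul _ _).trans ?_
    have h1 : (1 - ∑ i ∈ Finset.Iio j, X i - X j : MvPolynomial (Fin n) ℝ).totalDegree ≤ 1 :=
      (totalDegree_sub _ _).trans (max_le (totalDegree_one_sub_sum_le _) (by rw [totalDegree_X]))
    have h2 := totalDegree_one_sub_sum_le (Finset.Iio j)
    have h3 := (totalDegree_pow (1 - ∑ i ∈ Finset.Iio j, X i - X j : MvPolynomial (Fin n) ℝ) k)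
    have h4 := (totalDegree_pow (1 - ∑ i ∈ Finset.Iio j, X i : MvPolynomial (Fin n) ℝ) (m - k))
    nlinarith [Nat.sub_add_cancel hk]
  refine le_antisymm hle ?_
  set f : Fin n → Polynomial ℝ := fun i => if i = j then 1 - Polynomial.X else 0 with hf
  have hfd (i : Fin n) : (f i).natDegree ≤ 1 := by
    simp only [hf]
    split_ifs
    · exact (Polynomial.natDegree_sub_le _ _).trans (by simp)
    · simp
  have haev : aeval f (jacobiFactor j m a) = jacobiShift m a := by
    unfold jacobiFactor jacobiShift
    rw [map_sum]
    refine Finset.sum_congr rfl fun k _ => ?_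
    have h0 : ∑ i ∈ Finset.Iio j, f i = 0 := Finset.sum_eq_zero fun i hi => by
      simp [hf, (Finset.mem_Iio.1 hi).ne]
    have hj : f j = 1 - Polynomial.X := by simp [hf]
    simp only [map_mul, map_pow, map_sub, map_one, map_sum, aeval_X, aeval_C, h0, hj,
      Polynomial.algebraMap_eq]
    simp
  have hdeg := aeval_natDegree_le (m := (jacobiFactor j m a).totalDegree) (n := 1) _ le_rfl f hfd
  rw [haev, mul_one] at hdeg
  refine le_trans (Polynomial.le_natDegree_of_ne_zero ?_) hdeg
  have : (jacobiShift m a).coeff m = jacobiCoeff m a m := by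
    simp [jacobiShift, Polynomial.finsetSum_coeff, Polynomial.coeff_X_pow]
  rw [this]
  exact jacobiCoeff_self_ne_zero m ha

theorem jacobiFactor_ne_zero (j : Fin n) (m : ℕ) {a : ℝ} (ha : -1 / 2 ≤ a) :
    jacobiFactor j m a ≠ 0 := by
  intro h
  -- The zero polynomial has total degree `0`, so the degree says nothing when `m = 0`.
  rcases Nat.eq_zero_or_pos m with rfl | hm
  · have : jacobiFactor j 0 a = 1 := by simp [jacobiFactor, jacobiCoeff]
    rw [h] at this
    exact zero_ne_one this
  · have := totalDegree_jacobiFactor j m ha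
    rw [h, totalDegree_zero] at this
    omega

/-- The parameter `aⱼ` of the Jacobi factors of `simplexPoly α`. -/
noncomputable def jacobiParam (α : Fin n → ℕ) (j : Fin n) : ℝ :=
  2 * (∑ k ∈ Finset.Ioi j, (α k : ℝ)) + ((n : ℝ) - ((j : ℕ) + 1) - 1) / 2

theorem jacobiParam_ge (α : Fin n → ℕ) (j : Fin n) : -1 / 2 ≤ jacobiParam α j := by
  unfold jacobiParam
  have h1 : (0 : ℝ) ≤ ∑ k ∈ Finset.Ioi j, (α k : ℝ) := by positivity
  have h2 : ((j : ℕ) : ℝ) + 1 ≤ n := by exact_mod_cast j.2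
  linarith

/-- The polynomial which agrees with `simplexPoly α` on the simplex. -/
noncomputable def simplexMvPoly (α : Fin n → ℕ) : MvPolynomial (Fin n) ℝ :=
  ∏ j, jacobiFactor j (α j) (jacobiParam α j)

theorem simplexMvPoly_ne_zero (α : Fin n → ℕ) : simplexMvPoly α ≠ 0 :=
  Finset.prod_ne_zero_iff.2 fun j _ => jacobiFactor_ne_zero j _ (jacobiParam_ge α j)

theorem totalDegree_simplexMvPoly (α : Fin n → ℕ) :
    (simplexMvPoly α).totalDegree = multiDeg α := by
  unfold simplexMvPoly multiDeg
  have h : ∀ s : Finset (Fin n), (∏ j ∈ s, jacobiFactor j (α j) (jacobiParam α j)).totalDegree =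
      ∑ j ∈ s, α j := by
    intro s
    induction s using Finset.induction_on with
    | empty => simp
    | insert j s hj ih =>
      rw [Finset.prod_insert hj, Finset.sum_insert hj, totalDegree_mul_of_isDomain
        (jacobiFactor_ne_zero j _ (jacobiParam_ge α j))
        (Finset.prod_ne_zero_iff.2 fun k _ => jacobiFactor_ne_zero k _ (jacobiParam_ge α k)), ih,
        totalDegree_jacobiFactor j _ (jacobiParam_ge α j)]
  exact h _

theorem eval_simplexMvPoly (α : Fin n → ℕ) {x : Fin n → ℝ} (hx : x ∈ openSimplex n) :
    eval x (simplexMvPoly α) = simplexPoly α x := by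
  unfold simplexMvPoly simplexPoly
  rw [map_prod]
  refine Finset.prod_congr rfl fun j _ => ?_
  rw [eval_jacobiFactor]
  · rfl
  · refine (sub_pos.2 (lt_of_le_of_lt ?_ hx.2)).ne'
    exact Finset.sum_le_univ_sum_of_nonneg fun i => (hx.1 i).le

end SimplexMvPoly

/-! ### The Laplacian on `C²_b` -/

section Laplacian

variable {n : ℕ}

/-- The Riemannian volume of the Baran metric of the simplex. -/
noncomputable abbrev baranVolume (n : ℕ) : Measure (Fin n → ℝ) :=
  riemVolume (openSimplex n) (baranSimplex n)

instance (n : ℕ) : IsFiniteMeasure (baranVolume n) := by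
  rw [baranVolume, ← simplexMeasure_eq_riemVolume]
  infer_instance

theorem ae_baranVolume_mem (n : ℕ) : ∀ᵐ x ∂(baranVolume n), x ∈ openSimplex n := by
  rw [baranVolume, ← simplexMeasure_eq_riemVolume]
  exact ae_mem_openSimplex n

theorem aesm_baranVolume {E : Type*} [NormedAddCommGroup E]
    {f : (Fin n → ℝ) → E} (hf : ContinuousOn f (openSimplex n)) :
    AEStronglyMeasurable f (baranVolume n) := by
  rw [baranVolume, ← simplexMeasure_eq_riemVolume]
  exact aestronglyMeasurable_of_continuousOn_openSimplex hf

theorem ae_baranVolume_of_eqOn {E : Type*} {f g : (Fin n → ℝ) → E}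
    (h : Set.EqOn f g (openSimplex n)) : f =ᵐ[baranVolume n] g := by
  filter_upwards [ae_baranVolume_mem n] with x hx using h hx

/-- The density is positive on the simplex, so the equality holds Lebesgue-almost everywhere there,
and continuity on an open set removes the exception. Hence an `L²` class has at most one continuous
representative on the simplex. -/
theorem eqOn_of_ae_baranVolume {f g : (Fin n → ℝ) → ℂ} (h : f =ᵐ[baranVolume n] g)
    (hf : ContinuousOn f (openSimplex n)) (hg : ContinuousOn g (openSimplex n)) :
    Set.EqOn f g (openSimplex n) := by
  refine Measure.eqOn_open_of_ae_eq (μ := volume) ?_ (isOpen_openSimplex n) hf hg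
  rw [baranVolume, ← simplexMeasure_eq_riemVolume] at h
  have h' := (ae_withDensity_iff (measurable_simplexDensity n)).1 h
  filter_upwards [h', ae_restrict_mem (measurableSet_openSimplex n)] with x hx hxS
  refine hx (ne_of_gt (ENNReal.ofReal_pos.2 ?_))
  exact one_div_pos.2 (Real.sqrt_pos.2 (barycentricProd_pos hxS))

theorem memLp_of_continuousOn_of_bound {f : (Fin n → ℝ) → ℂ} {p : ENNReal}
    (hf : ContinuousOn f (openSimplex n)) {C : ℝ} (hC : ∀ x ∈ openSimplex n, ‖f x‖ ≤ C) :
    MemLp f p (baranVolume n) :=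
  MemLp.of_bound (aesm_baranVolume hf) C (by
    filter_upwards [ae_baranVolume_mem n] with x hx using hC x hx)

theorem contDiffAt_of_contDiffOn {u : (Fin n → ℝ) → ℂ} {m : WithTop ℕ∞}
    (hu : ContDiffOn ℝ m u (openSimplex n)) {x : Fin n → ℝ} (hx : x ∈ openSimplex n) :
    ContDiffAt ℝ m u x := hu.contDiffAt (openSimplex_mem_nhds hx)

theorem contDiffOn_partialDeriv {u : (Fin n → ℝ) → ℂ} {m k : WithTop ℕ∞}
    (hu : ContDiffOn ℝ k u (openSimplex n)) (hm : m + 1 ≤ k) (i : Fin n) :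
    ContDiffOn ℝ m (partialDeriv i u) (openSimplex n) := fun _ hx =>
  ((contDiffAt_of_contDiffOn hu hx).partialDeriv i hm).contDiffWithinAt

theorem continuousOn_ofReal {f : (Fin n → ℝ) → ℝ} (hf : Continuous f) {s : Set (Fin n → ℝ)} :
    ContinuousOn (fun x => ((f x : ℝ) : ℂ)) s := (Complex.continuous_ofReal.comp hf).continuousOn

theorem continuousOn_dunklXu {u : (Fin n → ℝ) → ℂ} (hu : ContDiffOn ℝ 2 u (openSimplex n)) :
    ContinuousOn (dunklXu n u) (openSimplex n) := by
  have h1 (i : Fin n) : ContDiffOn ℝ 1 (partialDeriv i u) (openSimplex n) :=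
    contDiffOn_partialDeriv hu (by norm_num) i
  have h2 (i j : Fin n) : ContinuousOn (partialDeriv i (partialDeriv j u)) (openSimplex n) :=
    (contDiffOn_partialDeriv (m := 0) (h1 j) (by norm_num) i).continuousOn
  unfold dunklXu
  refine ContinuousOn.add (ContinuousOn.sub ?_ (continuousOn_const.mul ?_))
    (continuousOn_const.mul ?_)
  · exact continuousOn_finsetSum _ fun i _ => (continuousOn_ofReal (by fun_prop)).mul (h2 i i)
  · exact continuousOn_finsetSum _ fun i _ => continuousOn_finsetSum _ fun j _ =>
      (continuousOn_ofReal (by fun_prop)).mul (h2 i j)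
  · exact continuousOn_finsetSum _ fun i _ =>
      (continuousOn_ofReal (by fun_prop)).mul (h1 i).continuousOn

theorem continuousOn_laplaceBeltrami {u : (Fin n → ℝ) → ℂ}
    (hu : ContDiffOn ℝ 2 u (openSimplex n)) :
    ContinuousOn (laplaceBeltrami (baranSimplex n) u) (openSimplex n) :=
  (continuousOn_dunklXu hu).congr fun _ hx => laplaceBeltrami_eq_dunklXu hu hx

theorem exists_norm_dunklXu_le {u : (Fin n → ℝ) → ℂ} (hu : u ∈ C2b n) :
    ∃ C, ∀ x ∈ openSimplex n, ‖dunklXu n u x‖ ≤ C := by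
  obtain ⟨-, C, hC⟩ := hu
  refine ⟨∑ _i : Fin n, C + 2 * ∑ i : Fin n, ∑ _j ∈ Finset.Ioi i, C +
    1 / 2 * ∑ _i : Fin n, ((n : ℝ) + 1) * C, fun x hx => ?_⟩
  obtain ⟨h0, h1, h2⟩ := hC x hx
  have hx0 (i : Fin n) : 0 < x i := hx.1 i
  have hx1 (i : Fin n) : x i < 1 := lt_one_of_mem_openSimplex hx i
  have hb {a b c : ℝ} {z : ℂ} (ha : |a| ≤ b) (hz : ‖z‖ ≤ c) : ‖(a : ℂ) * z‖ ≤ b * c := by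
    rw [norm_mul, Complex.norm_real, Real.norm_eq_abs]
    exact mul_le_mul ha hz (norm_nonneg _) ((abs_nonneg _).trans ha)
  unfold dunklXu
  refine (norm_add_le _ _).trans (add_le_add ((norm_sub_le _ _).trans (add_le_add ?_ ?_)) ?_)
  · refine norm_sum_le_of_le _ fun i _ => ?_
    rw [← one_mul C]
    refine hb ?_ (h2 i i)
    rw [abs_le]
    constructor <;> nlinarith [hx0 i, hx1 i]
  · rw [norm_mul]
    simp only [RCLike.norm_ofNat]
    refine mul_le_mul_of_nonneg_left (norm_sum_le_of_le _ fun i _ =>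
      norm_sum_le_of_le _ fun j _ => ?_) (by norm_num)
    rw [← one_mul C]
    refine hb ?_ (h2 i j)
    rw [abs_le]
    constructor <;> nlinarith [hx0 i, hx1 i, hx0 j, hx1 j, mul_pos (hx0 i) (hx0 j)]
  · rw [norm_mul]
    have : ‖(1 / 2 : ℂ)‖ = 1 / 2 := by simp
    rw [this]
    refine mul_le_mul_of_nonneg_left (norm_sum_le_of_le _ fun i _ => ?_) (by norm_num)
    refine hb ?_ (h1 i)
    have hn : (0 : ℝ) ≤ n := Nat.cast_nonneg n
    rw [abs_le]
    constructor <;> nlinarith [hx0 i, hx1 i]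

theorem memLp_of_mem_C2b {u : (Fin n → ℝ) → ℂ} (hu : u ∈ C2b n) {p : ENNReal} :
    MemLp u p (baranVolume n) := by
  obtain ⟨hd, C, hC⟩ := hu
  exact memLp_of_continuousOn_of_bound hd.continuousOn fun x hx => (hC x hx).1

/-- The Dunkl–Xu form has bounded coefficients, although the divergence form does not, so the image
is bounded on a space of finite measure. -/
theorem memLp_laplaceBeltrami {u : (Fin n → ℝ) → ℂ} (hu : u ∈ C2b n) {p : ENNReal} :
    MemLp (laplaceBeltrami (baranSimplex n) u) p (baranVolume n) := by
  obtain ⟨C, hC⟩ := exists_norm_dunklXu_le hu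
  refine memLp_of_continuousOn_of_bound (continuousOn_laplaceBeltrami hu.1) (C := C)
    fun x hx => ?_
  rw [laplaceBeltrami_eq_dunklXu hu.1 hx]
  exact hC x hx

/-! ### Linearity -/

theorem partialDeriv_eqOn {u v : (Fin n → ℝ) → ℂ} (h : Set.EqOn u v (openSimplex n))
    (i : Fin n) : Set.EqOn (partialDeriv i u) (partialDeriv i v) (openSimplex n) := fun x hx =>
  partialDeriv_congr i (by filter_upwards [openSimplex_mem_nhds hx] with y hy using h hy)

theorem dunklXu_eqOn {u v : (Fin n → ℝ) → ℂ} (h : Set.EqOn u v (openSimplex n)) :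
    Set.EqOn (dunklXu n u) (dunklXu n v) (openSimplex n) := by
  intro x hx
  have h1 (i : Fin n) := partialDeriv_eqOn h i hx
  have h2 (i j : Fin n) := partialDeriv_eqOn (partialDeriv_eqOn h j) i hx
  simp only [dunklXu, h1, h2]

theorem partialDeriv_lincomb {u v : (Fin n → ℝ) → ℂ} (c : ℂ)
    (hu : ContDiffOn ℝ 1 u (openSimplex n)) (hv : ContDiffOn ℝ 1 v (openSimplex n)) (i : Fin n) :
    Set.EqOn (partialDeriv i (fun y => c * u y + v y))
      (fun y => c * partialDeriv i u y + partialDeriv i v y) (openSimplex n) := by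
  intro x hx
  have hu' := (contDiffAt_of_contDiffOn hu hx).differentiableAt (by norm_num)
  have hv' := (contDiffAt_of_contDiffOn hv hx).differentiableAt (by norm_num)
  simp only
  rw [partialDeriv_add i ((differentiableAt_const c).fun_mul hu') hv',
    partialDeriv_mul i (differentiableAt_const c) hu', partialDeriv_const]
  ring

theorem partialDeriv_partialDeriv_lincomb {u v : (Fin n → ℝ) → ℂ} (c : ℂ)
    (hu : ContDiffOn ℝ 2 u (openSimplex n)) (hv : ContDiffOn ℝ 2 v (openSimplex n))
    (i j : Fin n) : Set.EqOn (partialDeriv i (partialDeriv j (fun y => c * u y + v y)))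
      (fun y => c * partialDeriv i (partialDeriv j u) y + partialDeriv i (partialDeriv j v) y)
      (openSimplex n) :=
  (partialDeriv_eqOn (partialDeriv_lincomb c (hu.of_le (by norm_num)) (hv.of_le (by norm_num)) j)
    i).trans (partialDeriv_lincomb c (contDiffOn_partialDeriv hu (by norm_num) j)
      (contDiffOn_partialDeriv hv (by norm_num) j) i)

theorem lincomb_mem_C2b {u v : (Fin n → ℝ) → ℂ} (c : ℂ) (hu : u ∈ C2b n) (hv : v ∈ C2b n) :
    (fun y => c * u y + v y) ∈ C2b n := by
  obtain ⟨hud, A, hA⟩ := hu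
  obtain ⟨hvd, B, hB⟩ := hv
  refine ⟨(contDiffOn_const.mul hud).add hvd, ‖c‖ * A + B, fun x hx => ?_⟩
  obtain ⟨a0, a1, a2⟩ := hA x hx
  obtain ⟨b0, b1, b2⟩ := hB x hx
  have key {z w : ℂ} (hz : ‖z‖ ≤ A) (hw : ‖w‖ ≤ B) : ‖c * z + w‖ ≤ ‖c‖ * A + B := by
    refine (norm_add_le _ _).trans (add_le_add ?_ hw)
    rw [norm_mul]
    gcongr
  refine ⟨key a0 b0, fun i => ?_, fun i j => ?_⟩
  · rw [partialDeriv_lincomb c (hud.of_le (by norm_num)) (hvd.of_le (by norm_num)) i hx]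
    exact key (a1 i) (b1 i)
  · rw [partialDeriv_partialDeriv_lincomb c hud hvd i j hx]
    exact key (a2 i j) (b2 i j)

theorem dunklXu_lincomb {u v : (Fin n → ℝ) → ℂ} (c : ℂ)
    (hu : ContDiffOn ℝ 2 u (openSimplex n)) (hv : ContDiffOn ℝ 2 v (openSimplex n)) :
    Set.EqOn (dunklXu n (fun y => c * u y + v y)) (fun y => c * dunklXu n u y + dunklXu n v y)
      (openSimplex n) := by
  intro x hx
  have h1 (i : Fin n) := partialDeriv_lincomb c (hu.of_le (by norm_num : (1 : WithTop ℕ∞) ≤ 2))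
    (hv.of_le (by norm_num)) i hx
  have h2 (i j : Fin n) := partialDeriv_partialDeriv_lincomb c hu hv i j hx
  simp only [dunklXu, h1, h2, mul_add, Finset.sum_add_distrib]
  simp only [mul_left_comm _ c, ← Finset.mul_sum]
  ring

theorem laplaceBeltrami_lincomb {u v : (Fin n → ℝ) → ℂ} (c : ℂ) (hu : u ∈ C2b n)
    (hv : v ∈ C2b n) :
    Set.EqOn (laplaceBeltrami (baranSimplex n) (fun y => c * u y + v y))
      (fun y => c * laplaceBeltrami (baranSimplex n) u y + laplaceBeltrami (baranSimplex n) v y)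
      (openSimplex n) := by
  intro x hx
  rw [laplaceBeltrami_eq_dunklXu (lincomb_mem_C2b c hu hv).1 hx, dunklXu_lincomb c hu.1 hv.1 hx]
  simp only [laplaceBeltrami_eq_dunklXu hu.1 hx, laplaceBeltrami_eq_dunklXu hv.1 hx]

theorem zero_mem_C2b (n : ℕ) : (fun _ => 0 : (Fin n → ℝ) → ℂ) ∈ C2b n := by
  have h1 (i : Fin n) : partialDeriv i (fun _ => (0 : ℂ)) = fun _ => 0 :=
    funext fun x => partialDeriv_const i 0
  exact ⟨contDiffOn_const, 0, fun x _ => by simp [h1]⟩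

theorem laplaceBeltrami_zero : Set.EqOn (laplaceBeltrami (baranSimplex n) (fun _ => 0))
    (fun _ => 0) (openSimplex n) := by
  intro x hx
  rw [laplaceBeltrami_eq_dunklXu contDiffOn_const hx]
  have h1 (i : Fin n) : partialDeriv i (fun _ => (0 : ℂ)) = fun _ => 0 :=
    funext fun x => partialDeriv_const i 0
  simp [dunklXu, h1]

theorem partialDeriv_conj (u : (Fin n → ℝ) → ℂ) (i : Fin n) (x : Fin n → ℝ) :
    partialDeriv i (fun y => (starRingEnd ℂ) (u y)) x = (starRingEnd ℂ) (partialDeriv i u x) := by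
  have h := Complex.conjCLE.comp_fderiv (f := u) (x := x)
  unfold partialDeriv
  change fderiv ℝ (Complex.conjCLE ∘ u) x _ = _
  rw [h]
  rfl

theorem conj_mem_C2b {u : (Fin n → ℝ) → ℂ} (hu : u ∈ C2b n) :
    (fun y => (starRingEnd ℂ) (u y)) ∈ C2b n := by
  obtain ⟨hd, C, hC⟩ := hu
  have h1 (i : Fin n) : partialDeriv i (fun y => (starRingEnd ℂ) (u y)) =
      fun x => (starRingEnd ℂ) (partialDeriv i u x) := funext fun x => partialDeriv_conj u i x
  refine ⟨Complex.conjCLE.contDiff.comp_contDiffOn hd, C, fun x hx => ?_⟩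
  obtain ⟨a0, a1, a2⟩ := hC x hx
  refine ⟨by simpa using a0, fun i => ?_, fun i j => ?_⟩
  · rw [h1]
    simpa using a1 i
  · rw [h1, partialDeriv_conj]
    simpa using a2 i j

theorem dunklXu_conj (u : (Fin n → ℝ) → ℂ) (x : Fin n → ℝ) :
    dunklXu n (fun y => (starRingEnd ℂ) (u y)) x = (starRingEnd ℂ) (dunklXu n u x) := by
  have h1 (i : Fin n) : partialDeriv i (fun y => (starRingEnd ℂ) (u y)) =
      fun x => (starRingEnd ℂ) (partialDeriv i u x) := funext fun x => partialDeriv_conj u i x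
  simp only [dunklXu, h1, map_add, map_sub, map_mul, map_sum, Complex.conj_ofReal, map_div₀,
    map_one, map_ofNat, partialDeriv_conj]

theorem laplaceBeltrami_conj {u : (Fin n → ℝ) → ℂ} (hu : u ∈ C2b n) :
    Set.EqOn (laplaceBeltrami (baranSimplex n) (fun y => (starRingEnd ℂ) (u y)))
      (fun y => (starRingEnd ℂ) (laplaceBeltrami (baranSimplex n) u y)) (openSimplex n) := by
  intro x hx
  rw [laplaceBeltrami_eq_dunklXu (conj_mem_C2b hu).1 hx, dunklXu_conj]
  simp only [laplaceBeltrami_eq_dunklXu hu.1 hx]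

/-! ### Symmetry -/

theorem gradPairing_eq (u v : (Fin n → ℝ) → ℂ) {x : Fin n → ℝ} (hx : x ∈ openSimplex n) :
    gradPairing u v x = ∑ i, (x i : ℂ) * (partialDeriv i u x * partialDeriv i v x) -
      eulerDeriv u x * eulerDeriv v x := by
  unfold gradPairing
  simp only [riemGrad_baranSimplex v hx]
  have : eulerDeriv u x * eulerDeriv v x =
      ∑ i, (x i : ℂ) * partialDeriv i u x * eulerDeriv v x := by
    rw [← Finset.sum_mul]
    rfl
  rw [this, ← Finset.sum_sub_distrib]
  exact Finset.sum_congr rfl fun i _ => by ring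

theorem gradPairing_comm (u v : (Fin n → ℝ) → ℂ) {x : Fin n → ℝ} (hx : x ∈ openSimplex n) :
    gradPairing u v x = gradPairing v u x := by
  rw [gradPairing_eq u v hx, gradPairing_eq v u hx, mul_comm (eulerDeriv u x)]
  simp only [mul_comm (partialDeriv _ u x)]

theorem norm_eulerDeriv_le {u : (Fin n → ℝ) → ℂ} {x : Fin n → ℝ} (hx : x ∈ openSimplex n)
    {C : ℝ} (hC : ∀ i, ‖partialDeriv i u x‖ ≤ C) : ‖eulerDeriv u x‖ ≤ n * C := by
  refine (norm_sum_le_of_le (f := fun j => ((x j : ℝ) : ℂ) * partialDeriv j u x)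
    (n := fun _ => C) _ fun i _ => ?_).trans (by simp)
  rw [norm_mul, Complex.norm_real, Real.norm_eq_abs, abs_of_pos (hx.1 i)]
  exact (mul_le_of_le_one_left (norm_nonneg _) (lt_one_of_mem_openSimplex hx i).le).trans (hC i)

theorem continuousOn_gradPairing {u v : (Fin n → ℝ) → ℂ}
    (hu : ContDiffOn ℝ 1 u (openSimplex n)) (hv : ContDiffOn ℝ 1 v (openSimplex n)) :
    ContinuousOn (gradPairing u v) (openSimplex n) := by
  have h {w : (Fin n → ℝ) → ℂ} (hw : ContDiffOn ℝ 1 w (openSimplex n)) (i : Fin n) :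
      ContinuousOn (partialDeriv i w) (openSimplex n) :=
    (contDiffOn_partialDeriv (m := 0) hw (by norm_num) i).continuousOn
  have hE {w : (Fin n → ℝ) → ℂ} (hw : ContDiffOn ℝ 1 w (openSimplex n)) :
      ContinuousOn (eulerDeriv w) (openSimplex n) :=
    continuousOn_finsetSum _ fun i _ => (continuousOn_ofReal (by fun_prop)).mul (h hw i)
  refine ContinuousOn.congr ?_ fun x hx => gradPairing_eq u v hx
  refine ContinuousOn.sub ?_ ((hE hu).mul (hE hv))
  exact continuousOn_finsetSum _ fun i _ =>
    (continuousOn_ofReal (by fun_prop)).mul ((h hu i).mul (h hv i))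

theorem integrable_gradPairing_of_mem_C2b {u v : (Fin n → ℝ) → ℂ} (hu : u ∈ C2b n)
    (hv : v ∈ C2b n) : Integrable (gradPairing u v) (baranVolume n) := by
  obtain ⟨hud, A, hA⟩ := hu
  obtain ⟨hvd, B, hB⟩ := hv
  rw [← memLp_one_iff_integrable]
  refine memLp_of_continuousOn_of_bound (continuousOn_gradPairing (hud.of_le (by norm_num))
    (hvd.of_le (by norm_num))) (C := n * (A * B) + n * A * (n * B)) fun x hx => ?_
  have hA1 := (hA x hx).2.1
  have hB1 := (hB x hx).2.1
  have hA0 : 0 ≤ A := (norm_nonneg _).trans (hA x hx).1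
  have hB0 : 0 ≤ B := (norm_nonneg _).trans (hB x hx).1
  rw [gradPairing_eq u v hx]
  refine (norm_sub_le _ _).trans (add_le_add ?_ ?_)
  · refine (norm_sum_le_of_le _ (n := fun _ => A * B) fun i _ => ?_).trans (by simp)
    rw [norm_mul, norm_mul, Complex.norm_real, Real.norm_eq_abs, abs_of_pos (hx.1 i)]
    refine (mul_le_of_le_one_left (by positivity) (lt_one_of_mem_openSimplex hx i).le).trans ?_
    exact mul_le_mul (hA1 i) (hB1 i) (norm_nonneg _) hA0
  · rw [norm_mul]
    exact mul_le_mul (norm_eulerDeriv_le hx hA1) (norm_eulerDeriv_le hx hB1) (norm_nonneg _)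
      (by positivity)

/-- Green's formula against a function in `C²_b`. -/
theorem integral_gradPairing_eq_neg_of_mem_C2b {u v : (Fin n → ℝ) → ℂ}
    (hu : ContDiffOn ℝ 1 u (openSimplex n)) (hv : v ∈ C2b n)
    (hui : Integrable u (baranVolume n)) (hgrad : Integrable (gradPairing u v) (baranVolume n)) :
    ∫ x, gradPairing u v x ∂(baranVolume n) =
      -∫ x, u x * laplaceBeltrami (baranSimplex n) v x ∂(baranVolume n) := by
  obtain ⟨D, hD⟩ := exists_norm_dunklXu_le hv
  have hlap : Integrable (fun x => u x * laplaceBeltrami (baranSimplex n) v x)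
      (baranVolume n) := by
    refine hui.mul_bdd (c := D) (memLp_laplaceBeltrami hv (p := 1)).1 ?_
    filter_upwards [ae_baranVolume_mem n] with x hx
    rw [laplaceBeltrami_eq_dunklXu hv.1 hx]
    exact hD x hx
  obtain ⟨hvd, C, hC⟩ := hv
  rw [baranVolume, ← simplexMeasure_eq_riemVolume] at *
  exact integral_gradPairing_eq_neg hu hvd (fun x hx => (hC x hx).2.1) hui hlap hgrad

/-- Both sides equal minus the integral of `gradPairing`, which is symmetric because the inverse
metric is. -/
theorem integral_laplaceBeltrami_mul_comm {u v : (Fin n → ℝ) → ℂ} (hu : u ∈ C2b n)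
    (hv : v ∈ C2b n) :
    ∫ x, laplaceBeltrami (baranSimplex n) u x * v x ∂(baranVolume n) =
      ∫ x, u x * laplaceBeltrami (baranSimplex n) v x ∂(baranVolume n) := by
  have h1 := integral_gradPairing_eq_neg_of_mem_C2b (hu.1.of_le (by norm_num)) hv
    ((memLp_of_mem_C2b hu (p := 1)).integrable le_rfl) (integrable_gradPairing_of_mem_C2b hu hv)
  have h2 := integral_gradPairing_eq_neg_of_mem_C2b (hv.1.of_le (by norm_num)) hu
    ((memLp_of_mem_C2b hv (p := 1)).integrable le_rfl) (integrable_gradPairing_of_mem_C2b hv hu)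
  have h3 : ∫ x, gradPairing u v x ∂(baranVolume n) = ∫ x, gradPairing v u x ∂(baranVolume n) :=
    integral_congr_ae (by
      filter_upwards [ae_baranVolume_mem n] with x hx using gradPairing_comm u v hx)
  simp_rw [mul_comm (laplaceBeltrami (baranSimplex n) u _)]
  rw [← neg_inj, ← h1, ← h2, h3]

/-! ### The operator in `L²` -/

/-- The graph of the Laplacian with domain `C²_b`. -/
noncomputable def laplaceGraph (n : ℕ) : Submodule ℂ (SimplexL2 n × SimplexL2 n) where
  carrier := {p | ∃ u ∈ C2b n, (p.1 : (Fin n → ℝ) → ℂ) =ᵐ[baranVolume n] u ∧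
    (p.2 : (Fin n → ℝ) → ℂ) =ᵐ[baranVolume n] laplaceBeltrami (baranSimplex n) u}
  add_mem' := by
    rintro p q ⟨u, hu, hu1, hu2⟩ ⟨v, hv, hv1, hv2⟩
    refine ⟨_, lincomb_mem_C2b 1 hu hv, ?_, ?_⟩
    · filter_upwards [hu1, hv1, Lp.coeFn_add p.1 q.1] with x h1 h2 h3
      rw [Prod.fst_add, h3, Pi.add_apply, h1, h2, one_mul]
    · filter_upwards [hu2, hv2, Lp.coeFn_add p.2 q.2, ae_baranVolume_mem n] with x h1 h2 h3 hx
      rw [Prod.snd_add, h3, Pi.add_apply, h1, h2, laplaceBeltrami_lincomb 1 hu hv hx]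
      simp only [one_mul]
  zero_mem' := by
    refine ⟨_, zero_mem_C2b n, Lp.coeFn_zero _ _ _, ?_⟩
    refine (Lp.coeFn_zero _ _ _).trans (ae_baranVolume_of_eqOn fun x hx => ?_)
    rw [laplaceBeltrami_zero hx]
    rfl
  smul_mem' := by
    rintro c p ⟨u, hu, hu1, hu2⟩
    refine ⟨_, lincomb_mem_C2b c hu (zero_mem_C2b n), ?_, ?_⟩
    · filter_upwards [hu1, Lp.coeFn_smul c p.1] with x h1 h3
      rw [Prod.smul_fst, h3, Pi.smul_apply, h1, add_zero, smul_eq_mul]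
    · filter_upwards [hu2, Lp.coeFn_smul c p.2, ae_baranVolume_mem n] with x h1 h3 hx
      rw [Prod.smul_snd, h3, Pi.smul_apply, h1,
        laplaceBeltrami_lincomb c hu (zero_mem_C2b n) hx]
      simp only [laplaceBeltrami_zero hx, add_zero, smul_eq_mul]

/-- The Laplacian of the Baran simplex, with domain `C²_b`. -/
noncomputable def simplexLaplacian (n : ℕ) : SimplexL2 n →ₗ.[ℂ] SimplexL2 n :=
  (laplaceGraph n).toLinearPMap

/-- Well-definedness: a `C²_b` function that vanishes almost everywhere vanishes on the whole open
simplex, and then so does its Laplacian. -/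
theorem simplexLaplacian_graph (n : ℕ) : (simplexLaplacian n).graph = laplaceGraph n := by
  refine Submodule.toLinearPMap_graph_eq _ ?_
  rintro ⟨f, h⟩ ⟨u, hu, hu1, hu2⟩ hf
  simp only at hf hu1 hu2 ⊢
  subst hf
  have h0 : Set.EqOn u (fun _ => 0) (openSimplex n) :=
    eqOn_of_ae_baranVolume (hu1.symm.trans (Lp.coeFn_zero _ _ _)) hu.1.continuousOn
      continuousOn_const
  apply Lp.ext
  refine hu2.trans (.trans ?_ (Lp.coeFn_zero _ _ _).symm)
  refine ae_baranVolume_of_eqOn fun x hx => ?_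
  rw [laplaceBeltrami_eq_dunklXu hu.1 hx, dunklXu_eqOn h0 hx,
    ← laplaceBeltrami_eq_dunklXu (zero_mem_C2b n).1 hx, laplaceBeltrami_zero hx]
  rfl

theorem mem_simplexLaplacian_graph (f h : SimplexL2 n) :
    (f, h) ∈ (simplexLaplacian n).graph ↔ ∃ u ∈ C2b n,
      (f : (Fin n → ℝ) → ℂ) =ᵐ[baranVolume n] u ∧
      (h : (Fin n → ℝ) → ℂ) =ᵐ[baranVolume n] laplaceBeltrami (baranSimplex n) u := by
  rw [simplexLaplacian_graph]
  rfl

/-- Green's formula is bilinear and the inner product is sesquilinear, so it is applied to the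
conjugate of `u`; the Laplacian is real and commutes with conjugation. -/
theorem simplexLaplacian_isFormalAdjoint (n : ℕ) :
    (simplexLaplacian n).IsFormalAdjoint (simplexLaplacian n) := by
  intro f g
  obtain ⟨u, hu, hu1, hu2⟩ := (mem_simplexLaplacian_graph _ _).1 ((simplexLaplacian n).mem_graph f)
  obtain ⟨v, hv, hv1, hv2⟩ := (mem_simplexLaplacian_graph _ _).1 ((simplexLaplacian n).mem_graph g)
  rw [L2.inner_def, L2.inner_def]
  have e1 : ∫ x, inner ℂ ((simplexLaplacian n f : SimplexL2 n) x) ((g : SimplexL2 n) x)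
      ∂(baranVolume n) = ∫ x, laplaceBeltrami (baranSimplex n)
        (fun y => (starRingEnd ℂ) (u y)) x * v x ∂(baranVolume n) := by
    refine integral_congr_ae ?_
    filter_upwards [hu2, hv1, ae_baranVolume_mem n] with x h1 h2 hx
    rw [h1, h2, laplaceBeltrami_conj hu hx, RCLike.inner_apply, mul_comm]
  have e2 : ∫ x, inner ℂ ((f : SimplexL2 n) x) ((simplexLaplacian n g : SimplexL2 n) x)
      ∂(baranVolume n) = ∫ x, (starRingEnd ℂ) (u x) * laplaceBeltrami (baranSimplex n) v x
        ∂(baranVolume n) := by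
    refine integral_congr_ae ?_
    filter_upwards [hu1, hv2] with x h1 h2
    rw [h1, h2, RCLike.inner_apply, mul_comm]
  exact e1.trans ((integral_laplaceBeltrami_mul_comm (conj_mem_C2b hu) hv).trans e2.symm)

end Laplacian

/-! ### The orthonormal basis of polynomials -/

section PolyL2

open MvPolynomial

variable {n : ℕ}

theorem integrable_polyFun (p : MvPolynomial (Fin n) ℂ) :
    Integrable (polyFun p) (baranVolume n) :=
  (memLp_of_mem_C2b (polyFun_mem_C2b p) (p := 1)).integrable le_rfl

/-- Integration of polynomials over the simplex. -/
noncomputable def polyIntegral (n : ℕ) : MvPolynomial (Fin n) ℂ →ₗ[ℂ] ℂ where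
  toFun p := ∫ x, polyFun p x ∂(baranVolume n)
  map_add' p q := by
    simp only [polyFun_add]
    exact integral_add (integrable_polyFun p) (integrable_polyFun q)
  map_smul' c p := by
    simp only [polyFun_smul, RingHom.id_apply, smul_eq_mul]
    exact integral_const_mul _ _

theorem polyIntegral_apply (p : MvPolynomial (Fin n) ℂ) :
    polyIntegral n p = ∫ x, polyFun p x ∂(baranVolume n) := rfl

theorem polyIntegral_dunklPoly_mul (p q : MvPolynomial (Fin n) ℂ) :
    polyIntegral n (dunklPoly n p * q) = polyIntegral n (p * dunklPoly n q) := by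
  have h := integral_laplaceBeltrami_mul_comm (polyFun_mem_C2b p) (polyFun_mem_C2b q)
  have key (r : MvPolynomial (Fin n) ℂ) {x : Fin n → ℝ} (hx : x ∈ openSimplex n) :
      laplaceBeltrami (baranSimplex n) (polyFun r) x = polyFun (dunklPoly n r) x := by
    rw [laplaceBeltrami_eq_dunklXu (polyFun_mem_C2b r).1 hx, dunklXu_polyFun]
  rw [polyIntegral_apply, polyIntegral_apply]
  refine Eq.trans (integral_congr_ae ?_) (h.trans (integral_congr_ae ?_))
  · filter_upwards [ae_baranVolume_mem n] with x hx
    rw [polyFun_mul, key p hx]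
  · filter_upwards [ae_baranVolume_mem n] with x hx
    rw [polyFun_mul, key q hx]

/-- The class in `L²` of a polynomial. -/
noncomputable def polyToL2 (n : ℕ) : MvPolynomial (Fin n) ℂ →ₗ[ℂ] SimplexL2 n where
  toFun p := (memLp_of_mem_C2b (polyFun_mem_C2b p)).toLp (polyFun p)
  map_add' p q := by
    rw [← MemLp.toLp_add]
    exact MemLp.toLp_congr _ _ (Filter.Eventually.of_forall fun x => polyFun_add p q x)
  map_smul' c p := by
    rw [RingHom.id_apply, ← MemLp.toLp_const_smul]
    exact MemLp.toLp_congr _ _ (Filter.Eventually.of_forall fun x => polyFun_smul c p x)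

theorem coeFn_polyToL2 (p : MvPolynomial (Fin n) ℂ) :
    (polyToL2 n p : (Fin n → ℝ) → ℂ) =ᵐ[baranVolume n] polyFun p :=
  MemLp.coeFn_toLp (memLp_of_mem_C2b (polyFun_mem_C2b p))

theorem polyToL2_injective (n : ℕ) : Function.Injective (polyToL2 n) := by
  intro p q h
  refine eq_of_polyFun_eqOn (eqOn_of_ae_baranVolume ?_ (contDiff_polyFun p (m := 0)).continuous.continuousOn
    (contDiff_polyFun q (m := 0)).continuous.continuousOn)
  have h1 := coeFn_polyToL2 p
  rw [h] at h1
  exact h1.symm.trans (coeFn_polyToL2 q)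

theorem polyFun_map_conj (p : MvPolynomial (Fin n) ℂ) (x : Fin n → ℝ) :
    polyFun (map (starRingEnd ℂ) p) x = (starRingEnd ℂ) (polyFun p x) := by
  unfold polyFun
  induction p using MvPolynomial.induction_on with
  | C c => simp
  | add p q hp hq => rw [map_add, map_add, map_add, map_add, hp, hq]
  | mul_X p i hp => simp [hp]

theorem polyFun_map_ofReal (p : MvPolynomial (Fin n) ℝ) (x : Fin n → ℝ) :
    polyFun (map Complex.ofRealHom p) x = ((eval x p : ℝ) : ℂ) := by
  unfold polyFun
  induction p using MvPolynomial.induction_on with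
  | C c => simp
  | add p q hp hq => rw [map_add, map_add, map_add, Complex.ofReal_add, hp, hq]
  | mul_X p i hp => simp [hp]

theorem inner_polyToL2 (p q : MvPolynomial (Fin n) ℂ) :
    inner ℂ (polyToL2 n p) (polyToL2 n q) = polyIntegral n (map (starRingEnd ℂ) p * q) := by
  rw [L2.inner_def, polyIntegral_apply]
  refine integral_congr_ae ?_
  filter_upwards [coeFn_polyToL2 p, coeFn_polyToL2 q] with x h1 h2
  rw [h1, h2, polyFun_mul, polyFun_map_conj, RCLike.inner_apply, mul_comm]

theorem map_conj_mem_polyLT {s : ℕ} {p : MvPolynomial (Fin n) ℂ} (hp : p ∈ polyLT n s) :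
    map (starRingEnd ℂ) p ∈ polyLT n s := by
  rw [polyLT, mem_restrictSupport_iff] at hp ⊢
  exact fun γ hγ => hp (support_map_subset _ _ hγ)

/-- A polynomial of degree less than `s` orthogonal to all such polynomials vanishes. -/
theorem eq_zero_of_forall_polyIntegral {s : ℕ} {p : MvPolynomial (Fin n) ℂ} (hp : p ∈ polyLT n s)
    (h : ∀ q ∈ polyLT n s, polyIntegral n (q * p) = 0) : p = 0 := by
  have h1 : inner ℂ (polyToL2 n p) (polyToL2 n p) = 0 := by
    rw [inner_polyToL2]
    exact h _ (map_conj_mem_polyLT hp)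
  exact polyToL2_injective n ((inner_self_eq_zero.1 h1).trans (map_zero _).symm)

/-! ### Density of polynomials -/

/-- Stone–Weierstrass on the compact closure of the simplex: the coordinates separate points. -/
theorem exists_polyFun_near {f : (Fin n → ℝ) → ℝ} (hf : Continuous f) {ε : ℝ} (hε : 0 < ε) :
    ∃ p : MvPolynomial (Fin n) ℝ, ∀ x ∈ openSimplex n, |eval x p - f x| < ε := by
  set K := closure (openSimplex n)
  have : CompactSpace K := isCompact_iff_compactSpace.1 (isCompact_closure_openSimplex n)
  let φ : MvPolynomial (Fin n) ℝ →ₐ[ℝ] C(K, ℝ) :=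
    aeval fun i => ⟨fun x : K => (x : Fin n → ℝ) i, (continuous_apply i).comp continuous_subtype_val⟩
  have hφ (p : MvPolynomial (Fin n) ℝ) (x : K) : φ p x = eval (x : Fin n → ℝ) p := by
    induction p using MvPolynomial.induction_on with
    | C c => simp [φ]
    | add p q hp hq => rw [map_add, map_add, ContinuousMap.add_apply, hp, hq]
    | mul_X p i hp =>
      rw [map_mul, map_mul, ContinuousMap.mul_apply, hp]
      simp [φ]
  have hsep : φ.range.SeparatesPoints := by
    intro x y hxy
    obtain ⟨i, hi⟩ := Function.ne_iff.1 (Subtype.coe_injective.ne hxy)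
    exact ⟨_, ⟨φ (X i), ⟨X i, rfl⟩, rfl⟩, by simpa [hφ] using hi⟩
  obtain ⟨⟨_, p, rfl⟩, hp⟩ :=
    ContinuousMap.exists_mem_subalgebra_near_continuousMap_of_separatesPoints φ.range hsep
      ⟨fun x : K => f x, by fun_prop⟩ ε hε
  refine ⟨p, fun x hx => ?_⟩
  have h := (ContinuousMap.norm_lt_iff _ hε).1 hp ⟨x, subset_closure hx⟩
  rw [← Real.norm_eq_abs]
  have e := hφ p ⟨x, subset_closure hx⟩
  simp only [ContinuousMap.sub_apply, ContinuousMap.coe_mk] at h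
  rw [← e]
  exact h

theorem dense_range_polyToL2 (n : ℕ) :
    Dense (LinearMap.range (polyToL2 n) : Set (SimplexL2 n)) := by
  have hd := BoundedContinuousFunction.toLp_denseRange (p := 2) ℂ (baranVolume n) ℂ (by simp)
  intro f
  rw [Metric.mem_closure_iff]
  intro ε hε
  obtain ⟨g, hg⟩ := hd.exists_dist_lt f (half_pos hε)
  set M : ℝ := (baranVolume n).real Set.univ ^ (2 : ENNReal).toReal⁻¹ with hM
  have hM0 : 0 ≤ M := by positivity
  -- The real and imaginary parts contribute `2 δ` together, and `M` is the square root of the total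
  -- mass; `M + 1` gives `M * (2 * δ) < ε / 2` also when `M = 0`.
  set δ := ε / (2 * (2 * (M + 1))) with hδ
  have hδ0 : 0 < δ := by positivity
  obtain ⟨p, hp⟩ := exists_polyFun_near (n := n) (f := fun x => (g x).re)
    (Complex.continuous_re.comp g.continuous) hδ0
  obtain ⟨q, hq⟩ := exists_polyFun_near (n := n) (f := fun x => (g x).im)
    (Complex.continuous_im.comp g.continuous) hδ0
  set P : MvPolynomial (Fin n) ℂ :=
    map Complex.ofRealHom p + Complex.I • map Complex.ofRealHom q with hP
  refine ⟨polyToL2 n P, ⟨P, rfl⟩, ?_⟩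
  refine (dist_triangle _ (BoundedContinuousFunction.toLp 2 (baranVolume n) ℂ g) _).trans_lt ?_
  have h2 : dist (BoundedContinuousFunction.toLp 2 (baranVolume n) ℂ g) (polyToL2 n P) ≤
      M * (2 * δ) := by
    rw [dist_eq_norm]
    refine (Lp.norm_le_of_ae_bound (C := 2 * δ) (by positivity) ?_).trans ?_
    · filter_upwards [Lp.coeFn_sub (BoundedContinuousFunction.toLp 2 (baranVolume n) ℂ g)
        (polyToL2 n P), BoundedContinuousFunction.coeFn_toLp (p := 2) (μ := baranVolume n)
        (𝕜 := ℂ) g, coeFn_polyToL2 P, ae_baranVolume_mem n] with x h1 h2 h3 hx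
      rw [h1, Pi.sub_apply, h2, h3, hP, polyFun_add, polyFun_smul, polyFun_map_ofReal,
        polyFun_map_ofReal]
      refine (Complex.norm_le_abs_re_add_abs_im _).trans ?_
      have a1 := hp x hx
      have a2 := hq x hx
      rw [abs_sub_comm] at a1 a2
      have e1 : (g x - (((eval x p : ℝ) : ℂ) + Complex.I * ((eval x q : ℝ) : ℂ))).re =
          (g x).re - eval x p := by simp
      have e2 : (g x - (((eval x p : ℝ) : ℂ) + Complex.I * ((eval x q : ℝ) : ℂ))).im =
          (g x).im - eval x q := by simp
      rw [e1, e2]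
      linarith
    · rfl
  have h3 : M * (2 * δ) < ε / 2 := by
    rw [hδ]
    have : M * (2 * (ε / (2 * (2 * (M + 1))))) = ε / 2 * (M / (M + 1)) := by
      field_simp
    rw [this]
    have h4 : M / (M + 1) < 1 := by
      rw [div_lt_one (by positivity)]
      linarith
    nlinarith
  linarith

end PolyL2

/-! ### The normalized polynomials as an orthonormal basis of eigenfunctions. -/

section Psi

open MvPolynomial

variable {n : ℕ}

/-- The squared norm of `P_α`. -/
noncomputable def simplexNormSq (α : Fin n → ℕ) : ℝ :=
  ∫ y, simplexPoly α y ^ 2 ∂(simplexMeasure n)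

theorem ae_simplexPoly (α : Fin n → ℕ) : ∀ᵐ x ∂(simplexMeasure n),
    ((simplexPoly α x : ℝ) : ℂ) = polyFun (map Complex.ofRealHom (simplexMvPoly α)) x := by
  filter_upwards [ae_mem_openSimplex n] with x hx
  rw [polyFun_map_ofReal, eval_simplexMvPoly α hx]

theorem integrable_simplexPoly_mul (α β : Fin n → ℕ) :
    Integrable (fun x => simplexPoly α x * simplexPoly β x) (simplexMeasure n) := by
  obtain ⟨A, hA⟩ := exists_norm_polyFun_le (map Complex.ofRealHom (simplexMvPoly α))
  obtain ⟨B, hB⟩ := exists_norm_polyFun_le (map Complex.ofRealHom (simplexMvPoly β))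
  refine Integrable.of_bound
    ((measurable_simplexPoly α).mul (measurable_simplexPoly β)).aestronglyMeasurable (A * B) ?_
  filter_upwards [ae_mem_openSimplex n, ae_simplexPoly α, ae_simplexPoly β] with x hx h1 h2
  have a1 := hA x hx
  have b1 := hB x hx
  rw [← h1, Complex.norm_real] at a1
  rw [← h2, Complex.norm_real] at b1
  rw [norm_mul]
  exact mul_le_mul a1 b1 (norm_nonneg _) ((norm_nonneg _).trans a1)

/-- A vanishing norm would make a nonzero polynomial vanish almost everywhere on the simplex, hence
identically. So the normalization never divides by zero. -/
theorem simplexNormSq_pos (α : Fin n → ℕ) : 0 < simplexNormSq α := by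
  have h0 : 0 ≤ simplexNormSq α := integral_nonneg fun x => sq_nonneg _
  refine lt_of_le_of_ne h0 fun h => ?_
  have hi : Integrable (fun x => simplexPoly α x ^ 2) (simplexMeasure n) := by
    simp only [sq]
    exact integrable_simplexPoly_mul α α
  have h1 := (integral_eq_zero_iff_of_nonneg (fun x => sq_nonneg (simplexPoly α x)) hi).1 h.symm
  have h2 : map Complex.ofRealHom (simplexMvPoly α) = 0 := by
    refine eq_of_polyFun_eqOn (eqOn_of_ae_baranVolume ?_
      (contDiff_polyFun _ (m := 0)).continuous.continuousOn
      (contDiff_polyFun _ (m := 0)).continuous.continuousOn)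
    rw [baranVolume, ← simplexMeasure_eq_riemVolume]
    filter_upwards [h1, ae_simplexPoly α] with x hx hx'
    rw [← hx', pow_eq_zero_iff (two_ne_zero) |>.1 hx]
    simp [polyFun]
  refine simplexMvPoly_ne_zero α (map_injective Complex.ofRealHom Complex.ofReal_injective ?_)
  rw [h2, map_zero]

/-- The polynomial which agrees with `psi α` on the simplex. -/
noncomputable def psiMvPoly (α : Fin n → ℕ) : MvPolynomial (Fin n) ℝ :=
  C (√(simplexNormSq α))⁻¹ * simplexMvPoly α

theorem sqrt_simplexNormSq_pos (α : Fin n → ℕ) : 0 < √(simplexNormSq α) :=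
  Real.sqrt_pos.2 (simplexNormSq_pos α)

theorem totalDegree_psiMvPoly (α : Fin n → ℕ) : (psiMvPoly α).totalDegree = multiDeg α := by
  have hc := (inv_pos.2 (sqrt_simplexNormSq_pos α)).ne'
  rw [psiMvPoly, totalDegree_mul_of_isDomain (by simpa using (sqrt_simplexNormSq_pos α).ne')
    (simplexMvPoly_ne_zero α), totalDegree_C, zero_add, totalDegree_simplexMvPoly]

theorem psi_eq_mul (α : Fin n → ℕ) (x : Fin n → ℝ) :
    psi α x = (√(simplexNormSq α))⁻¹ * simplexPoly α x := by
  rw [psi, div_eq_inv_mul]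
  rfl

theorem psi_eq_eval (α : Fin n → ℕ) {x : Fin n → ℝ} (hx : x ∈ openSimplex n) :
    psi α x = eval x (psiMvPoly α) := by
  rw [psiMvPoly, map_mul, eval_C, eval_simplexMvPoly α hx, psi_eq_mul]

theorem integral_psi_mul (α β : Fin n → ℕ) :
    ∫ x, psi α x * psi β x ∂(simplexMeasure n) = if α = β then 1 else 0 := by
  have h (x : Fin n → ℝ) : psi α x * psi β x =
      (√(simplexNormSq α))⁻¹ * (√(simplexNormSq β))⁻¹ * (simplexPoly α x * simplexPoly β x) := by
    rw [psi_eq_mul, psi_eq_mul]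
    ring
  simp only [h]
  rw [integral_const_mul]
  split_ifs with hab
  · subst hab
    have e : ∫ x, simplexPoly α x * simplexPoly α x ∂(simplexMeasure n) = simplexNormSq α := by
      simp only [simplexNormSq, sq]
    have hs := Real.mul_self_sqrt (simplexNormSq_pos α).le
    have hp := sqrt_simplexNormSq_pos α
    rw [e]
    field_simp
    rw [sq]
    exact hs.symm
  · rw [integral_simplexPoly_mul_of_ne hab, mul_zero]

/-- The polynomial `psiMvPoly α` with complex coefficients. -/
noncomputable def psiPolyC (α : Fin n → ℕ) : MvPolynomial (Fin n) ℂ :=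
  map Complex.ofRealHom (psiMvPoly α)

theorem polyFun_psiPolyC (α : Fin n → ℕ) {x : Fin n → ℝ} (hx : x ∈ openSimplex n) :
    polyFun (psiPolyC α) x = ((psi α x : ℝ) : ℂ) := by
  rw [psiPolyC, polyFun_map_ofReal, psi_eq_eval α hx]

theorem map_conj_psiPolyC (α : Fin n → ℕ) : map (starRingEnd ℂ) (psiPolyC α) = psiPolyC α := by
  rw [psiPolyC, map_map]
  have h : (starRingEnd ℂ).comp Complex.ofRealHom = Complex.ofRealHom :=
    RingHom.ext fun r => Complex.conj_ofReal r
  rw [h]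

theorem psiPolyC_mem_polyLT (α : Fin n → ℕ) : psiPolyC α ∈ polyLT n (multiDeg α + 1) := by
  rw [polyLT, mem_restrictSupport_iff]
  intro γ hγ
  have h := le_totalDegree (support_map_subset _ _ hγ)
  rw [totalDegree_psiMvPoly] at h
  exact Nat.lt_succ_of_le h

theorem multiDeg_coe (γ : Fin n →₀ ℕ) : multiDeg (γ : Fin n → ℕ) = γ.degree := by
  rw [Finsupp.degree_eq_sum]
  rfl

theorem polyIntegral_mul_psiPolyC {α : Fin n → ℕ} {q : MvPolynomial (Fin n) ℂ}
    (hq : q ∈ polyLT n (multiDeg α)) : polyIntegral n (q * psiPolyC α) = 0 := by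
  suffices h : polyLT n (multiDeg α) ≤
      LinearMap.ker (polyIntegral n ∘ₗ LinearMap.mulRight ℂ (psiPolyC α)) by
    simpa using h hq
  refine polyLT_le_of_monomial fun γ hγ => ?_
  rw [LinearMap.mem_ker, LinearMap.comp_apply, LinearMap.mulRight_apply, polyIntegral_apply,
    baranVolume, ← simplexMeasure_eq_riemVolume]
  have h0 := integral_simplexPoly_mul_monomial α γ (by rwa [multiDeg_coe])
  have e : ∀ᵐ x ∂(simplexMeasure n), polyFun (monomial γ 1 * psiPolyC α) x =
      (((√(simplexNormSq α))⁻¹ * (simplexPoly α x * ∏ i, x i ^ γ i) : ℝ) : ℂ) := by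
    filter_upwards [ae_mem_openSimplex n] with x hx
    rw [polyFun_mul, polyFun_psiPolyC α hx, psi_eq_mul]
    have : polyFun (monomial γ 1) x = ((∏ i, x i ^ γ i : ℝ) : ℂ) := by
      unfold polyFun
      rw [eval_monomial, Finsupp.prod_fintype _ _ (by simp)]
      simp
    rw [this]
    push_cast
    ring
  rw [integral_congr_ae e, integral_complex_ofReal, integral_const_mul, h0, mul_zero, Complex.ofReal_zero]

/-- The `ψ_α` are eigenfunctions of the Dunkl–Xu operator. -/
theorem dunklPoly_psiPolyC (α : Fin n → ℕ) :
    dunklPoly n (psiPolyC α) = -((simplexEigenvalue n (multiDeg α) : ℂ) • psiPolyC α) := by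
  -- The residual has degree below `|α|`. Against such a `q` both of its parts integrate to zero,
  -- because the operator can be moved to `q` and does not raise its degree.
  rw [eq_neg_iff_add_eq_zero]
  refine eq_zero_of_forall_polyIntegral
    (dunklPoly_add_smul_mem_polyLT (psiPolyC_mem_polyLT α)) fun q hq => ?_
  rw [mul_add, map_add, ← polyIntegral_dunklPoly_mul,
    polyIntegral_mul_psiPolyC (dunklPoly_mem_polyLT hq), mul_smul_comm, map_smul,
    polyIntegral_mul_psiPolyC hq, smul_zero, add_zero]

theorem orthonormal_psi (n : ℕ) :
    Orthonormal ℂ fun α : Fin n → ℕ => polyToL2 n (psiPolyC α) := by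
  rw [orthonormal_iff_ite]
  intro α β
  rw [inner_polyToL2, map_conj_psiPolyC, polyIntegral_apply, baranVolume,
    ← simplexMeasure_eq_riemVolume]
  have e : ∀ᵐ x ∂(simplexMeasure n), polyFun (psiPolyC α * psiPolyC β) x =
      ((psi α x * psi β x : ℝ) : ℂ) := by
    filter_upwards [ae_mem_openSimplex n] with x hx
    rw [polyFun_mul, polyFun_psiPolyC α hx, polyFun_psiPolyC β hx, Complex.ofReal_mul]
  rw [integral_congr_ae e, integral_complex_ofReal, integral_psi_mul]
  split_ifs <;> simp

theorem finite_multiDeg_lt (n s : ℕ) : {α : Fin n → ℕ | multiDeg α < s}.Finite := by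
  refine (Set.finite_Iic (fun _ : Fin n => s)).subset fun α hα i => ?_
  exact (Finset.single_le_sum (f := α) (fun _ _ => Nat.zero_le _) (Finset.mem_univ i)).trans
    (le_of_lt hα)

/-- The polynomials of degree less than `s` are spanned by the `ψ_α` with `|α| < s`. -/
theorem span_psi_eq_map_polyLT (n s : ℕ) :
    Submodule.span ℂ (Set.range fun α : {α : Fin n → ℕ // multiDeg α < s} =>
      polyToL2 n (psiPolyC α.1)) = (polyLT n s).map (polyToL2 n) := by
  have hfin : Finite {α : Fin n → ℕ // multiDeg α < s} := finite_multiDeg_lt n s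
  have := Fintype.ofFinite {α : Fin n → ℕ // multiDeg α < s}
  let e : {γ : Fin n →₀ ℕ | γ.degree < s} ≃ {α : Fin n → ℕ // multiDeg α < s} :=
    Finsupp.equivFunOnFinite.subtypeEquiv fun γ => by
      change γ.degree < s ↔ multiDeg (γ : Fin n → ℕ) < s
      rw [multiDeg_coe]
  have hfin' : Finite {γ : Fin n →₀ ℕ | γ.degree < s} := Finite.of_equiv _ e.symm
  let b := basisRestrictSupport ℂ {γ : Fin n →₀ ℕ | γ.degree < s}
  have hfd : FiniteDimensional ℂ (polyLT n s) := Module.Finite.of_basis b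
  have hdim : Module.finrank ℂ (polyLT n s) = Nat.card {α : Fin n → ℕ // multiDeg α < s} :=
    (Module.finrank_eq_nat_card_basis b).trans (Nat.card_congr e)
  -- A dimension count: the same multi-indices label the monomials of degree below `s` and the
  -- linearly independent `ψ_α`.
  refine Submodule.eq_of_le_of_finrank_eq ?_ ?_
  · rw [Submodule.span_le]
    rintro _ ⟨α, rfl⟩
    exact ⟨_, polyLT_mono α.2 (psiPolyC_mem_polyLT α.1), rfl⟩
  · have hli : LinearIndependent ℂ fun α : {α : Fin n → ℕ // multiDeg α < s} =>
        polyToL2 n (psiPolyC α.1) :=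
      (orthonormal_psi n).linearIndependent.comp _ Subtype.val_injective
    rw [finrank_span_eq_card hli, ← Nat.card_eq_fintype_card, ← hdim]
    exact (Submodule.equivMapOfInjective _ (polyToL2_injective n) _).finrank_eq

theorem mem_polyLT_totalDegree (p : MvPolynomial (Fin n) ℂ) :
    p ∈ polyLT n (p.totalDegree + 1) := by
  rw [polyLT, mem_restrictSupport_iff]
  exact fun γ hγ => Nat.lt_succ_of_le (le_totalDegree hγ)

theorem dense_span_psi (n : ℕ) : ⊤ ≤ (Submodule.span ℂ (Set.range fun α : Fin n → ℕ =>
    polyToL2 n (psiPolyC α))).topologicalClosure := by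
  rw [top_le_iff, ← Submodule.dense_iff_topologicalClosure_eq_top]
  refine (dense_range_polyToL2 n).mono ?_
  rintro _ ⟨p, rfl⟩
  have h : polyToL2 n p ∈ (polyLT n (p.totalDegree + 1)).map (polyToL2 n) :=
    ⟨p, mem_polyLT_totalDegree p, rfl⟩
  rw [← span_psi_eq_map_polyLT] at h
  refine Submodule.span_mono ?_ h
  rintro _ ⟨α, rfl⟩
  exact ⟨α.1, rfl⟩

/-- The Hilbert basis of `L²(Sⁿ, g)` formed by the `ψ_α`. -/
noncomputable def psiBasis (n : ℕ) : HilbertBasis (Fin n → ℕ) ℂ (SimplexL2 n) :=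
  HilbertBasis.mk (orthonormal_psi n) (dense_span_psi n)

theorem psiBasis_apply (α : Fin n → ℕ) : psiBasis n α = polyToL2 n (psiPolyC α) := by
  rw [psiBasis, HilbertBasis.coe_mk]

theorem coeFn_psiBasis (α : Fin n → ℕ) :
    (psiBasis n α : (Fin n → ℝ) → ℂ) =ᵐ[baranVolume n] fun x => ((psi α x : ℝ) : ℂ) := by
  rw [psiBasis_apply]
  filter_upwards [coeFn_polyToL2 (psiPolyC α), ae_baranVolume_mem n] with x h1 hx
  rw [h1, polyFun_psiPolyC α hx]

theorem psiClasses_eq (n s : ℕ) : psiClasses n s = psiBasis n '' {α | multiDeg α = s} := by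
  ext f
  constructor
  · rintro ⟨α, hα, hf⟩
    exact ⟨α, hα, Lp.ext ((coeFn_psiBasis α).trans hf.symm)⟩
  · rintro ⟨α, hα, rfl⟩
    exact ⟨α, hα, coeFn_psiBasis α⟩

theorem fourierCoeffSimplex_eq (u : SimplexL2 n) (α : Fin n → ℕ) :
    fourierCoeffSimplex u α = (psiBasis n).repr u α := by
  rw [HilbertBasis.repr_apply_apply, L2.inner_def, fourierCoeffSimplex,
    simplexMeasure_eq_riemVolume]
  refine integral_congr_ae ?_
  filter_upwards [coeFn_psiBasis α] with x h
  rw [h, RCLike.inner_apply, Complex.conj_ofReal]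

theorem psiBasis_mem_simplexLaplacian_graph (α : Fin n → ℕ) :
    (psiBasis n α, ((-simplexEigenvalue n (multiDeg α) : ℝ) : ℂ) • psiBasis n α) ∈
      (simplexLaplacian n).graph := by
  rw [mem_simplexLaplacian_graph]
  refine ⟨_, polyFun_mem_C2b (psiPolyC α), ?_, ?_⟩
  · rw [psiBasis_apply]
    exact coeFn_polyToL2 _
  · rw [psiBasis_apply]
    filter_upwards [Lp.coeFn_smul ((-simplexEigenvalue n (multiDeg α) : ℝ) : ℂ)
      (polyToL2 n (psiPolyC α)), coeFn_polyToL2 (psiPolyC α), ae_baranVolume_mem n]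
      with x h1 h2 hx
    rw [h1, Pi.smul_apply, h2, laplaceBeltrami_eq_dunklXu (polyFun_mem_C2b _).1 hx,
      dunklXu_polyFun, dunklPoly_psiPolyC, ← neg_smul, polyFun_smul, smul_eq_mul,
      Complex.ofReal_neg]

end Psi

/-! ### The energy form and `H¹` -/

section Energy

variable {n : ℕ}

theorem sum_riemGrad_baranSimplex (u : (Fin n → ℝ) → ℂ) {x : Fin n → ℝ} (hx : x ∈ openSimplex n) :
    ∑ i, riemGrad (baranSimplex n) u x i = ((1 - ∑ i, x i : ℝ) : ℂ) * eulerDeriv u x := by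
  simp only [riemGrad_baranSimplex u hx, mul_sub, Finset.sum_sub_distrib, ← Finset.sum_mul]
  push_cast
  rw [eulerDeriv]
  ring

theorem partialDeriv_eq_riemGrad (u : (Fin n → ℝ) → ℂ) {x : Fin n → ℝ} (hx : x ∈ openSimplex n)
    (i : Fin n) : partialDeriv i u x = ((x i)⁻¹ : ℝ) * riemGrad (baranSimplex n) u x i +
      ((1 - ∑ i, x i)⁻¹ : ℝ) * ∑ j, riemGrad (baranSimplex n) u x j := by
  have h0 : ((1 - ∑ i, x i : ℝ) : ℂ) ≠ 0 := Complex.ofReal_ne_zero.2 (sub_pos.2 hx.2).ne'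
  have hi : ((x i : ℝ) : ℂ) ≠ 0 := Complex.ofReal_ne_zero.2 (hx.1 i).ne'
  rw [sum_riemGrad_baranSimplex u hx, riemGrad_baranSimplex u hx, Complex.ofReal_inv,
    Complex.ofReal_inv, inv_mul_cancel_left₀ h0, inv_mul_cancel_left₀ hi]
  ring

theorem riemGrad_conj (u : (Fin n → ℝ) → ℂ) (x : Fin n → ℝ) (i : Fin n) :
    riemGrad (baranSimplex n) (fun y => (starRingEnd ℂ) (u y)) x i =
      (starRingEnd ℂ) (riemGrad (baranSimplex n) u x i) := by
  simp only [riemGrad, map_sum, map_mul, Complex.conj_ofReal, partialDeriv_conj]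

/-- The metric is diagonal in the `n + 1` barycentric components of a tangent vector, which sum to
zero. In this form positivity and Cauchy–Schwarz are evident term by term. -/
theorem gradPairing_conj_eq (u v : (Fin n → ℝ) → ℂ) {x : Fin n → ℝ} (hx : x ∈ openSimplex n) :
    gradPairing u (fun y => (starRingEnd ℂ) (v y)) x =
      ∑ i, ((x i)⁻¹ : ℝ) * (riemGrad (baranSimplex n) u x i *
        (starRingEnd ℂ) (riemGrad (baranSimplex n) v x i)) +
      ((1 - ∑ i, x i)⁻¹ : ℝ) * ((∑ j, riemGrad (baranSimplex n) u x j) *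
        (starRingEnd ℂ) (∑ j, riemGrad (baranSimplex n) v x j)) := by
  simp only [gradPairing, riemGrad_conj]
  rw [map_sum, Finset.mul_sum, Finset.mul_sum, ← Finset.sum_add_distrib]
  refine Finset.sum_congr rfl fun i _ => ?_
  rw [partialDeriv_eq_riemGrad u hx i]
  ring

theorem riemGradNormSq_baranSimplex (u : (Fin n → ℝ) → ℂ) (x : Fin n → ℝ) :
    riemGradNormSq (baranSimplex n) u x =
      ∑ i, (x i)⁻¹ * ‖riemGrad (baranSimplex n) u x i‖ ^ 2 +
      (1 - ∑ i, x i)⁻¹ * ‖∑ j, riemGrad (baranSimplex n) u x j‖ ^ 2 := by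
  have h : (∑ i, ∑ j, ((baranSimplex n x i j : ℝ) : ℂ) * riemGrad (baranSimplex n) u x i *
      (starRingEnd ℂ) (riemGrad (baranSimplex n) u x j)) =
      ((∑ i, (x i)⁻¹ * ‖riemGrad (baranSimplex n) u x i‖ ^ 2 +
      (1 - ∑ i, x i)⁻¹ * ‖∑ j, riemGrad (baranSimplex n) u x j‖ ^ 2 : ℝ) : ℂ) := by
    set X := riemGrad (baranSimplex n) u x
    push_cast
    rw [← Complex.mul_conj', map_sum, Finset.sum_mul_sum, Finset.mul_sum,
      ← Finset.sum_add_distrib]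
    refine Finset.sum_congr rfl fun i _ => ?_
    have e (j : Fin n) : ((baranSimplex n x i j : ℝ) : ℂ) =
        (if i = j then ((x i : ℝ) : ℂ)⁻¹ else 0) + (1 - ∑ i, ((x i : ℝ) : ℂ))⁻¹ := by
      simp only [baranSimplex, Matrix.add_apply, Matrix.smul_apply, Matrix.of_apply,
        Matrix.diagonal_apply]
      split_ifs <;> simp
    simp only [e, add_mul, Finset.sum_add_distrib, ite_mul, zero_mul]
    rw [Finset.sum_ite_eq Finset.univ i, if_pos (Finset.mem_univ i), ← Complex.mul_conj',
      Finset.mul_sum]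
    simp only [mul_assoc]
  rw [riemGradNormSq, h, Complex.ofReal_re]

theorem gradPairing_conj_self (u : (Fin n → ℝ) → ℂ) {x : Fin n → ℝ} (hx : x ∈ openSimplex n) :
    gradPairing u (fun y => (starRingEnd ℂ) (u y)) x =
      ((riemGradNormSq (baranSimplex n) u x : ℝ) : ℂ) := by
  rw [gradPairing_conj_eq u u hx, riemGradNormSq_baranSimplex]
  simp only [Complex.mul_conj']
  push_cast
  rfl

theorem riemGradNormSq_nonneg (u : (Fin n → ℝ) → ℂ) {x : Fin n → ℝ} (hx : x ∈ openSimplex n) :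
    0 ≤ riemGradNormSq (baranSimplex n) u x := by
  rw [riemGradNormSq_baranSimplex]
  have h0 : 0 < 1 - ∑ i, x i := sub_pos.2 hx.2
  have hi := hx.1
  exact add_nonneg (Finset.sum_nonneg fun i _ => mul_nonneg (inv_pos.2 (hi i)).le (sq_nonneg _))
    (mul_nonneg (inv_pos.2 h0).le (sq_nonneg _))

/-- The inequality `2 |a b| ≤ |a|² + |b|²` in each of the `n + 1` diagonal terms. It gives
integrability of mixed energies and the Bessel inequality. -/
theorem two_mul_norm_gradPairing_conj_le (u v : (Fin n → ℝ) → ℂ) {x : Fin n → ℝ}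
    (hx : x ∈ openSimplex n) :
    2 * ‖gradPairing u (fun y => (starRingEnd ℂ) (v y)) x‖ ≤
      riemGradNormSq (baranSimplex n) u x + riemGradNormSq (baranSimplex n) v x := by
  have h0 : 0 < 1 - ∑ i, x i := sub_pos.2 hx.2
  have key {r : ℝ} (hr : 0 < r) (a b : ℂ) :
      2 * ‖((r⁻¹ : ℝ) : ℂ) * (a * (starRingEnd ℂ) b)‖ ≤ r⁻¹ * ‖a‖ ^ 2 + r⁻¹ * ‖b‖ ^ 2 := by
    rw [norm_mul, norm_mul, RCLike.norm_conj, Complex.norm_real, Real.norm_of_nonneg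
      (inv_pos.2 hr).le]
    have := mul_le_mul_of_nonneg_left (two_mul_le_add_sq ‖a‖ ‖b‖) (inv_pos.2 hr).le
    linarith
  rw [gradPairing_conj_eq u v hx, riemGradNormSq_baranSimplex, riemGradNormSq_baranSimplex]
  have h1 := norm_add_le (∑ i, (((x i)⁻¹ : ℝ) : ℂ) * (riemGrad (baranSimplex n) u x i *
        (starRingEnd ℂ) (riemGrad (baranSimplex n) v x i)))
      ((((1 - ∑ i, x i)⁻¹ : ℝ) : ℂ) * ((∑ j, riemGrad (baranSimplex n) u x j) *
        (starRingEnd ℂ) (∑ j, riemGrad (baranSimplex n) v x j)))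
  have h2 := norm_sum_le Finset.univ fun i => (((x i)⁻¹ : ℝ) : ℂ) *
    (riemGrad (baranSimplex n) u x i * (starRingEnd ℂ) (riemGrad (baranSimplex n) v x i))
  have h3 := Finset.sum_le_sum fun (i : Fin n) (_ : i ∈ Finset.univ) =>
    key (hx.1 i) (riemGrad (baranSimplex n) u x i) (riemGrad (baranSimplex n) v x i)
  rw [← Finset.mul_sum, Finset.sum_add_distrib] at h3
  have h4 := key h0 (∑ j, riemGrad (baranSimplex n) u x j) (∑ j, riemGrad (baranSimplex n) v x j)
  linarith

theorem conj_contDiffOn {m : WithTop ℕ∞} {u : (Fin n → ℝ) → ℂ}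
    (hu : ContDiffOn ℝ m u (openSimplex n)) :
    ContDiffOn ℝ m (fun y => (starRingEnd ℂ) (u y)) (openSimplex n) :=
  Complex.conjCLE.contDiff.comp_contDiffOn hu

theorem ae_riemGradNormSq_nonneg (u : (Fin n → ℝ) → ℂ) :
    0 ≤ᵐ[baranVolume n] riemGradNormSq (baranSimplex n) u := by
  filter_upwards [ae_baranVolume_mem n] with x hx using riemGradNormSq_nonneg u hx

theorem aesm_riemGradNormSq {u : (Fin n → ℝ) → ℂ} (hu : ContDiffOn ℝ 1 u (openSimplex n)) :
    AEStronglyMeasurable (riemGradNormSq (baranSimplex n) u) (baranVolume n) := by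
  refine aesm_baranVolume ((Complex.continuous_re.comp_continuousOn
    (continuousOn_gradPairing hu (conj_contDiffOn hu))).congr fun x hx => ?_)
  rw [Function.comp_apply, gradPairing_conj_self u hx, Complex.ofReal_re]

theorem integrable_riemGradNormSq_of_mem_C2b {u : (Fin n → ℝ) → ℂ} (hu : u ∈ C2b n) :
    Integrable (riemGradNormSq (baranSimplex n) u) (baranVolume n) := by
  refine (integrable_gradPairing_of_mem_C2b hu (conj_mem_C2b hu)).re.congr ?_
  filter_upwards [ae_baranVolume_mem n] with x hx
  rw [gradPairing_conj_self u hx, RCLike.re_to_complex, Complex.ofReal_re]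

theorem integrable_gradPairing_conj {u v : (Fin n → ℝ) → ℂ}
    (hu : ContDiffOn ℝ 1 u (openSimplex n)) (hv : ContDiffOn ℝ 1 v (openSimplex n))
    (hui : Integrable (riemGradNormSq (baranSimplex n) u) (baranVolume n))
    (hvi : Integrable (riemGradNormSq (baranSimplex n) v) (baranVolume n)) :
    Integrable (gradPairing u (fun y => (starRingEnd ℂ) (v y))) (baranVolume n) := by
  refine (hui.add hvi).mono' (aesm_baranVolume (continuousOn_gradPairing hu (conj_contDiffOn hv)))
    ?_
  filter_upwards [ae_baranVolume_mem n] with x hx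
  rw [Pi.add_apply]
  have h := two_mul_norm_gradPairing_conj_le u v hx
  have := norm_nonneg (gradPairing u (fun y => (starRingEnd ℂ) (v y)) x)
  linarith

theorem simplexEigenvalue_nonneg {n : ℕ} (hn : 1 ≤ n) (s : ℕ) : 0 ≤ simplexEigenvalue n s := by
  have h : (1 : ℝ) ≤ n := by exact_mod_cast hn
  exact mul_nonneg (Nat.cast_nonneg _) (add_nonneg (Nat.cast_nonneg _) (by linarith))

/-- The polynomial `∑_{α ∈ F} c_α ψ_α`. -/
noncomputable def psiSum (F : Finset (Fin n → ℕ)) (c : (Fin n → ℕ) → ℂ) :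
    MvPolynomial (Fin n) ℂ :=
  ∑ α ∈ F, c α • psiPolyC α

theorem polyToL2_psiSum (F : Finset (Fin n → ℕ)) (c : (Fin n → ℕ) → ℂ) :
    polyToL2 n (psiSum F c) = ∑ α ∈ F, c α • psiBasis n α := by
  simp only [psiSum, map_sum, map_smul, psiBasis_apply]

theorem dunklPoly_psiSum (F : Finset (Fin n → ℕ)) (c : (Fin n → ℕ) → ℂ) :
    dunklPoly n (psiSum F c) =
      -psiSum F fun α => (simplexEigenvalue n (multiDeg α) : ℂ) * c α := by
  simp only [psiSum, map_sum, map_smul, dunklPoly_psiPolyC, smul_neg, Finset.sum_neg_distrib,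
    smul_smul, mul_comm]

theorem inner_psiSum (F : Finset (Fin n → ℕ)) (c : (Fin n → ℕ) → ℂ) (f : SimplexL2 n) :
    inner ℂ (polyToL2 n (psiSum F c)) f =
      ∑ α ∈ F, (starRingEnd ℂ) (c α) * (psiBasis n).repr f α := by
  rw [polyToL2_psiSum, sum_inner]
  simp only [inner_smul_left, HilbertBasis.repr_apply_apply]

theorem repr_psiSum {F : Finset (Fin n → ℕ)} (c : (Fin n → ℕ) → ℂ) {α : Fin n → ℕ} (hα : α ∈ F) :
    (psiBasis n).repr (polyToL2 n (psiSum F c)) α = c α := by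
  rw [HilbertBasis.repr_apply_apply, polyToL2_psiSum,
    (psiBasis n).orthonormal.inner_right_sum c hα]

/-- Green's formula against a finite sum of eigenfunctions. -/
theorem integral_gradPairing_psiSum {u : (Fin n → ℝ) → ℂ}
    (hu : ContDiffOn ℝ 1 u (openSimplex n)) (hL : MemLp u 2 (baranVolume n))
    (hui : Integrable (riemGradNormSq (baranSimplex n) u) (baranVolume n))
    (F : Finset (Fin n → ℕ)) (c : (Fin n → ℕ) → ℂ) :
    ∫ x, gradPairing u (fun y => (starRingEnd ℂ) (polyFun (psiSum F c) y)) x ∂(baranVolume n) =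
      ∑ α ∈ F, (simplexEigenvalue n (multiDeg α) : ℂ) *
        ((starRingEnd ℂ) (c α) * (psiBasis n).repr (hL.toLp u) α) := by
  have hC := polyFun_mem_C2b (psiSum F c)
  rw [integral_gradPairing_eq_neg_of_mem_C2b hu (conj_mem_C2b hC) (hL.integrable (by norm_num))
    (integrable_gradPairing_conj hu (hC.1.of_le (by norm_num)) hui
      (integrable_riemGradNormSq_of_mem_C2b hC)), ← integral_neg]
  -- The Laplacian multiplies the coefficients by `-λ`, so the Green integral is the inner product
  -- with the sum whose coefficients are `λ c`.
  have h := inner_psiSum F (fun α => (simplexEigenvalue n (multiDeg α) : ℂ) * c α) (hL.toLp u)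
  simp only [map_mul, Complex.conj_ofReal, mul_assoc] at h
  rw [← h, L2.inner_def]
  refine integral_congr_ae ?_
  filter_upwards [ae_baranVolume_mem n, hL.coeFn_toLp, coeFn_polyToL2
    (psiSum F fun α => (simplexEigenvalue n (multiDeg α) : ℂ) * c α)] with x hx h1 h2
  rw [h1, h2, RCLike.inner_apply, laplaceBeltrami_conj hC hx]
  simp only [laplaceBeltrami_eq_dunklXu hC.1 hx]
  rw [dunklXu_polyFun, dunklPoly_psiSum, ← neg_one_smul ℂ (psiSum F _), polyFun_smul]
  simp

/-- The preceding Green formula with `u` equal to the finite sum itself. -/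
theorem integral_riemGradNormSq_psiSum (F : Finset (Fin n → ℕ)) (c : (Fin n → ℕ) → ℂ) :
    ∫ x, riemGradNormSq (baranSimplex n) (polyFun (psiSum F c)) x ∂(baranVolume n) =
      ∑ α ∈ F, simplexEigenvalue n (multiDeg α) * ‖c α‖ ^ 2 := by
  have hC := polyFun_mem_C2b (psiSum F c)
  have h := integral_gradPairing_psiSum (hC.1.of_le (by norm_num)) (memLp_of_mem_C2b hC)
    (integrable_riemGradNormSq_of_mem_C2b hC) F c
  rw [integral_congr_ae (g := fun x =>
    ((riemGradNormSq (baranSimplex n) (polyFun (psiSum F c)) x : ℝ) : ℂ)) (by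
      filter_upwards [ae_baranVolume_mem n] with x hx using gradPairing_conj_self _ hx),
    integral_complex_ofReal] at h
  apply Complex.ofReal_injective
  rw [h]
  push_cast
  refine Finset.sum_congr rfl fun α hα => ?_
  change _ * (_ * (psiBasis n).repr (polyToL2 n (psiSum F c)) α) = _
  rw [repr_psiSum c hα, Complex.conj_mul']

/-- Bessel's inequality for the Dirichlet energy. -/
theorem sum_eigenvalue_mul_le_integral {u : (Fin n → ℝ) → ℂ}
    (hu : ContDiffOn ℝ 1 u (openSimplex n)) (hL : MemLp u 2 (baranVolume n))
    (hui : Integrable (riemGradNormSq (baranSimplex n) u) (baranVolume n))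
    (F : Finset (Fin n → ℕ)) :
    ∑ α ∈ F, simplexEigenvalue n (multiDeg α) * ‖(psiBasis n).repr (hL.toLp u) α‖ ^ 2 ≤
      ∫ x, riemGradNormSq (baranSimplex n) u x ∂(baranVolume n) := by
  set c : (Fin n → ℕ) → ℂ := fun α => (psiBasis n).repr (hL.toLp u) α
  set v := polyFun (psiSum F c)
  have hC : v ∈ C2b n := polyFun_mem_C2b (psiSum F c)
  have hvi := integrable_riemGradNormSq_of_mem_C2b hC
  have hg := integrable_gradPairing_conj hu (hC.1.of_le (by norm_num)) hui hvi
  have h1 := integral_gradPairing_psiSum hu hL hui F c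
  have h2 : ∫ x, riemGradNormSq (baranSimplex n) v x ∂(baranVolume n) = _ :=
    integral_riemGradNormSq_psiSum F c
  -- With `v` the partial sum of `u` over `F`, the real part of the mixed energy of `u` and `v`
  -- equals the energy of `v`, so `2 Re ℰ(u, v) ≤ ℰ(u) + ℰ(v)` becomes `ℰ(v) ≤ ℰ(u)`.
  have h3 : ∫ x, 2 * (gradPairing u (fun y => (starRingEnd ℂ) (v y)) x).re ∂(baranVolume n) ≤
      ∫ x, (riemGradNormSq (baranSimplex n) u x + riemGradNormSq (baranSimplex n) v x)
        ∂(baranVolume n) := by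
    refine integral_mono_ae (hg.re.const_mul 2) (hui.add hvi) ?_
    filter_upwards [ae_baranVolume_mem n] with x hx
    have := two_mul_norm_gradPairing_conj_le u v hx
    have := Complex.re_le_norm (gradPairing u (fun y => (starRingEnd ℂ) (v y)) x)
    linarith
  have h4 : ∫ x, (gradPairing u (fun y => (starRingEnd ℂ) (v y)) x).re ∂(baranVolume n) =
      ∑ α ∈ F, simplexEigenvalue n (multiDeg α) * ‖c α‖ ^ 2 := by
    have : ∫ x, (gradPairing u (fun y => (starRingEnd ℂ) (v y)) x).re ∂(baranVolume n) =
      (∫ x, gradPairing u (fun y => (starRingEnd ℂ) (v y)) x ∂(baranVolume n)).re := integral_re hg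
    rw [this, h1, ← Complex.ofReal_re (∑ α ∈ F, simplexEigenvalue n (multiDeg α) * ‖c α‖ ^ 2)]
    congr 1
    push_cast
    refine Finset.sum_congr rfl fun α _ => ?_
    rw [← Complex.conj_mul']
  rw [integral_const_mul, integral_add hui hvi, h4, h2] at h3
  linarith

end Energy

/-! ### The space `H¹` in terms of Fourier coefficients. -/

section Sobolev

variable {n : ℕ}

theorem sobolevNorm_eq {u : (Fin n → ℝ) → ℂ} (hL : MemLp u 2 (baranVolume n))
    (hui : Integrable (riemGradNormSq (baranSimplex n) u) (baranVolume n)) :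
    sobolevNorm (openSimplex n) (baranSimplex n) u = ENNReal.ofReal (‖hL.toLp u‖ +
      √(∫ x, riemGradNormSq (baranSimplex n) u x ∂(baranVolume n))) := by
  rw [sobolevNorm, ENNReal.ofReal_add (norm_nonneg _) (Real.sqrt_nonneg _), ofReal_norm,
    Lp.enorm_toLp, ← ofReal_integral_eq_lintegral_ofReal hui (ae_riemGradNormSq_nonneg u),
    ENNReal.ofReal_rpow_of_nonneg (integral_nonneg_of_ae (ae_riemGradNormSq_nonneg u))
      (by norm_num), Real.sqrt_eq_rpow]

theorem memLp_of_sobolevNorm_lt_top {u : (Fin n → ℝ) → ℂ}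
    (hu : ContDiffOn ℝ 1 u (openSimplex n))
    (h : sobolevNorm (openSimplex n) (baranSimplex n) u < ⊤) : MemLp u 2 (baranVolume n) :=
  ⟨aesm_baranVolume hu.continuousOn, (ENNReal.add_lt_top.1 h).1⟩

theorem integrable_of_sobolevNorm_lt_top {u : (Fin n → ℝ) → ℂ}
    (hu : ContDiffOn ℝ 1 u (openSimplex n))
    (h : sobolevNorm (openSimplex n) (baranSimplex n) u < ⊤) :
    Integrable (riemGradNormSq (baranSimplex n) u) (baranVolume n) := by
  rw [← lintegral_ofReal_ne_top_iff_integrable (aesm_riemGradNormSq hu)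
    (ae_riemGradNormSq_nonneg u)]
  exact ((ENNReal.rpow_lt_top_iff_of_pos (by norm_num)).1 (ENNReal.add_lt_top.1 h).2).ne

theorem sum_eigenvalue_mul_le_of_sobolevNorm_le {u : (Fin n → ℝ) → ℂ}
    (hu : ContDiffOn ℝ 1 u (openSimplex n)) (hL : MemLp u 2 (baranVolume n)) {C : ℝ} (hC : 0 ≤ C)
    (h : sobolevNorm (openSimplex n) (baranSimplex n) u ≤ ENNReal.ofReal C)
    (F : Finset (Fin n → ℕ)) :
    ∑ α ∈ F, simplexEigenvalue n (multiDeg α) * ‖(psiBasis n).repr (hL.toLp u) α‖ ^ 2 ≤ C ^ 2 := by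
  have hui := integrable_of_sobolevNorm_lt_top hu (h.trans_lt ENNReal.ofReal_lt_top)
  refine (sum_eigenvalue_mul_le_integral hu hL hui F).trans ?_
  rw [sobolevNorm_eq hL hui, ENNReal.ofReal_le_ofReal_iff hC] at h
  rw [← Real.sqrt_le_left hC]
  linarith [norm_nonneg (hL.toLp u)]

/-- The limit `f` need not be differentiable, so the Bessel inequality is applied to `φ k - φ N`
with a fixed `N` from the Cauchy condition. On a finite index set the bound passes to the `L²`
limit, so `f - φ N` has summable energy, and so has `φ N`. -/
theorem summable_of_mem_sobolevH1 (hn : 1 ≤ n) {f : SimplexL2 n}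
    (hf : f ∈ SobolevH1 (openSimplex n) (baranSimplex n)) :
    Summable fun α => simplexEigenvalue n (multiDeg α) * ‖(psiBasis n).repr f α‖ ^ 2 := by
  obtain ⟨φ, hφ, hcau, hlim⟩ := hf
  have hd (k : ℕ) : ContDiffOn ℝ 1 (φ k) (openSimplex n) := (hφ k).1.of_le (by simp)
  have hL (k : ℕ) := memLp_of_sobolevNorm_lt_top (hd k) (hφ k).2
  have hlam (α : Fin n → ℕ) := simplexEigenvalue_nonneg hn (multiDeg α)
  -- As membership in the domain of a linear operator, the summability is visibly stable under
  -- addition.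
  have hiff (g : SimplexL2 n) :
      (Summable fun α => simplexEigenvalue n (multiDeg α) * ‖(psiBasis n).repr g α‖ ^ 2) ↔
      g ∈ (diagOp (psiBasis n) fun α => √(simplexEigenvalue n (multiDeg α))).domain := by
    simp only [mem_diagOp_domain, Real.sq_sqrt (hlam _)]
  obtain ⟨N, hN⟩ := hcau 1 one_pos
  have hg : Summable fun α => simplexEigenvalue n (multiDeg α) *
      ‖(psiBasis n).repr ((hL N).toLp (φ N)) α‖ ^ 2 :=
    summable_of_sum_le (fun α => mul_nonneg (hlam α) (sq_nonneg _))
      fun F => sum_eigenvalue_mul_le_of_sobolevNorm_le (hd N) (hL N)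
        (C := (sobolevNorm (openSimplex n) (baranSimplex n) (φ N)).toReal) ENNReal.toReal_nonneg
        (ENNReal.ofReal_toReal (hφ N).2.ne).ge F
  have ht : Filter.Tendsto (fun k => (hL k).toLp (φ k)) Filter.atTop (nhds f) := by
    rw [Lp.tendsto_Lp_iff_tendsto_eLpNorm']
    refine hlim.congr fun k => eLpNorm_congr_ae ?_
    filter_upwards [(hL k).coeFn_toLp] with x hx
    rw [Pi.sub_apply, Pi.sub_apply, hx]
  have hdiff : Summable fun α => simplexEigenvalue n (multiDeg α) *
      ‖(psiBasis n).repr (f - (hL N).toLp (φ N)) α‖ ^ 2 := by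
    refine summable_of_sum_le (c := 1 ^ 2) (fun α => mul_nonneg (hlam α) (sq_nonneg _))
      fun F => ?_
    have hcont : Continuous fun g : SimplexL2 n => ∑ α ∈ F, simplexEigenvalue n (multiDeg α) *
        ‖(psiBasis n).repr (g - (hL N).toLp (φ N)) α‖ ^ 2 := by
      simp only [HilbertBasis.repr_apply_apply]
      fun_prop
    refine le_of_tendsto ((hcont.tendsto f).comp ht) ?_
    filter_upwards [Filter.eventually_ge_atTop N] with k hk
    rw [Function.comp_apply, ← MemLp.toLp_sub]
    refine sum_eigenvalue_mul_le_of_sobolevNorm_le ((hd k).sub (hd N)) _ zero_le_one ?_ F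
    rw [ENNReal.ofReal_one]
    exact hN k hk N le_rfl
  rw [hiff] at hg hdiff ⊢
  simpa using Submodule.add_mem _ hdiff hg

theorem norm_sq_polyToL2_psiSum (F : Finset (Fin n → ℕ)) (c : (Fin n → ℕ) → ℂ) :
    ‖polyToL2 n (psiSum F c)‖ ^ 2 = ∑ α ∈ F, ‖c α‖ ^ 2 := by
  apply Complex.ofReal_injective
  rw [Complex.ofReal_pow]
  refine (inner_self_eq_norm_sq_to_K (𝕜 := ℂ) (polyToL2 n (psiSum F c))).symm.trans ?_
  rw [inner_psiSum]
  push_cast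
  refine Finset.sum_congr rfl fun α hα => ?_
  rw [repr_psiSum c hα, Complex.conj_mul']

theorem sobolevNorm_psiSum (F : Finset (Fin n → ℕ)) (c : (Fin n → ℕ) → ℂ) :
    sobolevNorm (openSimplex n) (baranSimplex n) (polyFun (psiSum F c)) =
      ENNReal.ofReal (√(∑ α ∈ F, ‖c α‖ ^ 2) +
        √(∑ α ∈ F, simplexEigenvalue n (multiDeg α) * ‖c α‖ ^ 2)) := by
  have hC := polyFun_mem_C2b (psiSum F c)
  rw [sobolevNorm_eq (memLp_of_mem_C2b hC) (integrable_riemGradNormSq_of_mem_C2b hC),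
    integral_riemGradNormSq_psiSum, ← norm_sq_polyToL2_psiSum, Real.sqrt_sq (norm_nonneg _)]
  rfl

theorem psiSum_sub_of_subset {F F' : Finset (Fin n → ℕ)} (h : F ⊆ F') (c : (Fin n → ℕ) → ℂ) :
    psiSum F' c - psiSum F c = psiSum (F' \ F) c := by
  classical
  rw [sub_eq_iff_eq_add]
  exact (Finset.sum_sdiff h).symm

theorem neg_psiSum (F : Finset (Fin n → ℕ)) (c : (Fin n → ℕ) → ℂ) :
    -psiSum F c = psiSum F (-c) := by
  simp [psiSum]

/-- The multi-indices of degree less than `k`. -/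
noncomputable def multiDegLT (n k : ℕ) : Finset (Fin n → ℕ) := (finite_multiDeg_lt n k).toFinset

theorem mem_multiDegLT {k : ℕ} {α : Fin n → ℕ} : α ∈ multiDegLT n k ↔ multiDeg α < k := by
  simp [multiDegLT]

theorem multiDegLT_mono : Monotone (multiDegLT n) := fun _ _ h _ hα =>
  mem_multiDegLT.2 ((mem_multiDegLT.1 hα).trans_le h)

theorem tendsto_multiDegLT (n : ℕ) :
    Filter.Tendsto (multiDegLT n) Filter.atTop Filter.atTop :=
  Filter.tendsto_atTop_finset_of_monotone multiDegLT_mono fun α =>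
    ⟨multiDeg α + 1, mem_multiDegLT.2 (Nat.lt_succ_self _)⟩

/-- The Cauchy criterion for the two series; the sets `multiDegLT n N` eventually contain any given
finite set. -/
theorem exists_sobolevNorm_psiSum_le {c : (Fin n → ℕ) → ℂ} (h0 : Summable fun α => ‖c α‖ ^ 2)
    (h1 : Summable fun α => simplexEigenvalue n (multiDeg α) * ‖c α‖ ^ 2) {ε : ℝ} (hε : 0 < ε) :
    ∃ N, ∀ F : Finset (Fin n → ℕ), Disjoint F (multiDegLT n N) →
      sobolevNorm (openSimplex n) (baranSimplex n) (polyFun (psiSum F c)) ≤ ENNReal.ofReal ε := by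
  obtain ⟨s, hs⟩ := summable_iff_vanishing_norm.1 h0 ((ε / 2) ^ 2) (by positivity)
  obtain ⟨t, ht⟩ := summable_iff_vanishing_norm.1 h1 ((ε / 2) ^ 2) (by positivity)
  obtain ⟨N, hN⟩ := ((tendsto_multiDegLT n).eventually (Filter.eventually_ge_atTop (s ∪ t))).exists
  refine ⟨N, fun F hF => ?_⟩
  rw [sobolevNorm_psiSum]
  have hF' := hF.mono_right hN
  rw [Finset.disjoint_union_right] at hF'
  have a := (le_abs_self _).trans_lt (hs F hF'.1)
  have b := (le_abs_self _).trans_lt (ht F hF'.2)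
  have a' := (Real.sqrt_lt' (by positivity)).2 a
  have b' := (Real.sqrt_lt' (by positivity)).2 b
  exact ENNReal.ofReal_le_ofReal (by linarith)

/-- The approximants are the partial sums over degree below `k`. They are polynomials, hence smooth,
and their differences are tails with small Sobolev norm. -/
theorem mem_sobolevH1_of_summable {f : SimplexL2 n}
    (hf : Summable fun α => simplexEigenvalue n (multiDeg α) * ‖(psiBasis n).repr f α‖ ^ 2) :
    f ∈ SobolevH1 (openSimplex n) (baranSimplex n) := by
  have hf0 := summable_norm_sq_repr (psiBasis n) f
  set c : (Fin n → ℕ) → ℂ := fun α => (psiBasis n).repr f α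
  refine ⟨fun k => polyFun (psiSum (multiDegLT n k) c), fun k => ?_, fun ε hε => ?_, ?_⟩
  · refine ⟨(contDiff_polyFun _).contDiffOn, ?_⟩
    rw [sobolevNorm_psiSum]
    exact ENNReal.ofReal_lt_top
  · obtain ⟨δ, hδ, hδε⟩ : ∃ δ : ℝ, 0 < δ ∧ ENNReal.ofReal δ ≤ ε := by
      obtain ⟨r, hr0, hr⟩ := ENNReal.lt_iff_exists_nnreal_btwn.1 hε
      exact ⟨r, by exact_mod_cast hr0, by simpa using hr.le⟩
    obtain ⟨N, hN⟩ := exists_sobolevNorm_psiSum_le hf0 hf hδ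
    -- The second bound, for `-c`, serves the differences taken in the opposite order.
    obtain ⟨N', hN'⟩ := exists_sobolevNorm_psiSum_le (c := -c) (by simpa using hf0)
      (by simpa using hf) hδ
    have hsub (k l : ℕ) : (polyFun (psiSum (multiDegLT n k) c) -
        polyFun (psiSum (multiDegLT n l) c)) =
        polyFun (psiSum (multiDegLT n k) c - psiSum (multiDegLT n l) c) :=
      funext fun x => (polyFun_sub _ _ x).symm
    have hdis {k l M : ℕ} (hl : M ≤ l) :
        Disjoint (multiDegLT n k \ multiDegLT n l) (multiDegLT n M) :=
      Finset.sdiff_disjoint.mono_right (multiDegLT_mono hl)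
    refine ⟨max N N', fun k hk l hl => ?_⟩
    rw [hsub]
    rcases le_total l k with h | h
    · rw [psiSum_sub_of_subset (multiDegLT_mono h)]
      exact (hN _ (hdis (le_of_max_le_left hl))).trans hδε
    · rw [← neg_sub, psiSum_sub_of_subset (multiDegLT_mono h), neg_psiSum]
      exact (hN' _ (hdis (le_of_max_le_right hk))).trans hδε
  · have ht : Filter.Tendsto (fun k => polyToL2 n (psiSum (multiDegLT n k) c)) Filter.atTop
        (nhds f) := by
      have h := (psiBasis n).hasSum_repr f
      rw [HasSum, SummationFilter.unconditional_filter] at h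
      simp only [polyToL2_psiSum]
      exact h.comp (tendsto_multiDegLT n)
    rw [Lp.tendsto_Lp_iff_tendsto_eLpNorm'] at ht
    refine ht.congr fun k => eLpNorm_congr_ae ?_
    filter_upwards [coeFn_polyToL2 (psiSum (multiDegLT n k) c)] with x hx
    rw [Pi.sub_apply, Pi.sub_apply, hx]

end Sobolev

/-! ### The eigenvalue sequence and the resulting properties of the Laplacian. -/

section Spectrum

variable {n : ℕ}

/-- Distinct degrees have distinct eigenvalues, so an eigenspace is exactly the span of one degree.
-/
theorem simplexEigenvalue_strictMono (hn : 1 ≤ n) : StrictMono (simplexEigenvalue n) := by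
  intro s t hst
  have h : (1 : ℝ) ≤ n := by exact_mod_cast hn
  have hs : (0 : ℝ) ≤ s := Nat.cast_nonneg s
  have ht : (s : ℝ) < t := by exact_mod_cast hst
  unfold simplexEigenvalue
  exact mul_lt_mul'' ht (by linarith) hs (by linarith)

theorem natCast_le_simplexEigenvalue (hn : 1 ≤ n) (s : ℕ) : (s : ℝ) ≤ simplexEigenvalue n s := by
  have h : (1 : ℝ) ≤ n := by exact_mod_cast hn
  have hs : (0 : ℝ) ≤ s := Nat.cast_nonneg s
  have h1 : (s : ℝ) ≤ s * s := by exact_mod_cast Nat.le_mul_self s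
  unfold simplexEigenvalue
  nlinarith

theorem multiDeg_surjective (hn : 1 ≤ n) : Function.Surjective (multiDeg (n := n)) := fun s =>
  ⟨Pi.single ⟨0, hn⟩ s, Finset.sum_pi_single' _ _ _ |>.trans (if_pos (Finset.mem_univ _))⟩

theorem setOf_simplexEigenvalue_eq (hn : 1 ≤ n) (s : ℕ) :
    {α : Fin n → ℕ | simplexEigenvalue n (multiDeg α) = simplexEigenvalue n s} =
      {α | multiDeg α = s} := by
  ext α
  exact (simplexEigenvalue_strictMono hn).injective.eq_iff

theorem finite_multiDeg_eq (n s : ℕ) : {α : Fin n → ℕ | multiDeg α = s}.Finite :=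
  (finite_multiDeg_lt n (s + 1)).subset fun _ hα => Nat.lt_succ_of_le (le_of_eq hα)

theorem range_simplexEigenvalue_multiDeg (hn : 1 ≤ n) :
    (Set.range fun α : Fin n → ℕ => (simplexEigenvalue n (multiDeg α) : ℂ)) =
      Set.range fun s : ℕ => (simplexEigenvalue n s : ℂ) :=
  (multiDeg_surjective hn).range_comp fun s => (simplexEigenvalue n s : ℂ)

/-- The eigenvalues tend to infinity, so the distance from `z` to them attains its minimum, which is
positive when `z` is none of them. -/
theorem exists_le_norm_simplexEigenvalue_sub (hn : 1 ≤ n) (z : ℂ)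
    (hz : ∀ α : Fin n → ℕ, z ≠ simplexEigenvalue n (multiDeg α)) :
    ∃ δ > 0, ∀ α : Fin n → ℕ, δ ≤ ‖(simplexEigenvalue n (multiDeg α) : ℂ) - z‖ := by
  have ht : Filter.Tendsto (fun s : ℕ => ‖(simplexEigenvalue n s : ℂ) - z‖) Filter.cofinite
      Filter.atTop := by
    rw [Nat.cofinite_eq_atTop]
    refine Filter.tendsto_atTop_mono (fun s => ?_)
      (Filter.tendsto_atTop_add_const_right _ (-‖z‖) tendsto_natCast_atTop_atTop)
    have h1 := norm_sub_norm_le (simplexEigenvalue n s : ℂ) z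
    rw [Complex.norm_real, Real.norm_of_nonneg (simplexEigenvalue_nonneg hn s)] at h1
    linarith [natCast_le_simplexEigenvalue hn s]
  obtain ⟨s, hs⟩ := ht.exists_forall_le
  obtain ⟨α, rfl⟩ := multiDeg_surjective hn s
  exact ⟨_, norm_pos_iff.2 (sub_ne_zero.2 (hz α).symm), fun β => hs (multiDeg β)⟩

theorem neg_simplexLaplacian_graph_le (n : ℕ) : (-simplexLaplacian n).graph ≤
    (diagOp (psiBasis n) fun α => simplexEigenvalue n (multiDeg α)).graph := by
  rintro ⟨u, v⟩ h
  have h' := graph_le_diagOp_of_symmetric (simplexLaplacian_isFormalAdjoint n)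
    psiBasis_mem_simplexLaplacian_graph (LinearPMap.mem_neg_graph.1 h)
  rw [← neg_diagOp, LinearPMap.mem_neg_graph, neg_neg] at h'
  exact h'

theorem psiBasis_mem_neg_simplexLaplacian_graph (α : Fin n → ℕ) :
    (psiBasis n α, (simplexEigenvalue n (multiDeg α) : ℂ) • psiBasis n α) ∈
      (-simplexLaplacian n).graph := by
  have h := psiBasis_mem_simplexLaplacian_graph α
  rwa [Complex.ofReal_neg, neg_smul, ← LinearPMap.mem_neg_graph] at h

theorem neg_closure_simplexLaplacian (n : ℕ) : -(simplexLaplacian n).closure =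
    diagOp (psiBasis n) fun α => simplexEigenvalue n (multiDeg α) := by
  rw [closure_eq_diagOp (simplexLaplacian_isFormalAdjoint n) psiBasis_mem_simplexLaplacian_graph,
    neg_diagOp]
  simp only [neg_neg]

theorem closure_simplexLaplacian_domain (n : ℕ) :
    ((simplexLaplacian n).closure.domain : Set (SimplexL2 n)) = {u | Summable fun α =>
      simplexEigenvalue n (multiDeg α) ^ 2 * ‖fourierCoeffSimplex u α‖ ^ 2} := by
  rw [closure_eq_diagOp (simplexLaplacian_isFormalAdjoint n) psiBasis_mem_simplexLaplacian_graph]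
  ext u
  simp only [SetLike.mem_coe, mem_diagOp_domain, neg_sq, fourierCoeffSimplex_eq,
    Set.mem_ofPred_eq]

/-- On unit eigenvectors of degree `s` the norm of the image is `λ_s ≥ s`, which exceeds any
constant. -/
theorem not_bounded_simplexLaplacian (hn : 1 ≤ n) : ¬ ∃ C : ℝ, ∀ u : (simplexLaplacian n).domain,
    ‖simplexLaplacian n u‖ ≤ C * ‖(u : SimplexL2 n)‖ := by
  rintro ⟨C, hC⟩
  obtain ⟨s, hs⟩ := exists_nat_gt C
  obtain ⟨α, rfl⟩ := multiDeg_surjective hn s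
  obtain ⟨u, hu, hu'⟩ :=
    (LinearPMap.mem_graph_iff _).1 (psiBasis_mem_simplexLaplacian_graph α)
  simp only at hu hu'
  have h := hC u
  rw [hu', hu, norm_smul, (psiBasis n).orthonormal.1 α, mul_one, mul_one, Complex.norm_real,
    norm_neg, Real.norm_of_nonneg (simplexEigenvalue_nonneg hn _)] at h
  linarith [natCast_le_simplexEigenvalue hn (multiDeg α)]

theorem sqrt_domain_eq (hn : 1 ≤ n) :
    ((diagOp (psiBasis n) fun α => √(simplexEigenvalue n (multiDeg α))).domain :
      Set (SimplexL2 n)) = {u | Summable fun α =>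
        simplexEigenvalue n (multiDeg α) * ‖fourierCoeffSimplex u α‖ ^ 2} := by
  ext u
  simp only [SetLike.mem_coe, mem_diagOp_domain, fourierCoeffSimplex_eq, Set.mem_ofPred_eq,
    Real.sq_sqrt (simplexEigenvalue_nonneg hn _)]

theorem setOf_summable_eq_sobolevH1 (hn : 1 ≤ n) :
    {u : SimplexL2 n | Summable fun α =>
      simplexEigenvalue n (multiDeg α) * ‖fourierCoeffSimplex u α‖ ^ 2} =
      SobolevH1 (openSimplex n) (baranSimplex n) := by
  ext u
  simp only [fourierCoeffSimplex_eq, Set.mem_ofPred_eq]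
  exact ⟨mem_sobolevH1_of_summable, summable_of_mem_sobolevH1 hn⟩

theorem closure_simplexLaplacian_domain_subset (hn : 1 ≤ n) :
    ((simplexLaplacian n).closure.domain : Set (SimplexL2 n)) ⊆
      SobolevH1 (openSimplex n) (baranSimplex n) := by
  rw [closure_simplexLaplacian_domain, ← setOf_summable_eq_sobolevH1 hn]
  intro u hu
  have h0 := summable_norm_sq_repr (psiBasis n) u
  simp only [Set.mem_ofPred_eq, fourierCoeffSimplex_eq] at hu ⊢
  refine Summable.of_nonneg_of_le
    (fun α => mul_nonneg (simplexEigenvalue_nonneg hn _) (sq_nonneg _)) (fun α => ?_) (h0.add hu)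
  -- This bound dominates the series for `H¹` by the sum of the `L²` series and the series for the
  -- domain.
  have h1 : simplexEigenvalue n (multiDeg α) ≤ 1 + simplexEigenvalue n (multiDeg α) ^ 2 := by
    nlinarith [sq_nonneg (simplexEigenvalue n (multiDeg α) - 1),
      simplexEigenvalue_nonneg hn (multiDeg α)]
  have h2 := mul_le_mul_of_nonneg_right h1 (sq_nonneg ‖(psiBasis n).repr u α‖)
  linarith

end Spectrum

theorem theorem1p2 (n : ℕ) (hn : 1 ≤ n) :
    -- the metric is Riemannian, and the measure is its volume
    (∀ x ∈ openSimplex n, (baranSimplex n x).PosDef) ∧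
    simplexMeasure n = riemVolume (openSimplex n) (baranSimplex n) ∧
    -- the Laplace–Beltrami operator is the Dunkl–Xu operator
    (∀ u : (Fin n → ℝ) → ℂ, ContDiffOn ℝ 2 u (openSimplex n) → ∀ x ∈ openSimplex n,
      laplaceBeltrami (baranSimplex n) u x = dunklXu n u x) ∧
    -- the `ψ_α` are polynomials of degree `|α|`, orthonormal for the measure
    (∀ α : Fin n → ℕ, ∃ p : MvPolynomial (Fin n) ℝ, p.totalDegree = multiDeg α ∧
      ∀ x ∈ openSimplex n, psi α x = MvPolynomial.eval x p) ∧
    (∀ α β : Fin n → ℕ,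
      ∫ x, psi α x * psi β x ∂(simplexMeasure n) = if α = β then 1 else 0) ∧
    (∀ u ∈ C2b n, MemLp u 2 (riemVolume (openSimplex n) (baranSimplex n)) ∧
      MemLp (laplaceBeltrami (baranSimplex n) u) 2
        (riemVolume (openSimplex n) (baranSimplex n))) ∧
    -- `Δ` is the operator in `L²` with domain `C²_b`
    ∃ Δ : SimplexL2 n →ₗ.[ℂ] SimplexL2 n,
      (∀ f h : SimplexL2 n, (f, h) ∈ Δ.graph ↔ ∃ u ∈ C2b n,
        (f : (Fin n → ℝ) → ℂ) =ᵐ[riemVolume (openSimplex n) (baranSimplex n)] u ∧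
        (h : (Fin n → ℝ) → ℂ) =ᵐ[riemVolume (openSimplex n) (baranSimplex n)]
          laplaceBeltrami (baranSimplex n) u) ∧
      -- it is densely defined, symmetric and unbounded
      Dense (Δ.domain : Set (SimplexL2 n)) ∧
      Δ.IsFormalAdjoint Δ ∧
      (¬ ∃ C : ℝ, ∀ u : Δ.domain, ‖Δ u‖ ≤ C * ‖(u : SimplexL2 n)‖) ∧
      -- eigenvalues and eigenspaces of `-Δ` on `C²_b`; completeness of the eigenfunctions
      opEigenvalues (-Δ) = Set.range (fun s : ℕ => (simplexEigenvalue n s : ℂ)) ∧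
      (∀ s : ℕ, opEigenspace (-Δ) (simplexEigenvalue n s : ℂ) =
        (Submodule.span ℂ (psiClasses n s) : Set (SimplexL2 n))) ∧
      Dense (Submodule.span ℂ (⋃ s, psiClasses n s) : Set (SimplexL2 n)) ∧
      -- the closure is self-adjoint, with spectrum the same eigenvalues and eigenspaces
      Δ.IsClosable ∧
      IsSelfAdjoint Δ.closure ∧
      opSpectrum (-Δ.closure) = Set.range (fun s : ℕ => (simplexEigenvalue n s : ℂ)) ∧
      (∀ s : ℕ, opEigenspace (-Δ.closure) (simplexEigenvalue n s : ℂ) =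
        (Submodule.span ℂ (psiClasses n s) : Set (SimplexL2 n))) ∧
      -- the domain of the closure
      (Δ.closure.domain : Set (SimplexL2 n)) =
        {u | Summable fun α : Fin n → ℕ =>
          simplexEigenvalue n (multiDeg α) ^ 2 * ‖fourierCoeffSimplex u α‖ ^ 2} ∧
      (Δ.closure.domain : Set (SimplexL2 n)) ⊆ SobolevH1 (openSimplex n) (baranSimplex n) ∧
      -- the nonnegative self-adjoint square root of `-Δ` and its domain
      ∃ B : SimplexL2 n →ₗ.[ℂ] SimplexL2 n,
        IsPosSqrt B (-Δ.closure) ∧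
        (∀ B' : SimplexL2 n →ₗ.[ℂ] SimplexL2 n, IsPosSqrt B' (-Δ.closure) → B' = B) ∧
        (B.domain : Set (SimplexL2 n)) =
          {u | Summable fun α : Fin n → ℕ =>
            simplexEigenvalue n (multiDeg α) * ‖fourierCoeffSimplex u α‖ ^ 2} ∧
        (B.domain : Set (SimplexL2 n)) = SobolevH1 (openSimplex n) (baranSimplex n) := by

  have hsym := simplexLaplacian_isFormalAdjoint n
  have hb := psiBasis_mem_simplexLaplacian_graph (n := n)
  have hcl := closure_eq_diagOp hsym hb
  have hneg := neg_closure_simplexLaplacian n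
  have hlam := fun α : Fin n → ℕ => simplexEigenvalue_nonneg hn (multiDeg α)
  have hfin (s : ℕ) :
      {α : Fin n → ℕ | simplexEigenvalue n (multiDeg α) = simplexEigenvalue n s}.Finite := by
    rw [setOf_simplexEigenvalue_eq hn]
    exact finite_multiDeg_eq n s
  refine ⟨fun x hx => baranSimplex_posDef hx, simplexMeasure_eq_riemVolume n,
    fun u hu x hx => laplaceBeltrami_eq_dunklXu hu hx,
    fun α => ⟨psiMvPoly α, totalDegree_psiMvPoly α, fun x hx => psi_eq_eval α hx⟩,
    integral_psi_mul, fun u hu => ⟨memLp_of_mem_C2b hu, memLp_laplaceBeltrami hu⟩,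
    simplexLaplacian n, mem_simplexLaplacian_graph,
    dense_of_basis_mem (psiBasis n) _ fun α => LinearPMap.mem_domain_of_mem_graph (hb α), hsym,
    not_bounded_simplexLaplacian hn, ?_, fun s => ?_, ?_, isClosable_of_symmetric_of_basis hsym hb,
    ?_, ?_, fun s => ?_, closure_simplexLaplacian_domain n,
    closure_simplexLaplacian_domain_subset hn,
    diagOp (psiBasis n) fun α => √(simplexEigenvalue n (multiDeg α)), ?_, fun B' hB' => ?_,
    sqrt_domain_eq hn, (sqrt_domain_eq hn).trans (setOf_summable_eq_sobolevH1 hn)⟩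
  · rw [opEigenvalues_eq_range _ _ (neg_simplexLaplacian_graph_le n)
      psiBasis_mem_neg_simplexLaplacian_graph, range_simplexEigenvalue_multiDeg hn]
  · rw [opEigenspace_eq_span _ _ (neg_simplexLaplacian_graph_le n)
      psiBasis_mem_neg_simplexLaplacian_graph _ (hfin s), setOf_simplexEigenvalue_eq hn,
      psiClasses_eq]
  · refine dense_of_basis_mem (psiBasis n) _ fun α => Submodule.subset_span ?_
    rw [Set.mem_iUnion]
    exact ⟨multiDeg α, α, rfl, coeFn_psiBasis α⟩
  · rw [hcl]
    exact diagOp_isSelfAdjoint _ _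
  · rw [hneg, opSpectrum_diagOp _ _ (exists_le_norm_simplexEigenvalue_sub hn),
      range_simplexEigenvalue_multiDeg hn]
  · rw [hneg, opEigenspace_eq_span _ _ le_rfl (basis_mem_diagOp_graph _ _) _ (hfin s),
      setOf_simplexEigenvalue_eq hn, psiClasses_eq]
  · rw [hneg]
    exact isPosSqrt_diagOp _ _ hlam
  · rw [hneg] at hB'
    exact hB'.eq_diagOp _ _ hlam
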